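/- **Setting.** Let $d,n,k$ be positive integers with $k\le d$, and let $1\ge p_1\ge\dots\ge p_d>0$. The law $\mathcal D$ on $\{0,1,-1\}^d$ has independent coordinates with $\mathbb P(x_j=0)=1-p_j$ and $\mathbb P(x_j=1)=\mathbb P(x_j=-1)=p_j/2$. The data matrix $X\in\mathbb R^{n\times d}$ has i.i.d. rows of law $\mathcal D$, the labels are $y=X\beta^*+\xi$ with $\xi\sim\mathcal N(0,\sigma^2 I_n)$ independent of $X$ and $0\le\sigma\le1$, and $|\beta^*_j|\le B$ for all $j$. The estimator is $\hat\beta=(X^\top X)^\dagger X^\top y$, and its test loss is $\mathbb E_{x\sim\mathcal D}[(\hat\beta^\top x-\beta^{*\top}x)^2]$. Write $p_{>k}=\sum_{i>k}p_i$, and let $\mathbb E_{X_{\le k}}$ be the expectation over the first $k$ columns of $X$ only, the other columns $X_{>k}$ and the noise $\xi$ being kept fixed. For an integer $K$ put $c_{\log}=(\ln d)^K$; the regime is $c_{\log}<k<n/c_{\log}<d/c_{\log}^2$. **Theorem.** There are a constant $c_0>0$ and an integer $K$ such that the following hold. 1. (General frequencies.) For all constants $0<c_1\le c_2$, $c_p>0$,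 $B$, $A$ there are $C>0$ and $d_0$, depending only on these constants, such that, whenever $d\ge d_0$, the regime above holds, $$c_1\ln^2 d\le np_k\le c_2\ln^2 d,\qquad p_{>k}\le 1-c_p,\qquad np_{>k}^2<c_0,\qquad p_{>k}+\sigma^2\ge d^{-A},$$ then with probability at least $0.99$ over the data generation $$\mathbb E_{X_{\le k}}\big[\mathbb E_{x\sim\mathcal D}[(\hat\beta^\top x-\beta^{*\top}x)^2]\big]\le C\Big(p_{>k}+\sigma^2\Big(\frac{k\ln d}{n}+\Big(\frac{k^2\ln^2 d}{n}+\ln d\Big)p_{>k}\ln d\Big)\Big).$$ 2. (Power law.) For all constants $\alpha>2$, $0<c_1\le c_2$, $B$ there are $\eta>0$, $C>0$ and $d_0$, depending only on these constants, such that, if $p_i=\min\{1,s\,i^{-\alpha}/Z_\alpha\}$ with $Z_\alpha=\sum_{i\le d}i^{-\alpha}$ and $s>0$, and $d\ge d_0$, the regime above holds, $s+\ln d<n^\eta$ and $c_1\ln^2 d\le np_k\le c_2\ln^2 d$, then with probability at least $0.99$ over the data generation $$\mathbb E_{X_{\le k}}\big[\mathbb E_{x\sim\mathcal D}[(\hat\beta^\top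 x-\beta^{*\top}x)^2]\big]\le C\Big(s\Big(\frac{\ln^2 d}{ns}\Big)^{1-\frac1\alpha}+\sigma^2\Big(\frac{\ln^2 d}{ns}\Big)^{1-\frac1\alpha}s\ln^5 d\Big).$$ -/

import Mathlib

open MeasureTheory ProbabilityTheory

noncomputable section

/-- Law of one coordinate: `0` with probability `1 - q`, and `1`, `-1` with probability `q / 2`
each. -/
def featureLaw (q : ℝ) : Measure ℝ :=
  ENNReal.ofReal (1 - q) • Measure.dirac 0 + ENNReal.ofReal (q / 2) • Measure.dirac 1 +
    ENNReal.ofReal (q / 2) • Measure.dirac (-1)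

instance featureLaw.instSigmaFinite (q : ℝ) : SigmaFinite (featureLaw q) := by
  have : IsFiniteMeasure (featureLaw q) := by
    refine ⟨?_⟩
    simp [featureLaw]
  infer_instance

/-- Law `𝒟` of one data vector: independent coordinates, the `j`-th one with frequency `p j`. -/
def sampleLaw {d : ℕ} (p : Fin d → ℝ) : Measure (Fin d → ℝ) :=
  Measure.pi fun j => featureLaw (p j)

instance sampleLaw.instSigmaFinite {d : ℕ} (p : Fin d → ℝ) : SigmaFinite (sampleLaw p) := by
  unfold sampleLaw; infer_instance

/-- Law of the data matrix: `n` independent rows with law `𝒟`. -/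
def designLaw (n : ℕ) {d : ℕ} (p : Fin d → ℝ) : Measure (Fin n → Fin d → ℝ) :=
  Measure.pi fun _ => sampleLaw p

/-- Law of the label noise: `n` independent centred Gaussians of variance `σ ^ 2`
(the point mass at `0` if `σ = 0`). -/
def noiseLaw (n : ℕ) (σ : ℝ) : Measure (Fin n → ℝ) :=
  Measure.pi fun _ => gaussianReal 0 (Real.toNNReal (σ ^ 2))

/-- Joint law of the data matrix and the label noise, which are independent. -/
def dataLaw (n : ℕ) {d : ℕ} (p : Fin d → ℝ) (σ : ℝ) :
    Measure ((Fin n → Fin d → ℝ) × (Fin n → ℝ)) :=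
  (designLaw n p).prod (noiseLaw n σ)

/-- Moore-Penrose inverse of a real symmetric matrix: in an orthonormal basis of eigenvectors,
every nonzero eigenvalue is inverted and the eigenvalue `0` is kept (`0⁻¹ = 0`). -/
def symPinv {d : ℕ} (A : Matrix (Fin d) (Fin d) ℝ) (hA : A.IsHermitian) :
    Matrix (Fin d) (Fin d) ℝ :=
  (hA.eigenvectorUnitary : Matrix (Fin d) (Fin d) ℝ) *
    Matrix.diagonal (fun i => (hA.eigenvalues i)⁻¹) *
    star (hA.eigenvectorUnitary : Matrix (Fin d) (Fin d) ℝ)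

theorem gram_isHermitian {n d : ℕ} (X : Matrix (Fin n) (Fin d) ℝ) :
    (X.transpose * X).IsHermitian := by
  simpa [Matrix.conjTranspose_eq_transpose_of_trivial] using
    Matrix.isHermitian_conjTranspose_mul_self X

/-- The estimator `β̂ = (XᵀX)† Xᵀ y`. -/
def minNormEstimator {n d : ℕ} (X : Matrix (Fin n) (Fin d) ℝ) (y : Fin n → ℝ) : Fin d → ℝ :=
  Matrix.mulVec (symPinv (X.transpose * X) (gram_isHermitian X)) (Matrix.mulVec X.transpose y)

/-- In-distribution test loss `𝔼_{x ∼ 𝒟} (⟨β, x⟩ - ⟨β', x⟩)²`. -/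
def testLoss {d : ℕ} (p : Fin d → ℝ) (β β' : Fin d → ℝ) : ℝ :=
  ∫ x, (β ⬝ᵥ x - β' ⬝ᵥ x) ^ 2 ∂(sampleLaw p)

/-- The test loss of the estimator computed from the data matrix `X` and the labels
`y = X β* + ξ`. -/
def trainedLoss {n d : ℕ} (p βstar : Fin d → ℝ) (X : Fin n → Fin d → ℝ) (ξ : Fin n → ℝ) : ℝ :=
  testLoss p
    (minNormEstimator (Matrix.of X) (Matrix.mulVec (Matrix.of X) βstar + ξ)) βstar

/-- The data matrix whose first `k` columns are those of `X'` and whose other columns are those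
of `X`. -/
def replaceCommon {n d : ℕ} (k : ℕ) (X' X : Fin n → Fin d → ℝ) : Fin n → Fin d → ℝ :=
  fun i j => if (j : ℕ) < k then X' i j else X i j

/-- `𝔼_{X_{≤ k}}` of the test loss: the entries of the first `k` columns of the data matrix are
averaged out, while the other columns and the noise stay as they are in `ω`. As all entries of
the data matrix and the noise are independent, this is the conditional expectation of the loss
given `(X_{> k}, ξ)`; the law of the data matrix has finite support, so that the integral
exists. -/
def commonAveragedLoss {n d : ℕ} (k : ℕ) (p βstar : Fin d → ℝ)
    (ω : (Fin n → Fin d → ℝ) × (Fin n → ℝ)) : ℝ :=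
  ∫ X', trainedLoss p βstar (replaceCommon k X' ω.1) ω.2 ∂(designLaw n p)

/-- Tail probability `p_{> k}`; features are numbered from `0`, so that these are the features
with index at least `k`. -/
def tailProb {d : ℕ} (p : Fin d → ℝ) (k : ℕ) : ℝ :=
  ∑ i : Fin d, if k ≤ (i : ℕ) then p i else 0

/-- `1 ≥ p_1 ≥ … ≥ p_d > 0`. -/
def IsFeatureFrequency {d : ℕ} (p : Fin d → ℝ) : Prop :=
  Antitone p ∧ ∀ i, 0 < p i ∧ p i ≤ 1

/-- Power-law frequencies `p_i = min {1, s i^{-α} / Z}` with `Z = ∑_{i ≤ d} i^{-α}`. -/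
def powerLawFreq (d : ℕ) (α s : ℝ) : Fin d → ℝ :=
  fun i => min 1 (s * ((i : ℝ) + 1) ^ (-α) / ∑ j : Fin d, ((j : ℝ) + 1) ^ (-α))

/-- The size regime `c < k < n / c < d / c ^ 2` with the polylogarithmic factor
`c = (ln d) ^ K`. -/
def SizeRegime (K d n k : ℕ) : Prop :=
  Real.log d ^ K < k ∧ (k : ℝ) < n / Real.log d ^ K ∧
    (n : ℝ) / Real.log d ^ K < d / (Real.log d ^ K) ^ 2

end

/-! Call the first k columns common, the others rare, and a row pure if it has no rare entry. Write
L = ln d. Since n p_{>k}² is small, with probability at least 199/200 over the rare columns every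
row has at most one rare entry and at least half of the rows are pure (`prob_rare_good`). Such rare
columns are then fixed and only the common ones vary. The error of the estimator is a bias vector in
the kernel of X plus a linear image of the noise, and the loss is the sum of p_j times the squared
j-th coordinate (`testLoss_eq`).

The good event is that, on the pure rows, no common column j has squared distance below n p_j / 16
from the span of the other common ones. It fails with probability at most exp(2L - cL²/128), because
a sparse random column is far from a fixed subspace of dimension much smaller than n
(`prob_columnVec_near_le`). On it the bias vanishes on the common columns, hence on every rare
column that occurs in the data, since such an entry is alone among the rare ones of its row; the
unseen features cost at most B² p_{>k} (`bias_le_of_good`). The noise variance of coordinate j is σ²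
times the j-th diagonal entry of (XᵀX)†, which is at most ‖z‖² for every z with Xᵀz = e_j
(`gramPinv_diag_le`). For common j a z supported on the pure rows costs 16/(n p_j). For a seen rare
j the cost is 1 plus the leverage of an impure row, which is independent of the pure Gram matrix, so
that its mean is at most 16k/n.

The difficulty is the mean of (XᵀX)† on the bad event. Integrality bounds the product of the nonzero
eigenvalues of an integer Gram matrix below by 1 (`eigenvalue_gram_ge`), but for k columns this only
gives eigenvalues above d^{-O(k)}, useless against exp(-cL²). The remedy is to grade the degeneracy
by its size. A pair T ⊆ T' of column sets with |T| = t, |T'| ≤ Mt is bad if some v with entries of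
size at least 1 on T is nearly orthogonal to all pure rows restricted to T'. If no bad pair has size
above t, then all but the t largest common entries of an eigenvector are controlled by the root of
its eigenvalue (`sorted_entry_le`), and integrality is needed for t columns only. The inverse
eigenvalue is therefore at most d^{4s+6t+12} with s about log_M k (`one_le_mul_eigenvalue`,
`eigBound_le`). A bad pair of size t has probability at most exp(-t(cL²/16 - 7ML))
(`prob_badPair_le`, `prob_badSize_le_exp`), which wins for every t; all these terms together
contribute at most 1/d (`bad_terms_le`).

Markov's inequality for the noise finishes the general bound. For power laws n p_k ≍ L² determines k
up to constants, and α > 2 makes n p_{>k}² small, so that the general bound applies. -/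

noncomputable section

set_option linter.unusedSectionVars false
set_option linter.unusedDecidableInType false
set_option linter.unusedFintypeInType false

/-! ### Finite product weights -/

/-- A family of probability weights on a finite type. -/
structure IsWeight {I α : Type*} [Fintype α] (w : I → α → ℝ) : Prop where
  nonneg : ∀ i a, 0 ≤ w i a
  sum_eq_one : ∀ i, ∑ a, w i a = 1

/-- Expectation under the product of the weights `w i`. -/
def avg {I α : Type*} [Fintype I] [DecidableEq I] [Fintype α] (w : I → α → ℝ)
    (f : (I → α) → ℝ) : ℝ :=
  ∑ Z : I → α, (∏ i, w i (Z i)) * f Z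

/-- Probability under the product of the weights `w i`. -/
def prob {I α : Type*} [Fintype I] [DecidableEq I] [Fintype α] (w : I → α → ℝ)
    (S : Set (I → α)) : ℝ :=
  avg w (S.indicator 1)

section avg

variable {I α : Type*} [Fintype I] [DecidableEq I] [Fintype α] {w : I → α → ℝ}

theorem avg_prod (w g : I → α → ℝ) :
    avg w (fun Z => ∏ i, g i (Z i)) = ∏ i, ∑ a, w i a * g i a := by
  classical
  rw [Finset.prod_univ_sum, Fintype.piFinset_univ]
  simp only [avg, Finset.prod_mul_distrib]

theorem avg_add (w : I → α → ℝ) (f g : (I → α) → ℝ) :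
    avg w (fun Z => f Z + g Z) = avg w f + avg w g := by
  simp [avg, mul_add, Finset.sum_add_distrib]

theorem avg_const_mul (w : I → α → ℝ) (c : ℝ) (f : (I → α) → ℝ) :
    avg w (fun Z => c * f Z) = c * avg w f := by
  simp only [avg, Finset.mul_sum]
  exact Finset.sum_congr rfl fun _ _ => by ring

theorem avg_sum {J : Type*} (w : I → α → ℝ) (s : Finset J) (f : J → (I → α) → ℝ) :
    avg w (fun Z => ∑ j ∈ s, f j Z) = ∑ j ∈ s, avg w (f j) := by
  simp only [avg, Finset.mul_sum]
  exact Finset.sum_comm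

theorem IsWeight.total (hw : IsWeight w) : ∑ Z : I → α, ∏ i, w i (Z i) = 1 := by
  have := avg_prod w (fun _ _ => 1)
  simpa [avg, hw.sum_eq_one] using this

theorem IsWeight.prod_nonneg (hw : IsWeight w) (Z : I → α) : 0 ≤ ∏ i, w i (Z i) :=
  Finset.prod_nonneg fun i _ => hw.nonneg i _

theorem avg_const (hw : IsWeight w) (c : ℝ) : avg w (fun _ => c) = c := by
  simp [avg, ← Finset.sum_mul, hw.total]

theorem avg_mono (hw : IsWeight w) {f g : (I → α) → ℝ} (h : ∀ Z, f Z ≤ g Z) :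
    avg w f ≤ avg w g :=
  Finset.sum_le_sum fun Z _ => mul_le_mul_of_nonneg_left (h Z) (hw.prod_nonneg Z)

theorem avg_nonneg (hw : IsWeight w) {f : (I → α) → ℝ} (h : ∀ Z, 0 ≤ f Z) : 0 ≤ avg w f :=
  Finset.sum_nonneg fun Z _ => mul_nonneg (hw.prod_nonneg Z) (h Z)

theorem avg_le_of_le (hw : IsWeight w) {f : (I → α) → ℝ} {c : ℝ} (h : ∀ Z, f Z ≤ c) :
    avg w f ≤ c :=
  (avg_mono hw h).trans_eq (avg_const hw c)

theorem prob_nonneg (hw : IsWeight w) (S : Set (I → α)) : 0 ≤ prob w S :=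
  avg_nonneg hw fun Z => Set.indicator_nonneg (fun _ _ => zero_le_one) Z

theorem prob_le_avg (hw : IsWeight w) {S : Set (I → α)} {f : (I → α) → ℝ}
    (hf : ∀ Z, 0 ≤ f Z) (h : ∀ Z ∈ S, 1 ≤ f Z) : prob w S ≤ avg w f := by
  refine avg_mono hw fun Z => ?_
  by_cases hZ : Z ∈ S
  · simpa [hZ] using h Z hZ
  · simpa [hZ] using hf Z

theorem prob_mono (hw : IsWeight w) {S T : Set (I → α)} (h : S ⊆ T) : prob w S ≤ prob w T :=
  avg_mono hw fun Z => Set.indicator_le_indicator_of_subset h (fun _ => zero_le_one) Z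

theorem prob_le_one (hw : IsWeight w) (S : Set (I → α)) : prob w S ≤ 1 :=
  avg_le_of_le hw fun Z => Set.indicator_le_self' (fun _ _ => zero_le_one) Z

theorem prob_union_le (hw : IsWeight w) (S T : Set (I → α)) :
    prob w (S ∪ T) ≤ prob w S + prob w T := by
  rw [prob, prob, prob, ← avg_add]
  refine avg_mono hw fun Z => ?_
  by_cases hS : Z ∈ S <;> by_cases hT : Z ∈ T <;> simp [hS, hT]

theorem prob_biUnion_le {J : Type*} (hw : IsWeight w) (s : Finset J) (S : J → Set (I → α)) :
    prob w {Z | ∃ j ∈ s, Z ∈ S j} ≤ ∑ j ∈ s, prob w (S j) := by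
  simp only [prob]
  rw [← avg_sum]
  refine avg_mono hw fun Z => ?_
  have h0 : ∀ j ∈ s, 0 ≤ (S j).indicator (1 : (I → α) → ℝ) Z :=
    fun j _ => Set.indicator_nonneg (fun _ _ => zero_le_one) Z
  by_cases hZ : ∃ j ∈ s, Z ∈ S j
  · obtain ⟨j, hj, hZj⟩ := hZ
    have : Z ∈ {Z | ∃ j ∈ s, Z ∈ S j} := ⟨j, hj, hZj⟩
    rw [Set.indicator_of_mem this]
    have := Finset.single_le_sum h0 hj
    simpa [hZj] using this
  · rw [Set.indicator_of_notMem (by simpa using hZ)]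
    exact Finset.sum_nonneg h0

theorem prob_iUnion_le {J : Type*} [Fintype J] (hw : IsWeight w) (S : J → Set (I → α)) :
    prob w {Z | ∃ j, Z ∈ S j} ≤ ∑ j, prob w (S j) := by
  simpa using prob_biUnion_le hw Finset.univ S

/-- Product formula for a product over a subset of the coordinates. -/
theorem avg_prod_subset (hw : IsWeight w) (s : Finset I) (g : I → α → ℝ) :
    avg w (fun Z => ∏ i ∈ s, g i (Z i)) = ∏ i ∈ s, ∑ a, w i a * g i a := by
  have h := avg_prod w (fun i a => if i ∈ s then g i a else 1)
  have h1 : ∀ Z : I → α, (∏ i, if i ∈ s then g i (Z i) else 1) = ∏ i ∈ s, g i (Z i) := by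
    intro Z; rw [Finset.prod_ite_mem, Finset.univ_inter]
  have h2 : ∀ i, (∑ a, w i a * if i ∈ s then g i a else 1)
      = if i ∈ s then ∑ a, w i a * g i a else 1 := by
    intro i
    by_cases hi : i ∈ s <;> simp [hi, hw.sum_eq_one]
  simp only [h1, h2] at h
  rw [h, Finset.prod_ite_mem, Finset.univ_inter]

end avg

/-! ### Sparse sign entries, rows and designs -/

/-- Weights of one sparse sign entry of frequency `q`. -/
def entryWeight (q : ℝ) (x : SignType) : ℝ := if x = 0 then 1 - q else q / 2

theorem sum_signType (f : SignType → ℝ) : ∑ x, f x = f 0 + f 1 + f (-1) := by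
  have : (Finset.univ : Finset SignType) = {0, 1, -1} := by decide
  rw [this, Finset.sum_insert (by decide), Finset.sum_insert (by decide), Finset.sum_singleton]
  ring

theorem sum_entryWeight_mul (q : ℝ) (f : SignType → ℝ) :
    ∑ x, entryWeight q x * f x = (1 - q) * f 0 + q / 2 * (f 1 + f (-1)) := by
  rw [sum_signType]
  simp [entryWeight]
  ring

theorem entryWeight_neg (q : ℝ) (x : SignType) : entryWeight q (-x) = entryWeight q x := by
  cases x <;> rfl

theorem isWeight_entry {J : Type*} {p : J → ℝ} (hp : ∀ j, 0 ≤ p j ∧ p j ≤ 1) :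
    IsWeight (fun j => entryWeight (p j)) where
  nonneg j a := by
    have := hp j
    unfold entryWeight; split_ifs <;> linarith
  sum_eq_one j := by
    have := sum_entryWeight_mul (p j) (fun _ => 1)
    simp only [mul_one] at this
    rw [this]; ring

/-- Weights of one row of a design. -/
def rowWeight {J : Type*} [Fintype J] (p : J → ℝ) (x : J → SignType) : ℝ :=
  ∏ j, entryWeight (p j) (x j)

/-- Weights of the rows of a design with `m` indexing the rows. -/
def designWeight (m : Type*) {J : Type*} [Fintype J] (p : J → ℝ) : m → (J → SignType) → ℝ :=
  fun _ => rowWeight p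

theorem isWeight_design (m : Type*) {J : Type*} [Fintype J] [DecidableEq J] {p : J → ℝ}
    (hp : ∀ j, 0 ≤ p j ∧ p j ≤ 1) : IsWeight (designWeight m p) where
  nonneg _ a := (isWeight_entry hp).prod_nonneg a
  sum_eq_one _ := (isWeight_entry hp).total

section design

variable {m J : Type*} [Fintype m] [DecidableEq m] [Fintype J] [DecidableEq J] {p : J → ℝ}

/-- The design that has the entries of `Z` at the positions in `s` and those of `Z'` elsewhere. -/
def splice {α : Type*} (s : m → J → Prop) [∀ i j, Decidable (s i j)] (Z Z' : m → J → α) : m → J → α :=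
  fun i j => if s i j then Z i j else Z' i j

/-- Swapping the entries in `s` between two independent designs is an involution that preserves the
product weight. This replaces conditioning: the entries in `s` can be frozen while the others are
averaged. -/
theorem avg_resample (hp : ∀ j, 0 ≤ p j ∧ p j ≤ 1) (s : m → J → Prop) [∀ i j, Decidable (s i j)]
    (f : (m → J → SignType) → ℝ) :
    avg (designWeight m p) (fun Z => avg (designWeight m p) fun Z' => f (splice s Z Z')) =
      avg (designWeight m p) f := by
  set W : (m → J → SignType) → ℝ := fun Z => ∏ i, designWeight m p i (Z i) with hW
  let e : ((m → J → SignType) × (m → J → SignType)) ≃ ((m → J → SignType) × (m → J → SignType)) :=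
    { toFun := fun z => (splice s z.1 z.2, splice s z.2 z.1)
      invFun := fun z => (splice s z.1 z.2, splice s z.2 z.1)
      left_inv := by
        rintro ⟨a, b⟩; ext i j <;> simp only [splice] <;> split_ifs <;> rfl
      right_inv := by
        rintro ⟨a, b⟩; ext i j <;> simp only [splice] <;> split_ifs <;> rfl }
  have hWe : ∀ z : (m → J → SignType) × (m → J → SignType),
      W (e z).1 * W (e z).2 = W z.1 * W z.2 := by
    rintro ⟨a, b⟩
    simp only [hW, designWeight, rowWeight, ← Finset.prod_mul_distrib]
    refine Finset.prod_congr rfl fun i _ => Finset.prod_congr rfl fun j _ => ?_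
    simp only [e, Equiv.coe_fn_mk, splice]
    split_ifs
    · rfl
    · ring
  have h1 : avg (designWeight m p) (fun Z => avg (designWeight m p) fun Z' => f (splice s Z Z'))
      = ∑ z : (m → J → SignType) × (m → J → SignType), W z.1 * W z.2 * f (e z).1 := by
    rw [Fintype.sum_prod_type]
    simp only [avg, Finset.mul_sum]
    exact Finset.sum_congr rfl fun _ _ => Finset.sum_congr rfl fun _ _ => by
      simp only [hW, e, Equiv.coe_fn_mk]; ring
  have h2 : ∑ z : (m → J → SignType) × (m → J → SignType), W z.1 * W z.2 * f (e z).1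
      = ∑ z : (m → J → SignType) × (m → J → SignType), W z.1 * W z.2 * f z.1 := by
    rw [← Equiv.sum_comp e (fun z => W z.1 * W z.2 * f z.1)]
    exact Finset.sum_congr rfl fun z _ => by rw [hWe]
  rw [h1, h2, Fintype.sum_prod_type]
  simp only [avg]
  refine Finset.sum_congr rfl fun Z _ => ?_
  have := (isWeight_design m hp).total
  calc ∑ y, W Z * W y * f Z = W Z * f Z * ∑ y, W y := by
        rw [Finset.mul_sum]; exact Finset.sum_congr rfl fun _ _ => by ring
    _ = W Z * f Z := by rw [show ∑ y, W y = 1 from this, mul_one]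

/-- If, with the entries in `s` fixed, the event has probability at most `c`, it has probability at
most `c`. -/
theorem prob_le_of_resample (hp : ∀ j, 0 ≤ p j ∧ p j ≤ 1) (s : m → J → Prop) [∀ i j, Decidable (s i j)]
    {S : Set (m → J → SignType)} {c : ℝ}
    (h : ∀ Z, prob (designWeight m p) {Z' | splice s Z Z' ∈ S} ≤ c) :
    prob (designWeight m p) S ≤ c := by
  rw [prob, ← avg_resample hp s]
  exact avg_le_of_le (isWeight_design m hp) h

/-- Product formula for the entries of one column. -/
theorem avg_prod_column (hp : ∀ j, 0 ≤ p j ∧ p j ≤ 1) (s : Finset m) (j : J) (g : m → SignType → ℝ) :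
    avg (designWeight m p) (fun Z => ∏ i ∈ s, g i (Z i j)) =
      ∏ i ∈ s, ∑ x, entryWeight (p j) x * g i x := by
  rw [avg_prod_subset (isWeight_design m hp) s (fun i x => g i (x j))]
  refine Finset.prod_congr rfl fun i _ => ?_
  have := avg_prod_subset (isWeight_entry hp) {j} (fun _ => g i)
  simpa [avg, designWeight, rowWeight] using this

/-- Changing signs of entries preserves expectations. -/
theorem avg_flip (p : J → ℝ) (s : m → J → Prop) [∀ i j, Decidable (s i j)]
    (f : (m → J → SignType) → ℝ) :
    avg (designWeight m p) (fun Z => f (fun i j => if s i j then - Z i j else Z i j)) =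
      avg (designWeight m p) f := by
  let e : (m → J → SignType) ≃ (m → J → SignType) :=
    { toFun := fun Z i j => if s i j then - Z i j else Z i j
      invFun := fun Z i j => if s i j then - Z i j else Z i j
      left_inv := by intro a; ext i j; dsimp only; split_ifs <;> simp
      right_inv := by intro a; ext i j; dsimp only; split_ifs <;> simp }
  rw [avg, avg, ← Equiv.sum_comp e (fun Z => (∏ i, designWeight m p i (Z i)) * f Z)]
  refine Finset.sum_congr rfl fun Z _ => ?_
  congr 1
  simp only [designWeight, rowWeight]
  refine Finset.prod_congr rfl fun i _ => Finset.prod_congr rfl fun j _ => ?_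
  simp only [e, Equiv.coe_fn_mk]
  split_ifs <;> simp [entryWeight_neg]

end design

/-! ### Basic solutions of systems of linear inequalities -/

/-- A feasible system of linear inequalities has a small subsystem such that the corresponding
equations are solvable and all their solutions are feasible. -/
theorem exists_tight_subsystem {C E : Type*} [Fintype C] [AddCommGroup E] [Module ℝ E]
    [FiniteDimensional ℝ E] (f : C → Module.Dual ℝ E) (b : C → ℝ) (v₀ : E)
    (hv₀ : ∀ c, f c v₀ ≤ b c) :
    ∃ J : Finset C, J.card ≤ Module.finrank ℝ E ∧ (∃ v, ∀ c ∈ J, f c v = b c) ∧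
      ∀ w, (∀ c ∈ J, f c w = b c) → ∀ c, f c w ≤ b c := by
  classical
  -- Take a feasible `v` with as many tight constraints as possible. If some form were outside the
  -- span of the tight ones, one could move from `v` along a direction killed by all tight forms
  -- until a further constraint becomes tight.
  let tight : E → Finset C := fun v => Finset.univ.filter fun c => f c v = b c
  obtain ⟨S, ⟨v, hv, rfl⟩, hmax⟩ := Set.exists_max_image
    {S : Finset C | ∃ v, (∀ c, f c v ≤ b c) ∧ S = tight v} Finset.card (Set.toFinite _)
    ⟨_, v₀, hv₀, rfl⟩
  have hspan : ∀ c, f c ∈ Submodule.span ℝ (Set.range fun c : tight v => f c) := by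
    intro c₀
    apply mem_span_of_iInf_ker_le_ker
    intro u hu
    rw [Submodule.mem_iInf] at hu
    by_contra hne
    have hpos : ∃ u : E, (∀ c ∈ tight v, f c u = 0) ∧ 0 < f c₀ u := by
      have hu' : ∀ c ∈ tight v, f c u = 0 := fun c hc => hu ⟨c, hc⟩
      rcases lt_or_gt_of_ne (show f c₀ u ≠ 0 from hne) with h | h
      · exact ⟨-u, fun c hc => by simp [hu' c hc], by simpa using h⟩
      · exact ⟨u, hu', h⟩
    obtain ⟨u, hu0, hu1⟩ := hpos
    -- Ratio test: `c₁` is the first constraint met on the ray from `v` in direction `u`.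
    obtain ⟨c₁, hc₁, hmin⟩ := Finset.exists_min_image (Finset.univ.filter fun c => 0 < f c u)
      (fun c => (b c - f c v) / f c u) ⟨c₀, by simp [hu1]⟩
    have hc₁' : 0 < f c₁ u := by simpa using hc₁
    set τ := (b c₁ - f c₁ v) / f c₁ u with hτ
    have hτ0 : 0 ≤ τ := div_nonneg (sub_nonneg.2 (hv _)) hc₁'.le
    have hfeas : ∀ c, f c (v + τ • u) ≤ b c := by
      intro c
      rw [map_add, map_smul, smul_eq_mul]
      rcases le_or_gt (f c u) 0 with h | h
      · nlinarith [hv c]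
      · have := hmin c (by simpa using h)
        have h2 : τ * f c u ≤ b c - f c v := by rwa [le_div_iff₀ h] at this
        linarith
    have hsub : tight v ⊂ tight (v + τ • u) := by
      rw [Finset.ssubset_iff]
      refine ⟨c₁, ?_, ?_⟩
      · intro hc; exact hc₁'.ne' (hu0 _ hc)
      · intro c hc
        rcases Finset.mem_insert.1 hc with rfl | hc
        · simp only [tight, Finset.mem_filter, Finset.mem_univ, true_and, map_add, map_smul,
            smul_eq_mul]
          rw [hτ, div_mul_cancel₀ _ hc₁'.ne']; ring
        · have h1 : f c v = b c := by simpa [tight] using hc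
          simp [tight, hu0 c hc, h1]
    exact absurd (hmax _ ⟨_, hfeas, rfl⟩) (not_le.2 (Finset.card_lt_card hsub))
  -- The subsystem is a basis chosen among the tight forms. A solution of its equations agrees with
  -- `v` on the span, hence on every form, and inherits feasibility.
  obtain ⟨κ, a, -, ha1, ha2⟩ := exists_linearIndependent' ℝ (fun c : tight v => f c)
  have hfin : Finite κ := ha2.finite
  have : Fintype κ := Fintype.ofFinite κ
  refine ⟨Finset.univ.image fun i => (a i : C), ?_, ⟨v, ?_⟩, ?_⟩
  · refine Finset.card_image_le.trans ?_
    have := ha2.fintype_card_le_finrank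
    rwa [Subspace.dual_finrank_eq] at this
  · intro c hc
    obtain ⟨i, -, rfl⟩ := Finset.mem_image.1 hc
    exact (Finset.mem_filter.1 (a i).2).2
  · intro w hw c
    have hker : ∀ g ∈ Submodule.span ℝ (Set.range fun c : tight v => f c), g (w - v) = 0 := by
      rw [← ha1]
      intro g hg
      induction hg using Submodule.span_induction with
      | mem g hg =>
        obtain ⟨i, rfl⟩ := hg
        have h1 := hw (a i) (Finset.mem_image.2 ⟨i, Finset.mem_univ _, rfl⟩)
        have h2 : f (a i) v = b (a i) := (Finset.mem_filter.1 (a i).2).2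
        simp [h1, h2]
      | zero => simp
      | add x y _ _ hx hy => simp [hx, hy] 
      | smul r x _ hx => simp [hx] 
    have := hker _ (hspan c)
    rw [map_sub, sub_eq_zero] at this
    rw [this]; exact hv c

/-- A set of at most `r` elements is the set of values other than `none` of some map from `Fin r` to
`Option α`. -/
theorem card_filter_card_le (α : Type*) [Fintype α] [DecidableEq α] (r : ℕ) :
    ((Finset.univ : Finset (Finset α)).filter fun S => S.card ≤ r).card ≤
      (Fintype.card α + 1) ^ r := by
  classical
  have h := Finset.card_le_card_of_surjOn (s := (Finset.univ : Finset (Fin r → Option α)))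
    (t := (Finset.univ : Finset (Finset α)).filter fun S => S.card ≤ r)
    (fun g => Finset.univ.filter fun a => ∃ i, g i = some a) (by
      intro S hS
      have hS : S.card ≤ r := by simpa using hS
      refine ⟨fun i => if h : (i : ℕ) < S.card then some (S.equivFin.symm ⟨i, h⟩) else none,
        by simp, ?_⟩
      ext a
      simp only [Finset.mem_filter, Finset.mem_univ, true_and]
      constructor
      · rintro ⟨i, hi⟩
        split_ifs at hi with h
        simp only [Option.some.injEq] at hi
        rw [← hi]; exact (S.equivFin.symm ⟨i, h⟩).2
      · intro ha
        refine ⟨⟨S.equivFin ⟨a, ha⟩, (S.equivFin ⟨a, ha⟩).2.trans_le hS⟩, ?_⟩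
        simp)
  simpa using h

/-! ### Small ball estimate for one row -/

section row

variable {J : Type*} [Fintype J] [DecidableEq J] {p : J → ℝ}

/-- Flip the sign of one nonzero coordinate in `T`. The sum changes by at least 2, so the two sign
choices cannot both land in the interval of half-width 1/2. Only rows vanishing on all of `T` escape
the pairing. -/
theorem prob_small_ball (hp : ∀ j, 0 ≤ p j ∧ p j ≤ 1) {T T' : Finset J} (hT : T ⊆ T') (u : J → ℝ)
    (hu : ∀ j ∈ T, 1 ≤ |u j|) :
    prob (fun j => entryWeight (p j)) {x | |∑ j ∈ T', (x j : ℝ) * u j| ≤ 1 / 2} ≤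
      1 / 2 + 1 / 2 * ∏ j ∈ T, (1 - p j) := by
  classical
  rcases T.eq_empty_or_nonempty with rfl | ⟨j₁, hj₁⟩
  · refine (prob_le_one (isWeight_entry hp) _).trans ?_
    norm_num
  have : Nonempty J := ⟨j₁⟩
  set w := fun j => entryWeight (p j)
  have hw : IsWeight w := isWeight_entry hp
  let supp : (J → SignType) → Finset J := fun x => T.filter fun j => x j ≠ 0
  -- The flipped coordinate depends on the support of `x` only, and flipping keeps the support. This
  -- makes `φ` an involution.
  let piv : (J → SignType) → J := fun x => Classical.epsilon fun j => j ∈ supp x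
  let φ : (J → SignType) → (J → SignType) := fun x => Function.update x (piv x) (- x (piv x))
  have hsupp : ∀ x, supp (φ x) = supp x := by
    intro x
    ext j
    simp only [supp, φ, Finset.mem_filter, Function.update_apply]
    by_cases h : j = piv x
    · subst h
      simp
    · simp [h]
  have hpiv : ∀ x, piv (φ x) = piv x := fun x => by simp only [piv, hsupp]
  have hinv : Function.Involutive φ := by
    intro x
    have h1 : φ (φ x) = Function.update (φ x) (piv (φ x)) (- φ x (piv (φ x))) := rfl
    rw [h1, hpiv]
    ext j
    by_cases h : j = piv x
    · subst h; simp [φ]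
    · simp [φ, h]
  have hWφ : ∀ x, ∏ j, w j (φ x j) = ∏ j, w j (x j) := by
    intro x
    refine Finset.prod_congr rfl fun j _ => ?_
    simp only [φ, Function.update_apply]
    split_ifs with h
    · subst h; exact entryWeight_neg _ _
    · rfl
  set S : Set (J → SignType) := {x | |∑ j ∈ T', (x j : ℝ) * u j| ≤ 1 / 2} with hS
  have h1 : avg w (fun x => S.indicator 1 (φ x)) = prob w S := by
    rw [prob, avg, avg, ← Equiv.sum_comp hinv.toPerm (fun x => (∏ j, w j (x j)) * S.indicator 1 x)]
    exact Finset.sum_congr rfl fun x _ => by rw [Function.Involutive.coe_toPerm, hWφ]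
  have h2 : ∀ x, S.indicator (1 : (J → SignType) → ℝ) x + S.indicator 1 (φ x) ≤
      1 + ∏ j ∈ T, (if x j = 0 then 1 else 0) := by
    intro x
    by_cases hx : ∀ j ∈ T, x j = 0
    · have : ∏ j ∈ T, (if x j = 0 then (1 : ℝ) else 0) = 1 :=
        Finset.prod_eq_one fun j hj => by simp [hx j hj]
      rw [this]
      exact add_le_add (Set.indicator_le_self' (fun _ _ => zero_le_one) x)
        (Set.indicator_le_self' (fun _ _ => zero_le_one) (φ x))
    · push Not at hx
      obtain ⟨j₂, hj₂, hj₂'⟩ := hx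
      have hne : piv x ∈ supp x := Classical.epsilon_spec (p := fun j => j ∈ supp x)
        ⟨j₂, by simp [supp, hj₂, hj₂']⟩
      have hprod : (0 : ℝ) ≤ ∏ j ∈ T, (if x j = 0 then 1 else 0) :=
        Finset.prod_nonneg fun j _ => by split_ifs <;> norm_num
      suffices h : ¬ (x ∈ S ∧ φ x ∈ S) by
        by_cases hx1 : x ∈ S
        · have hx2 : φ x ∉ S := fun h' => h ⟨hx1, h'⟩
          simp [hx1, hx2, hprod]
        · have := Set.indicator_le_self' (s := S) (f := (1 : (J → SignType) → ℝ))
            (fun _ _ => zero_le_one) (φ x)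
          simp only [Pi.one_apply] at this
          simp only [Set.indicator_of_notMem hx1]; linarith
      rintro ⟨hx1, hx2⟩
      obtain ⟨hpT, hp0⟩ := Finset.mem_filter.1 hne
      have hdiff : ∑ j ∈ T', (x j : ℝ) * u j - ∑ j ∈ T', (φ x j : ℝ) * u j
          = 2 * ((x (piv x) : ℝ) * u (piv x)) := by
        rw [← Finset.sum_sub_distrib, Finset.sum_eq_single_of_mem (piv x) (hT hpT)]
        · simp [φ]; ring
        · intro j _ hj; simp [φ, hj]
      have habs : |((x (piv x) : SignType) : ℝ)| = 1 := by
        rcases (x (piv x)).trichotomy with h | h | h <;> simp_all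
      have h3 : 2 ≤ |2 * ((x (piv x) : ℝ) * u (piv x))| := by
        rw [abs_mul, abs_mul, habs]
        have := hu _ hpT
        norm_num; linarith
      rw [← hdiff] at h3
      have h4 := abs_sub (∑ j ∈ T', (x j : ℝ) * u j) (∑ j ∈ T', (φ x j : ℝ) * u j)
      have h5 : |∑ j ∈ T', (x j : ℝ) * u j| ≤ 1 / 2 := hx1
      have h6 : |∑ j ∈ T', (φ x j : ℝ) * u j| ≤ 1 / 2 := hx2
      linarith
  have h3 := avg_mono hw h2
  rw [avg_add, avg_add, avg_const hw, h1,
    avg_prod_subset hw T (fun _ a => if a = 0 then 1 else 0)] at h3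
  have h4 : ∏ j ∈ T, ∑ a, w j a * (if a = 0 then (1 : ℝ) else 0) = ∏ j ∈ T, (1 - p j) :=
    Finset.prod_congr rfl fun j _ => by
      simp only [w]; rw [sum_entryWeight_mul]; simp
  rw [h4] at h3
  have h5 : prob w S = avg w (fun x => S.indicator 1 x) := rfl
  rw [← h5] at h3
  linarith

end row

/-! ### Pairs of column sets without a separating row -/

section badPair

variable {m J : Type*} [Fintype m] [DecidableEq m] [Fintype J] [DecidableEq J] {p : J → ℝ}

/-- The designs for which some `v`, with entries of size at least `1` on `T`, is nearly orthogonal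
to the part in the columns `T'` of all the rows in `R`. -/
def badPair (R : Finset m) (T T' : Finset J) : Set (m → J → SignType) :=
  {Z | ∃ v : J → ℝ, (∀ j ∈ T, 1 ≤ |v j|) ∧ ∀ i ∈ R, |∑ j ∈ T', (Z i j : ℝ) * v j| ≤ 1 / 2}

theorem prob_rows_le (hp : ∀ j, 0 ≤ p j ∧ p j ≤ 1) (A : Finset m) (S : Set (J → SignType)) {ρ : ℝ}
    (h : prob (fun j => entryWeight (p j)) S ≤ ρ) :
    prob (designWeight m p) {Z | ∀ i ∈ A, Z i ∈ S} ≤ ρ ^ A.card := by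
  classical
  have h1 : ∀ Z : m → J → SignType, ({Z | ∀ i ∈ A, Z i ∈ S} : Set (m → J → SignType)).indicator
      (1 : (m → J → SignType) → ℝ) Z =
      ∏ i ∈ A, S.indicator 1 (Z i) := by
    intro Z
    by_cases hZ : ∀ i ∈ A, Z i ∈ S
    · rw [Set.indicator_of_mem (by exact hZ)]
      exact (Finset.prod_eq_one fun i hi => by simp [hZ i hi]).symm
    · rw [Set.indicator_of_notMem (by exact hZ)]
      push Not at hZ
      obtain ⟨i, hi, hi'⟩ := hZ
      exact (Finset.prod_eq_zero hi (by simp [hi'])).symm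
  rw [prob, funext h1, avg_prod_subset (isWeight_design m hp) A (fun _ => S.indicator 1)]
  simp only [designWeight, Finset.prod_const]
  exact pow_le_pow_left₀ (prob_nonneg (isWeight_entry hp) S) h _

/-- The inequalities stating that `v`, with sign pattern `σ` on `T`, shows that `Z` is in
`badPair R T T'`. -/
def badForm (R : Finset m) (T T' : Finset J) (σ : T → Bool) (Z : m → J → SignType) :
    (R × Bool) ⊕ T → Module.Dual ℝ (T' → ℝ)
  | Sum.inl c => (if c.2 then (1 : ℝ) else -1) • ∑ j : T', (Z c.1 j : ℝ) • LinearMap.proj j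
  | Sum.inr j => if h : (j : J) ∈ T' then
      (if σ j then (-1 : ℝ) else 1) • LinearMap.proj (⟨j, h⟩ : T') else 0

/-- Right-hand sides that go with `badForm`. -/
def badBound (R : Finset m) (T : Finset J) : (R × Bool) ⊕ T → ℝ
  | Sum.inl _ => 1 / 2
  | Sum.inr _ => -1

/-- The witness `v` ranges over a continuum, so a union bound needs finitely many candidates. For a
fixed sign pattern the witnesses form a polyhedron, and a feasible polyhedron has a feasible point
determined by at most |T'| tight constraints. These involve at most |T'| rows; the remaining rows
are independent of that point, and each satisfies the small ball event with probability at most `ρ`.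
The prefactor counts sign patterns and tight subsystems. -/
theorem prob_badPair_le (hp : ∀ j, 0 ≤ p j ∧ p j ≤ 1) (R : Finset m) {T T' : Finset J} (hT : T ⊆ T')
    {ρ : ℝ} (hρ0 : 0 ≤ ρ) (hρ1 : ρ ≤ 1) (hρ : 1 / 2 + 1 / 2 * ∏ j ∈ T, (1 - p j) ≤ ρ) :
    prob (designWeight m p) (badPair R T T') ≤
      2 ^ T.card * (2 * R.card + T.card + 1) ^ T'.card * ρ ^ (R.card - T'.card) := by
  classical
  have hw := isWeight_design m hp
  -- The equations selected by `K` are solvable and every solution is feasible. Asking it of every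
  -- solution lets a solution be chosen from the selected rows alone.
  let U : (T → Bool) → Finset ((R × Bool) ⊕ T) → Set (m → J → SignType) := fun σ K =>
    {Z | (∃ v, ∀ c ∈ K, badForm R T T' σ Z c v = badBound R T c) ∧
      ∀ v, (∀ c ∈ K, badForm R T T' σ Z c v = badBound R T c) →
        ∀ c, badForm R T T' σ Z c v ≤ badBound R T c}
  have hcover : badPair R T T' ⊆ {Z | ∃ σ : T → Bool, Z ∈ {Z | ∃ K ∈
      (Finset.univ : Finset (Finset ((R × Bool) ⊕ T))).filter fun K => K.card ≤ T'.card,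
      Z ∈ U σ K}} := by
    rintro Z ⟨v, hv1, hv2⟩
    refine ⟨fun j => decide (0 ≤ v j), ?_⟩
    obtain ⟨K, hK1, hK2⟩ := exists_tight_subsystem (badForm R T T' (fun j => decide (0 ≤ v j)) Z)
      (badBound R T) (fun j => v j) (by
        rintro (⟨i, b⟩ | ⟨j, hj⟩)
        · have h1 := abs_le.1 (hv2 i i.2)
          rw [← Finset.sum_coe_sort T'] at h1
          cases b <;> simp [badForm, badBound] <;> norm_num at h1 <;> linarith
        · have h1 := hv1 j hj
          simp only [badForm, badBound, hT hj, dif_pos, decide_eq_true_eq]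
          rcases le_or_gt 0 (v j) with h | h
          · rw [abs_of_nonneg h] at h1
            simp [h]; linarith
          · rw [abs_of_neg h] at h1
            simp [not_le.2 h]; linarith)
    refine ⟨K, ?_, hK2⟩
    simpa using hK1
  have hU : ∀ σ, ∀ K ∈ (Finset.univ : Finset (Finset ((R × Bool) ⊕ T))).filter
      fun K => K.card ≤ T'.card, prob (designWeight m p) (U σ K) ≤ ρ ^ (R.card - T'.card) := by
    intro σ K hK
    have hK : K.card ≤ T'.card := by simpa using hK
    -- Only constraints of the first kind involve a row, so at most `K.card` rows are frozen.
    let rowOf : (R × Bool) ⊕ T → Finset m := Sum.elim (fun c => {(c.1 : m)}) fun _ => ∅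
    let rows : Finset m := K.biUnion rowOf
    have hrows : rows.card ≤ K.card := by
      refine Finset.card_biUnion_le.trans ((Finset.sum_le_card_nsmul _ _ 1 ?_).trans (by simp))
      rintro (c | c) - <;> simp [rowOf]
    refine prob_le_of_resample hp (fun i _ => i ∈ rows) fun Z => ?_
    have hform : ∀ Z' : m → J → SignType, ∀ c ∈ K, badForm R T T' σ
        (splice (fun i _ => i ∈ rows) Z Z') c = badForm R T T' σ Z c := by
      rintro Z' (⟨⟨i, hi⟩, b⟩ | j) hc
      · have : i ∈ rows := Finset.mem_biUnion.2 ⟨_, hc, by simp [rowOf]⟩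
        simp [badForm, splice, this]
      · rfl
    have hρn : 0 ≤ ρ ^ (R.card - T'.card) := pow_nonneg hρ0 _
    by_cases hsol : ∃ v, ∀ c ∈ K, badForm R T T' σ Z c v = badBound R T c
    swap
    · have : {Z' | splice (fun i _ => i ∈ rows) Z Z' ∈ U σ K} = ∅ := by
        ext Z'
        simp only [Set.mem_ofPred_eq, Set.mem_empty_iff_false, iff_false]
        rintro ⟨⟨v, hv⟩, -⟩
        exact hsol ⟨v, fun c hc => by rw [← hform Z' c hc]; exact hv c hc⟩
      rw [this]
      simpa [prob, avg] using hρn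
    obtain ⟨v, hv⟩ := hsol
    by_cases hvT : ∃ Z', splice (fun i _ => i ∈ rows) Z Z' ∈ U σ K
    swap
    · have : {Z' | splice (fun i _ => i ∈ rows) Z Z' ∈ U σ K} = ∅ := by
        ext Z'
        simp only [Set.mem_ofPred_eq, Set.mem_empty_iff_false, iff_false]
        exact fun h => hvT ⟨Z', h⟩
      rw [this]
      simpa [prob, avg] using hρn
    -- `v` was chosen from the frozen rows; it remains feasible for every completion in the event.
    have hfeas : ∀ Z', splice (fun i _ => i ∈ rows) Z Z' ∈ U σ K → ∀ c,
        badForm R T T' σ (splice (fun i _ => i ∈ rows) Z Z') c v ≤ badBound R T c :=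
      fun Z' h => h.2 v fun c hc => by rw [hform Z' c hc]; exact hv c hc
    let u : J → ℝ := fun j => if h : j ∈ T' then v ⟨j, h⟩ else 0
    have hu : ∀ j ∈ T, 1 ≤ |u j| := by
      intro j hj
      obtain ⟨Z', hZ'⟩ := hvT
      have h1 := hfeas Z' hZ' (Sum.inr ⟨j, hj⟩)
      simp only [badForm, badBound, hT hj, dif_pos] at h1
      simp only [u, hT hj, dif_pos]
      split_ifs at h1
      · simp at h1
        exact h1.trans (le_abs_self _)
      · simp at h1
        exact le_abs.2 (Or.inr (by linarith))
    have hsmall := (prob_small_ball hp hT u hu).trans hρ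
    refine (prob_mono hw (T := {Z' | ∀ i ∈ R \ rows, Z' i ∈
        {x : J → SignType | |∑ j ∈ T', (x j : ℝ) * u j| ≤ 1 / 2}}) ?_).trans
      ((prob_rows_le hp (R \ rows) _ hsmall).trans
        (pow_le_pow_of_le_one hρ0 hρ1 ?_))
    · intro Z' hZ' i hi
      obtain ⟨hiR, hi'⟩ := Finset.mem_sdiff.1 hi
      have h1 := hfeas Z' hZ' (Sum.inl (⟨i, hiR⟩, true))
      have h2 := hfeas Z' hZ' (Sum.inl (⟨i, hiR⟩, false))
      have h3 : ∑ j ∈ T', (Z' i j : ℝ) * u j = ∑ j : T', (Z' i j : ℝ) * v j := by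
        rw [← Finset.sum_coe_sort T']
        exact Finset.sum_congr rfl fun j _ => by simp [u]
      simp [badForm, badBound, splice, hi'] at h1 h2
      simp only [Set.mem_ofPred_eq, h3, abs_le]
      constructor <;> norm_num <;> linarith
    · have := Finset.le_card_sdiff rows R
      omega
  refine (prob_mono hw hcover).trans ((prob_iUnion_le hw _).trans ?_)
  have h1 : ∀ σ : T → Bool, prob (designWeight m p) {Z | ∃ K ∈
      (Finset.univ : Finset (Finset ((R × Bool) ⊕ T))).filter fun K => K.card ≤ T'.card,
      Z ∈ U σ K} ≤ (2 * R.card + T.card + 1 : ℝ) ^ T'.card * ρ ^ (R.card - T'.card) := by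
    intro σ
    refine (prob_biUnion_le hw _ _).trans ((Finset.sum_le_card_nsmul _ _ _ (hU σ)).trans ?_)
    rw [nsmul_eq_mul]
    refine mul_le_mul_of_nonneg_right ?_ (pow_nonneg hρ0 _)
    have := card_filter_card_le ((R × Bool) ⊕ T) T'.card
    have h2 : Fintype.card ((R × Bool) ⊕ T) = 2 * R.card + T.card := by
      simp; ring
    rw [h2] at this
    exact_mod_cast this
  refine (Finset.sum_le_card_nsmul _ _ _ fun σ _ => h1 σ).trans_eq ?_
  simp
  ring

/-- The designs with a bad pair of column sets in `Q` of sizes `t` and at most `M * t`. -/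
def badSize (R : Finset m) (Q : Finset J) (M t : ℕ) : Set (m → J → SignType) :=
  {Z | ∃ T T' : Finset J, T ⊆ T' ∧ T' ⊆ Q ∧ T.card = t ∧ T'.card ≤ M * t ∧ Z ∈ badPair R T T'}

/-- Union bound over both column sets. All frequencies in `Q` being at least `q`, the small ball
probability depends on the size `t` of the inner set only. -/
theorem prob_badSize_le (hp : ∀ j, 0 ≤ p j ∧ p j ≤ 1) (R : Finset m) (Q : Finset J) {M t : ℕ}
    {q : ℝ} (hq0 : 0 ≤ q) (hq1 : q ≤ 1) (hq : ∀ j ∈ Q, q ≤ p j) :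
    prob (designWeight m p) (badSize R Q M t) ≤
      (Fintype.card J + 1) ^ t * (Fintype.card J + 1) ^ (M * t) *
      (2 ^ t * (2 * R.card + t + 1) ^ (M * t) *
        (1 / 2 + 1 / 2 * (1 - q) ^ t) ^ (R.card - M * t)) := by
  classical
  have hw := isWeight_design m hp
  set ρ := 1 / 2 + 1 / 2 * (1 - q) ^ t with hρ
  have hq' : (1 - q) ^ t ≤ 1 := pow_le_one₀ (by linarith) (by linarith)
  have hq'' : 0 ≤ (1 - q) ^ t := pow_nonneg (by linarith) _
  have hρ0 : 0 ≤ ρ := by linarith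
  have hρ1 : ρ ≤ 1 := by linarith
  set c : ℝ := 2 ^ t * (2 * R.card + t + 1) ^ (M * t) * ρ ^ (R.card - M * t) with hc
  have hc0 : 0 ≤ c := by positivity
  let P : Finset (Finset J × Finset J) :=
    ((Finset.univ.filter fun T => T.card ≤ t) ×ˢ (Finset.univ.filter fun T' => T'.card ≤ M * t))
  let V : Finset J × Finset J → Set (m → J → SignType) := fun T =>
    {Z | T.1 ⊆ T.2 ∧ T.2 ⊆ Q ∧ T.1.card = t ∧ T.2.card ≤ M * t ∧ Z ∈ badPair R T.1 T.2}
  have hcover : badSize R Q M t ⊆ {Z | ∃ T ∈ P, Z ∈ V T} := by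
    rintro Z ⟨T, T', h1, h2, h3, h4, h5⟩
    exact ⟨(T, T'), by simp [P, h3, h4], h1, h2, h3, h4, h5⟩
  have hV : ∀ T ∈ P, prob (designWeight m p) (V T) ≤ c := by
    rintro ⟨T, T'⟩ -
    by_cases h : T ⊆ T' ∧ T' ⊆ Q ∧ T.card = t ∧ T'.card ≤ M * t
    · obtain ⟨h1, h2, h3, h4⟩ := h
      refine (prob_mono hw (T := badPair R T T') fun Z hZ => hZ.2.2.2.2).trans
        ((prob_badPair_le hp R h1 hρ0 hρ1 ?_).trans ?_)
      · rw [hρ, ← h3, ← Finset.prod_const]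
        gcongr with j hj
        · intro j hj; linarith [(hp j).2]
        · exact hq j (h2 (h1 hj))
      · rw [hc, h3]
        gcongr ?_ * ?_ * ?_
        · refine pow_le_pow_right₀ ?_ h4
          have : (0 : ℝ) ≤ R.card := by positivity
          have : (0 : ℝ) ≤ t := by positivity
          linarith
        · exact pow_le_pow_of_le_one hρ0 hρ1 (by omega)
    · have : V (T, T') = ∅ := by
        ext Z
        simp only [V, Set.mem_ofPred_eq, Set.mem_empty_iff_false, iff_false]
        rintro ⟨h1, h2, h3, h4, -⟩
        exact h ⟨h1, h2, h3, h4⟩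
      rw [this]
      simpa [prob, avg] using hc0
  refine (prob_mono hw hcover).trans ((prob_biUnion_le hw _ _).trans
    ((Finset.sum_le_card_nsmul _ _ _ hV).trans ?_))
  rw [nsmul_eq_mul]
  refine mul_le_mul_of_nonneg_right ?_ hc0
  rw [Finset.card_product]
  have h1 := card_filter_card_le J t
  have h2 := card_filter_card_le J (M * t)
  exact_mod_cast Nat.mul_le_mul h1 h2

end badPair

/-! ### Distance of a random column to a fixed subspace -/

section column

variable {m J : Type*} [Fintype m] [DecidableEq m] [Fintype J] [DecidableEq J] {p : J → ℝ}

/-- Change the sign of the entry at `(i, j)`. -/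
def flipEntry (i : m) (j : J) (Z : m → J → SignType) : m → J → SignType :=
  fun i' j' => if i' = i ∧ j' = j then - Z i' j' else Z i' j'

theorem avg_flipEntry (p : J → ℝ) (i : m) (j : J) (f : (m → J → SignType) → ℝ) :
    avg (designWeight m p) (fun Z => f (flipEntry i j Z)) = avg (designWeight m p) f :=
  avg_flip p (fun i' j' => i' = i ∧ j' = j) f

theorem flipEntry_same (i : m) (j : J) (Z : m → J → SignType) : flipEntry i j Z i j = - Z i j := by
  simp [flipEntry]

theorem flipEntry_of_ne {i i' : m} (h : i' ≠ i) (j : J) (Z : m → J → SignType) :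
    flipEntry i j Z i' j = Z i' j := by
  simp [flipEntry, h]

theorem flipEntry_sq (i i' : m) (j : J) (Z : m → J → SignType) :
    ((flipEntry i j Z i' j : SignType) : ℝ) ^ 2 = (Z i' j : ℝ) ^ 2 := by
  by_cases h : i' = i
  · subst h; rw [flipEntry_same]; simp
  · rw [flipEntry_of_ne h]

/-- Exponential moments of a sum of vectors with random signs. -/
theorem avg_exp_norm_sq_le {E : Type*} [NormedAddCommGroup E] [InnerProductSpace ℝ E]
    (hp : ∀ j, 0 ≤ p j ∧ p j ≤ 1) (j : J) (a : m → E) (s : Finset m)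
    (g θ : (m → J → SignType) → ℝ) (hg : ∀ Z, 0 ≤ g Z) (hθ : ∀ Z, 0 ≤ θ Z)
    (hgf : ∀ i Z, g (flipEntry i j Z) = g Z) (hθf : ∀ i Z, θ (flipEntry i j Z) = θ Z)
    (hθV : ∀ Z, 4 * θ Z * ∑ i ∈ s, (Z i j : ℝ) ^ 2 * ‖a i‖ ^ 2 ≤ 1) :
    avg (designWeight m p) (fun Z => g Z * Real.exp (θ Z * ‖∑ i ∈ s, (Z i j : ℝ) • a i‖ ^ 2)) ≤
      avg (designWeight m p) fun Z =>
        g Z * Real.exp (2 * θ Z * ∑ i ∈ s, (Z i j : ℝ) ^ 2 * ‖a i‖ ^ 2) := by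
  classical
  have hw := isWeight_design m hp
  induction s using Finset.induction_on generalizing g θ with
  | empty => simp
  | insert i s hi ih =>
    set b : (m → J → SignType) → ℝ := fun Z => (Z i j : ℝ) ^ 2 * ‖a i‖ ^ 2 with hb
    set V : (m → J → SignType) → ℝ := fun Z => ∑ i ∈ s, (Z i j : ℝ) ^ 2 * ‖a i‖ ^ 2 with hV
    set S : (m → J → SignType) → E := fun Z => ∑ i ∈ s, (Z i j : ℝ) • a i with hS
    have hb0 : ∀ Z, 0 ≤ b Z := fun Z => by positivity
    have hV0 : ∀ Z, 0 ≤ V Z := fun Z => Finset.sum_nonneg fun i _ => by positivity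
    have hbf : ∀ i' Z, b (flipEntry i' j Z) = b Z := fun i' Z => by
      simp only [hb, flipEntry_sq]
    have hSf : ∀ Z, S (flipEntry i j Z) = S Z := fun Z =>
      Finset.sum_congr rfl fun i' hi' => by
        rw [flipEntry_of_ne (ne_of_mem_of_not_mem hi' hi)]
    have hθV' : ∀ Z, 4 * θ Z * (b Z + V Z) ≤ 1 := fun Z => by
      have := hθV Z; rwa [Finset.sum_insert hi] at this
    -- Averaging over the sign of entry `i` turns the cross term into a cosh, bounded by the
    -- exponential of half the square, and Cauchy-Schwarz absorbs it in the square norm of the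
    -- remaining sum. The exponent grows from θ to θ(1 + 2θb), and 4θ(b + V) ≤ 1 ensures that 4θ'V ≤
    -- 1 persists.
    let θ' : (m → J → SignType) → ℝ := fun Z => θ Z * (1 + 2 * θ Z * b Z)
    let g' : (m → J → SignType) → ℝ := fun Z => g Z * Real.exp (θ Z * b Z)
    have h1 : avg (designWeight m p)
        (fun Z => g Z * Real.exp (θ Z * ‖(Z i j : ℝ) • a i + S Z‖ ^ 2)) ≤
        avg (designWeight m p) fun Z => g' Z * Real.exp (θ' Z * ‖S Z‖ ^ 2) := by
      have hflip := avg_flipEntry p i j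
        (fun Z => g Z * Real.exp (θ Z * ‖(Z i j : ℝ) • a i + S Z‖ ^ 2))
      have hsum := avg_add (designWeight m p)
        (fun Z => g Z * Real.exp (θ Z * ‖(Z i j : ℝ) • a i + S Z‖ ^ 2))
        (fun Z => g (flipEntry i j Z) * Real.exp (θ (flipEntry i j Z) *
          ‖((flipEntry i j Z i j : SignType) : ℝ) • a i + S (flipEntry i j Z)‖ ^ 2))
      rw [hflip] at hsum
      have hle : avg (designWeight m p) (fun Z =>
          g Z * Real.exp (θ Z * ‖(Z i j : ℝ) • a i + S Z‖ ^ 2) +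
          g (flipEntry i j Z) * Real.exp (θ (flipEntry i j Z) *
            ‖((flipEntry i j Z i j : SignType) : ℝ) • a i + S (flipEntry i j Z)‖ ^ 2)) ≤
          avg (designWeight m p) fun Z => 2 * (g' Z * Real.exp (θ' Z * ‖S Z‖ ^ 2)) := by
        refine avg_mono hw fun Z => ?_
        rw [hgf, hθf, hSf, flipEntry_same]
        set c : ℝ := (Z i j : ℝ) with hc
        have hcn : ((- Z i j : SignType) : ℝ) = -c := by simp [hc]
        rw [hcn]
        set r : ℝ := inner ℝ (a i) (S Z) with hr
        have e1 : ‖c • a i + S Z‖ ^ 2 = b Z + ‖S Z‖ ^ 2 + 2 * c * r := by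
          rw [norm_add_sq_real, norm_smul, mul_pow, real_inner_smul_left, Real.norm_eq_abs, sq_abs]
          simp only [hb]; ring
        have e2 : ‖(-c) • a i + S Z‖ ^ 2 = b Z + ‖S Z‖ ^ 2 - 2 * c * r := by
          rw [norm_add_sq_real, norm_smul, mul_pow, real_inner_smul_left, Real.norm_eq_abs, sq_abs]
          simp only [hb]; ring
        rw [e1, e2]
        have hcs : (c * r) ^ 2 ≤ b Z * ‖S Z‖ ^ 2 := by
          have := real_inner_mul_inner_self_le (a i) (S Z)
          rw [real_inner_self_eq_norm_sq, real_inner_self_eq_norm_sq] at this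
          have h2 := mul_le_mul_of_nonneg_left this (sq_nonneg c)
          simp only [hb]; nlinarith
        have hcosh : Real.exp (2 * θ Z * (c * r)) + Real.exp (-(2 * θ Z * (c * r))) ≤
            2 * Real.exp (2 * θ Z ^ 2 * b Z * ‖S Z‖ ^ 2) := by
          have h3 := Real.cosh_le_exp_half_sq (2 * θ Z * (c * r))
          rw [Real.cosh_eq] at h3
          have h4 : Real.exp ((2 * θ Z * (c * r)) ^ 2 / 2) ≤
              Real.exp (2 * θ Z ^ 2 * b Z * ‖S Z‖ ^ 2) := by
            apply Real.exp_le_exp.2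
            nlinarith [sq_nonneg (θ Z)]
          linarith
        calc g Z * Real.exp (θ Z * (b Z + ‖S Z‖ ^ 2 + 2 * c * r)) +
              g Z * Real.exp (θ Z * (b Z + ‖S Z‖ ^ 2 - 2 * c * r))
            = g Z * (Real.exp (θ Z * b Z) * Real.exp (θ Z * ‖S Z‖ ^ 2)) *
              (Real.exp (2 * θ Z * (c * r)) + Real.exp (-(2 * θ Z * (c * r)))) := by
              rw [show θ Z * (b Z + ‖S Z‖ ^ 2 + 2 * c * r) = θ Z * b Z + θ Z * ‖S Z‖ ^ 2 +
                  2 * θ Z * (c * r) by ring,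
                show θ Z * (b Z + ‖S Z‖ ^ 2 - 2 * c * r) = θ Z * b Z + θ Z * ‖S Z‖ ^ 2 +
                  -(2 * θ Z * (c * r)) by ring]
              simp only [Real.exp_add]
              ring
          _ ≤ g Z * (Real.exp (θ Z * b Z) * Real.exp (θ Z * ‖S Z‖ ^ 2)) *
              (2 * Real.exp (2 * θ Z ^ 2 * b Z * ‖S Z‖ ^ 2)) :=
              mul_le_mul_of_nonneg_left hcosh (mul_nonneg (hg Z) (by positivity))
          _ = 2 * (g' Z * Real.exp (θ' Z * ‖S Z‖ ^ 2)) := by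
              simp only [g', θ']
              rw [show θ Z * (1 + 2 * θ Z * b Z) * ‖S Z‖ ^ 2 = θ Z * ‖S Z‖ ^ 2 +
                2 * θ Z ^ 2 * b Z * ‖S Z‖ ^ 2 by ring, Real.exp_add]
              ring
      rw [hsum, avg_const_mul] at hle
      linarith
    have h2 := ih g' θ' (fun Z => mul_nonneg (hg Z) (Real.exp_pos _).le)
      (fun Z => mul_nonneg (hθ Z) (by have := mul_nonneg (hθ Z) (hb0 Z); nlinarith))
      (fun i' Z => by simp only [g', hgf, hθf, hbf]) (fun i' Z => by simp only [θ', hθf, hbf])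
      (fun Z => by
        have x1 := mul_nonneg (hθ Z) (hb0 Z)
        have x2 := mul_nonneg (hθ Z) (hV0 Z)
        have x3 := hθV' Z
        change 4 * (θ Z * (1 + 2 * θ Z * b Z)) * V Z ≤ 1
        nlinarith)
    simp only [Finset.sum_insert hi]
    refine h1.trans (h2.trans (avg_mono hw fun Z => ?_))
    simp only [g', mul_assoc (g Z), ← Real.exp_add]
    refine mul_le_mul_of_nonneg_left (Real.exp_le_exp.2 ?_) (hg Z)
    have x1 := mul_nonneg (hθ Z) (hb0 Z)
    have x2 := mul_nonneg (hθ Z) (hV0 Z)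
    have x3 := hθV' Z
    change θ Z * b Z + 2 * (θ Z * (1 + 2 * θ Z * b Z)) * V Z ≤ 2 * θ Z * (b Z + V Z)
    nlinarith

/-- Exponential moments of the number of nonzero entries of a column in given rows. -/
theorem avg_exp_count_le (hp : ∀ j, 0 ≤ p j ∧ p j ≤ 1) (j : J) (A : Finset m) (l : ℝ) :
    avg (designWeight m p) (fun Z => Real.exp (l * ∑ i ∈ A, (Z i j : ℝ) ^ 2)) ≤
      Real.exp (A.card * (p j * (Real.exp l - 1))) := by
  have h1 : ∀ Z : m → J → SignType, Real.exp (l * ∑ i ∈ A, (Z i j : ℝ) ^ 2) =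
      ∏ i ∈ A, Real.exp (l * (Z i j : ℝ) ^ 2) := fun Z => by
    rw [Finset.mul_sum, Real.exp_sum]
  rw [funext h1, avg_prod_column hp A j (fun _ x => Real.exp (l * (x : ℝ) ^ 2)),
    Finset.prod_const, sum_entryWeight_mul, Real.exp_nat_mul]
  have h2 : (1 - p j) * Real.exp (l * ((0 : SignType) : ℝ) ^ 2) +
      p j / 2 * (Real.exp (l * ((1 : SignType) : ℝ) ^ 2) +
        Real.exp (l * ((-1 : SignType) : ℝ) ^ 2)) = 1 + p j * (Real.exp l - 1) := by
    simp; ring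
  rw [h2]
  have := hp j
  refine pow_le_pow_left₀ ?_ ?_ _
  · nlinarith [Real.exp_pos l]
  · linarith [Real.add_one_le_exp (p j * (Real.exp l - 1))]

/-- The trace of an orthogonal projection is its rank. Hence a low-dimensional subspace can have
only few coordinates of large leverage. -/
theorem sum_norm_sq_starProjection (K : Submodule ℝ (EuclideanSpace ℝ m)) :
    ∑ i, ‖K.starProjection (EuclideanSpace.single i 1)‖ ^ 2 = Module.finrank ℝ K := by
  have hproj : LinearMap.IsProj K (K.starProjection : EuclideanSpace ℝ m →ₗ[ℝ] EuclideanSpace ℝ m) :=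
    ⟨fun x => K.starProjection_apply_mem x, fun x hx => K.starProjection_eq_self_iff.2 hx⟩
  rw [← hproj.trace, LinearMap.trace_eq_sum_inner _ (EuclideanSpace.basisFun m ℝ)]
  refine Finset.sum_congr rfl fun i _ => ?_
  rw [EuclideanSpace.basisFun_apply]
  rw [real_inner_comm]
  simpa using (K.re_inner_starProjection_eq_normSq (EuclideanSpace.single i (1 : ℝ))).symm

/-- The random column `j` of a design, restricted to the rows in `R`. -/
def columnVec (R : Finset m) (j : J) (Z : m → J → SignType) : EuclideanSpace ℝ m :=
  ∑ i ∈ R, (Z i j : ℝ) • EuclideanSpace.single i 1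

theorem norm_sq_columnVec (R : Finset m) (j : J) (Z : m → J → SignType) :
    ‖columnVec R j Z‖ ^ 2 = ∑ i ∈ R, (Z i j : ℝ) ^ 2 := by
  have h : ∀ i, (columnVec R j Z).ofLp i = if i ∈ R then (Z i j : ℝ) else 0 := by
    intro i
    simp [columnVec, Finset.sum_apply, Pi.single_apply]
  rw [EuclideanSpace.real_norm_sq_eq]
  simp [h, Finset.sum_ite_mem]

/-- A random column is far from a fixed subspace of small dimension. -/
theorem prob_columnVec_near_le (hp : ∀ j, 0 ≤ p j ∧ p j ≤ 1) (R : Finset m) (j : J)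
    (K : Submodule ℝ (EuclideanSpace ℝ m)) {η : ℝ} (hη : 0 < η)
    (hR : (Fintype.card m : ℝ) / 2 ≤ R.card)
    (hK : Module.finrank ℝ K ≤ η * (Fintype.card m / 256)) :
    prob (designWeight m p) {Z | ‖columnVec R j Z‖ ^ 2 - ‖K.starProjection (columnVec R j Z)‖ ^ 2 <
        Fintype.card m * p j / 16} ≤
      3 * Real.exp (-(Fintype.card m * p j / 128)) + 2 * Real.exp (-(1 / (1024 * η))) := by
  classical
  have hw := isWeight_design m hp
  set n : ℝ := (Fintype.card m : ℝ) with hn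
  set ν : ℝ := n * p j with hν
  have hn0 : 0 ≤ n := by positivity
  have hν0 : 0 ≤ ν := mul_nonneg hn0 (hp j).1
  rcases hν0.eq_or_lt with h0 | hνpos
  · refine (prob_le_one hw _).trans ?_
    rw [← h0]
    have := Real.exp_pos (-(1 / (1024 * η)))
    simp only [zero_div, neg_zero, Real.exp_zero]; linarith
  set a : m → EuclideanSpace ℝ m := fun i => K.starProjection (EuclideanSpace.single i 1) with ha
  -- The rows of leverage at least `η`. Leverages sum to the dimension of `K`, so there are at most
  -- n/256 of them; they are handled by counting entries, the other rows by cancellation of signs.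
  set A : Finset m := R.filter fun i => η ≤ ‖a i‖ ^ 2 with hA
  have hRn : (R.card : ℝ) ≤ n := Nat.cast_le.2 (Finset.card_le_univ R)
  have hAcard : (A.card : ℝ) ≤ n / 256 := by
    have h1 : (A.card : ℝ) * η ≤ ∑ i, ‖a i‖ ^ 2 := by
      rw [← nsmul_eq_mul]
      refine (Finset.card_nsmul_le_sum A _ η fun i hi => (Finset.mem_filter.1 hi).2).trans ?_
      exact Finset.sum_le_univ_sum_of_nonneg fun i => by positivity
    rw [sum_norm_sq_starProjection] at h1
    have := h1.trans hK
    rw [mul_comm] at this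
    exact le_of_mul_le_mul_left this hη
  set N : (m → J → SignType) → ℝ := fun Z => ∑ i ∈ R, (Z i j : ℝ) ^ 2 with hN
  set NA : (m → J → SignType) → ℝ := fun Z => ∑ i ∈ A, (Z i j : ℝ) ^ 2 with hNA
  set S : (m → J → SignType) → EuclideanSpace ℝ m := fun Z => ∑ i ∈ R \ A, (Z i j : ℝ) • a i with hS
  set V : (m → J → SignType) → ℝ := fun Z => ∑ i ∈ R \ A, (Z i j : ℝ) ^ 2 * ‖a i‖ ^ 2 with hV
  set W := designWeight m p with hW
  have hpj := hp j
  have E1 : prob W {Z | N Z < ν / 8} ≤ Real.exp (-(ν / 128)) := by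
    have h1 := prob_le_avg hw (S := {Z | N Z < ν / 8})
      (f := fun Z => Real.exp (ν / 8) * Real.exp ((-1) * N Z)) (fun Z => by positivity)
      (fun Z hZ => by
        rw [← Real.exp_add, Real.one_le_exp_iff]
        have : N Z < ν / 8 := hZ
        linarith)
    rw [avg_const_mul] at h1
    refine h1.trans ((mul_le_mul_of_nonneg_left (avg_exp_count_le hp j R (-1))
      (Real.exp_pos _).le).trans ?_)
    rw [← Real.exp_add]
    apply Real.exp_le_exp.2
    have he : Real.exp (-1) ≤ 1 / 2 := by
      rw [Real.exp_neg, inv_le_comm₀ (Real.exp_pos 1) (by norm_num)]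
      have := Real.add_one_le_exp (1 : ℝ)
      norm_num; linarith
    have h2 : R.card * p j ≥ ν / 2 := by
      have := mul_le_mul_of_nonneg_right hR hpj.1
      simp only [hν]; linarith
    have h3 : R.card * p j * (Real.exp (-1) - 1) ≤ ν / 2 * (-(1 / 2)) := by nlinarith
    linarith
  have E2 : prob W {Z | 4 * ν < N Z} ≤ Real.exp (-(ν / 128)) := by
    have h1 := prob_le_avg hw (S := {Z | 4 * ν < N Z})
      (f := fun Z => Real.exp (-(4 * ν)) * Real.exp (1 * N Z)) (fun Z => by positivity)
      (fun Z hZ => by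
        rw [← Real.exp_add, Real.one_le_exp_iff]
        have : 4 * ν < N Z := hZ
        linarith)
    rw [avg_const_mul] at h1
    refine h1.trans ((mul_le_mul_of_nonneg_left (avg_exp_count_le hp j R 1)
      (Real.exp_pos _).le).trans ?_)
    rw [← Real.exp_add]
    apply Real.exp_le_exp.2
    have he := Real.exp_one_lt_d9
    have he1 := Real.add_one_le_exp (1 : ℝ)
    have h2 : R.card * p j ≤ ν := by
      have := mul_le_mul_of_nonneg_right hRn hpj.1
      simpa only [hν] using this
    have h3 : R.card * p j * (Real.exp 1 - 1) ≤ ν * 2 := by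
      have : 0 ≤ R.card * p j := mul_nonneg (by positivity) hpj.1
      nlinarith
    linarith
  have E3 : prob W {Z | ν / 64 < NA Z} ≤ Real.exp (-(ν / 128)) := by
    have h1 := prob_le_avg hw (S := {Z | ν / 64 < NA Z})
      (f := fun Z => Real.exp (-(ν / 64)) * Real.exp (1 * NA Z)) (fun Z => by positivity)
      (fun Z hZ => by
        rw [← Real.exp_add, Real.one_le_exp_iff]
        have : ν / 64 < NA Z := hZ
        linarith)
    rw [avg_const_mul] at h1
    refine h1.trans ((mul_le_mul_of_nonneg_left (avg_exp_count_le hp j A 1)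
      (Real.exp_pos _).le).trans ?_)
    rw [← Real.exp_add]
    apply Real.exp_le_exp.2
    have he := Real.exp_one_lt_d9
    have he1 := Real.add_one_le_exp (1 : ℝ)
    have h2 : A.card * p j ≤ ν / 256 := by
      have := mul_le_mul_of_nonneg_right hAcard hpj.1
      simp only [hν]; linarith
    have h3 : A.card * p j * (Real.exp 1 - 1) ≤ ν / 256 * 2 := by
      have : 0 ≤ A.card * p j := mul_nonneg (by positivity) hpj.1
      nlinarith
    linarith
  have E4 : prob W {Z | N Z ≤ 4 * ν ∧ ν / 64 < ‖S Z‖ ^ 2} ≤ 2 * Real.exp (-(1 / (1024 * η))) := by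
    have hVN : ∀ Z, V Z ≤ η * N Z := by
      intro Z
      have h1 : V Z ≤ ∑ i ∈ R \ A, η * (Z i j : ℝ) ^ 2 := by
        refine Finset.sum_le_sum fun i hi => ?_
        have : ‖a i‖ ^ 2 ≤ η := by
          obtain ⟨h1, h2⟩ := Finset.mem_sdiff.1 hi
          by_contra h
          exact h2 (Finset.mem_filter.2 ⟨h1, (not_le.1 h).le⟩)
        nlinarith [sq_nonneg (Z i j : ℝ)]
      rw [← Finset.mul_sum] at h1
      refine h1.trans (mul_le_mul_of_nonneg_left ?_ hη.le)
      exact Finset.sum_le_sum_of_subset_of_nonneg Finset.sdiff_subset fun i _ _ => by positivity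
    -- On the event `N ≤ 4ν` one has `V ≤ 4ην`, so this is the largest exponent that this bound
    -- allows under the condition 4θV ≤ 1.
    set θ₀ : ℝ := 1 / (16 * η * ν) with hθ₀
    have hθ₀0 : 0 ≤ θ₀ := by positivity
    -- Weight and exponent are switched off outside the event that the column has few nonzero
    -- entries. The event is invariant under sign flips, as the moment bound requires.
    let G : Set (m → J → SignType) := {Z | N Z ≤ 4 * ν}
    have hNf : ∀ i Z, N (flipEntry i j Z) = N Z := fun i Z => by simp only [hN, flipEntry_sq]
    have hGf : ∀ i Z, (flipEntry i j Z ∈ G) = (Z ∈ G) := fun i Z => by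
      simp only [G, Set.mem_ofPred_eq, hNf]
    have key := avg_exp_norm_sq_le hp j a (R \ A) (fun Z => if Z ∈ G then Real.exp (-(θ₀ * (ν / 64))) else 0)
      (fun Z => if Z ∈ G then θ₀ else 0) (fun Z => by split_ifs <;> positivity)
      (fun Z => by split_ifs <;> positivity) (fun i Z => by simp only [hGf])
      (fun i Z => by simp only [hGf]) (fun Z => by
        split_ifs with hZ
        · have h1 : V Z ≤ η * (4 * ν) := (hVN Z).trans (mul_le_mul_of_nonneg_left hZ hη.le)
          calc 4 * θ₀ * V Z ≤ 4 * θ₀ * (η * (4 * ν)) := by gcongr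
            _ = 1 := by rw [hθ₀]; field_simp; norm_num
        · simp)
    have h1 := prob_le_avg hw (S := {Z | N Z ≤ 4 * ν ∧ ν / 64 < ‖S Z‖ ^ 2})
      (f := fun Z => (if Z ∈ G then Real.exp (-(θ₀ * (ν / 64))) else 0) *
        Real.exp ((if Z ∈ G then θ₀ else 0) * ‖S Z‖ ^ 2)) (fun Z => by
          split_ifs <;> positivity) (fun Z hZ => by
        have hZG : Z ∈ G := hZ.1
        rw [if_pos hZG, if_pos hZG, ← Real.exp_add, Real.one_le_exp_iff]
        have : θ₀ * (ν / 64) ≤ θ₀ * ‖S Z‖ ^ 2 := mul_le_mul_of_nonneg_left hZ.2.le hθ₀0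
        linarith)
    refine h1.trans (key.trans (avg_le_of_le hw fun Z => ?_))
    split_ifs with hZ
    · have h1 : V Z ≤ η * (4 * ν) := (hVN Z).trans (mul_le_mul_of_nonneg_left hZ hη.le)
      have h2 : 2 * θ₀ * V Z ≤ 1 / 2 := by
        calc 2 * θ₀ * V Z ≤ 2 * θ₀ * (η * (4 * ν)) := by gcongr
            _ = 1 / 2 := by rw [hθ₀]; field_simp; norm_num
      have h3 : θ₀ * (ν / 64) = 1 / (1024 * η) := by rw [hθ₀]; field_simp; norm_num
      have h4 : Real.exp (1 / 2) ≤ 2 := by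
        have h5 := Real.exp_one_lt_d9
        have h6 : Real.exp (1 / 2) ^ 2 = Real.exp 1 := by rw [← Real.exp_nat_mul]; norm_num
        nlinarith [Real.exp_pos (1 / 2 : ℝ)]
      rw [h3, mul_comm]
      exact mul_le_mul_of_nonneg_right ((Real.exp_le_exp.2 h2).trans h4) (Real.exp_pos _).le
    · rw [zero_mul]; positivity
  -- Outside the four events the squared distance is at least ν/8 - 2·ν/64 - 2·ν/64 = ν/16.
  have hcover : {Z | ‖columnVec R j Z‖ ^ 2 - ‖K.starProjection (columnVec R j Z)‖ ^ 2 < ν / 16} ⊆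
      (({Z | N Z < ν / 8} ∪ {Z | 4 * ν < N Z}) ∪ {Z | ν / 64 < NA Z}) ∪
        {Z | N Z ≤ 4 * ν ∧ ν / 64 < ‖S Z‖ ^ 2} := by
    intro Z hZ
    by_contra hcon
    simp only [Set.mem_union, Set.mem_ofPred_eq, not_or, not_lt, not_and] at hcon
    obtain ⟨⟨⟨c1, c2⟩, c3⟩, c4⟩ := hcon
    have c4 := c4 c2
    have hsplit : K.starProjection (columnVec R j Z) = K.starProjection (columnVec A j Z) + S Z := by
      have h1 : columnVec R j Z = columnVec A j Z + columnVec (R \ A) j Z := by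
        rw [columnVec, columnVec, columnVec, add_comm]
        exact (Finset.sum_sdiff (Finset.filter_subset _ _)).symm
      rw [h1, map_add]
      congr 1
      simp only [columnVec, map_sum, map_smul, hS, ha]
    have h2 : ‖K.starProjection (columnVec R j Z)‖ ^ 2 ≤
        2 * ‖K.starProjection (columnVec A j Z)‖ ^ 2 + 2 * ‖S Z‖ ^ 2 := by
      rw [hsplit]
      have h3 := norm_add_le (K.starProjection (columnVec A j Z)) (S Z)
      nlinarith [norm_nonneg (K.starProjection (columnVec A j Z) + S Z),
        sq_nonneg (‖K.starProjection (columnVec A j Z)‖ - ‖S Z‖)]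
    have h4 : ‖K.starProjection (columnVec A j Z)‖ ^ 2 ≤ NA Z := by
      rw [hNA]
      simp only [← norm_sq_columnVec]
      exact pow_le_pow_left₀ (norm_nonneg _) (K.norm_starProjection_apply_le _) 2
    have h5 : ‖columnVec R j Z‖ ^ 2 = N Z := norm_sq_columnVec R j Z
    have h6 : ‖columnVec R j Z‖ ^ 2 - ‖K.starProjection (columnVec R j Z)‖ ^ 2 < ν / 16 := hZ
    linarith
  have h1 := prob_union_le hw {Z | N Z < ν / 8} {Z | 4 * ν < N Z}
  have h2 := prob_union_le hw ({Z | N Z < ν / 8} ∪ {Z | 4 * ν < N Z}) {Z | ν / 64 < NA Z}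
  have h3 := prob_union_le hw (({Z | N Z < ν / 8} ∪ {Z | 4 * ν < N Z}) ∪ {Z | ν / 64 < NA Z})
    {Z | N Z ≤ 4 * ν ∧ ν / 64 < ‖S Z‖ ^ 2}
  have h4 := prob_mono hw hcover
  linarith

/-- The designs in which some column in `Q` is close, in the rows `R`, to the span of the other
columns in `Q`. -/
def nearDependent (p : J → ℝ) (R : Finset m) (Q : Finset J) : Set (m → J → SignType) :=
  {Z | ∃ j ∈ Q, ∃ u : J → ℝ, u j = 1 ∧
    ∑ i ∈ R, (∑ l ∈ Q, (Z i l : ℝ) * u l) ^ 2 < Fintype.card m * p j / 16}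

/-- With all columns but `j` frozen, the other columns of `Q` span a fixed subspace of dimension at
most `Q.card`, and column `j` is independent of it. Then sum over `j`. -/
theorem prob_nearDependent_le (hp : ∀ j, 0 ≤ p j ∧ p j ≤ 1) (R : Finset m) (Q : Finset J) {η q : ℝ}
    (hη : 0 < η) (hR : (Fintype.card m : ℝ) / 2 ≤ R.card)
    (hQ : (Q.card : ℝ) ≤ η * (Fintype.card m / 256)) (hq : ∀ j ∈ Q, q ≤ p j) :
    prob (designWeight m p) (nearDependent p R Q) ≤
      Q.card * (3 * Real.exp (-(Fintype.card m * q / 128)) + 2 * Real.exp (-(1 / (1024 * η)))) := by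
  classical
  have hw := isWeight_design m hp
  refine (prob_biUnion_le hw Q (fun j => {Z | ∃ u : J → ℝ, u j = 1 ∧
    ∑ i ∈ R, (∑ l ∈ Q, (Z i l : ℝ) * u l) ^ 2 < Fintype.card m * p j / 16})).trans ?_
  rw [← nsmul_eq_mul]
  refine Finset.sum_le_card_nsmul _ _ _ fun j hj => ?_
  refine prob_le_of_resample hp (fun _ l => l ≠ j) fun Z => ?_
  let K : Submodule ℝ (EuclideanSpace ℝ m) :=
    Submodule.span ℝ ((Q.erase j).image fun l => columnVec R l Z : Finset (EuclideanSpace ℝ m))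
  have hKfin : (Module.finrank ℝ K : ℝ) ≤ η * (Fintype.card m / 256) := by
    refine le_trans ?_ hQ
    exact_mod_cast (finrank_span_finset_le_card _).trans
      (Finset.card_image_le.trans (Finset.card_erase_le))
  refine (prob_mono hw ?_).trans ((prob_columnVec_near_le hp R j K hη hR hKfin).trans ?_)
  · rintro Z' ⟨u, hu1, hu2⟩
    refine lt_of_le_of_lt ?_ hu2
    set x := columnVec R j Z' with hx
    set y := ∑ l ∈ Q.erase j, u l • columnVec R l Z with hy
    have hyK : y ∈ K := Submodule.sum_mem _ fun l hl => Submodule.smul_mem _ _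
      (Submodule.subset_span (Finset.mem_coe.2 (Finset.mem_image_of_mem _ hl)))
    have h1 : ∑ i ∈ R, (∑ l ∈ Q, ((splice (fun _ l => l ≠ j) Z Z' i l : SignType) : ℝ) * u l) ^ 2 =
        ‖x + y‖ ^ 2 := by
      rw [EuclideanSpace.real_norm_sq_eq]
      have h2 : ∀ i, (x + y).ofLp i = if i ∈ R then
          ∑ l ∈ Q, ((splice (fun _ l => l ≠ j) Z Z' i l : SignType) : ℝ) * u l else 0 := by
        intro i
        have h3 : ∀ l (Z : m → J → SignType), (columnVec R l Z).ofLp i =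
            if i ∈ R then (Z i l : ℝ) else 0 := by
          intro l Z; simp [columnVec, Finset.sum_apply, Pi.single_apply]
        rw [← Finset.add_sum_erase Q _ hj]
        simp only [PiLp.add_apply, hx, hy, WithLp.ofLp_sum, Finset.sum_apply, PiLp.smul_apply, h3]
        split_ifs with hi
        · simp only [splice, ne_eq, not_true_eq_false, if_false, hu1, mul_one, smul_eq_mul]
          congr 1
          refine Finset.sum_congr rfl fun l hl => ?_
          rw [if_pos (Finset.ne_of_mem_erase hl), mul_comm]
        · simp
      simp [h2, Finset.sum_ite_mem]
    rw [h1]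
    have h4 := K.norm_sq_eq_add_norm_sq_starProjection
    have h5 := Submodule.norm_sq_eq_add_norm_sq_starProjection x K
    have h6 := Submodule.norm_sq_eq_add_norm_sq_starProjection (x + y) K
    -- Adding an element of `K` does not change the component orthogonal to `K`, and that component
    -- is at most the whole norm.
    have h7 : Kᗮ.starProjection (x + y) = Kᗮ.starProjection x := by
      rw [map_add, Submodule.starProjection_orthogonal_apply_eq_zero hyK, add_zero]
    rw [h7] at h6
    have := sq_nonneg ‖K.starProjection (x + y)‖
    linarith
  · have : Real.exp (-(Fintype.card m * p j / 128)) ≤ Real.exp (-(Fintype.card m * q / 128)) := by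
      apply Real.exp_le_exp.2
      have := mul_le_mul_of_nonneg_left (hq j hj) (Nat.cast_nonneg (α := ℝ) (Fintype.card m))
      linarith
    linarith

end column

/-! ### The Moore-Penrose inverse of a Gram matrix -/

section pinv

variable {d : ℕ} {A : Matrix (Fin d) (Fin d) ℝ} (hA : A.IsHermitian)

open Matrix

theorem eigen_star_mul_self :
    star (hA.eigenvectorUnitary : Matrix (Fin d) (Fin d) ℝ) * hA.eigenvectorUnitary = 1 :=
  Unitary.coe_star_mul_self _

theorem eigen_decomp : A = (hA.eigenvectorUnitary : Matrix (Fin d) (Fin d) ℝ) *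
    diagonal hA.eigenvalues * star (hA.eigenvectorUnitary : Matrix (Fin d) (Fin d) ℝ) := by
  have := hA.spectral_theorem
  rw [Unitary.conjStarAlgAut_apply] at this
  simpa using this

theorem eigen_conj_mul (a b : Fin d → ℝ) :
    ((hA.eigenvectorUnitary : Matrix (Fin d) (Fin d) ℝ) * diagonal a *
      star (hA.eigenvectorUnitary : Matrix (Fin d) (Fin d) ℝ)) *
    ((hA.eigenvectorUnitary : Matrix (Fin d) (Fin d) ℝ) * diagonal b *
      star (hA.eigenvectorUnitary : Matrix (Fin d) (Fin d) ℝ)) =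
    (hA.eigenvectorUnitary : Matrix (Fin d) (Fin d) ℝ) * diagonal (fun i => a i * b i) *
      star (hA.eigenvectorUnitary : Matrix (Fin d) (Fin d) ℝ) := by
  have h := eigen_star_mul_self hA
  set U := (hA.eigenvectorUnitary : Matrix (Fin d) (Fin d) ℝ)
  calc U * diagonal a * star U * (U * diagonal b * star U)
      = U * diagonal a * (star U * U) * diagonal b * star U := by simp only [Matrix.mul_assoc]
    _ = U * diagonal (fun i => a i * b i) * star U := by
      rw [h, Matrix.mul_one, Matrix.mul_assoc U, diagonal_mul_diagonal]

theorem symPinv_mul_self : symPinv A hA * A = (hA.eigenvectorUnitary : Matrix (Fin d) (Fin d) ℝ) *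
    diagonal (fun i => if hA.eigenvalues i = 0 then 0 else 1) *
      star (hA.eigenvectorUnitary : Matrix (Fin d) (Fin d) ℝ) := by
  have h := eigen_conj_mul hA (fun i => (hA.eigenvalues i)⁻¹) hA.eigenvalues
  rw [← eigen_decomp hA] at h
  rw [symPinv, h]
  congr 3
  ext i
  split_ifs with h0
  · simp [h0]
  · exact inv_mul_cancel₀ h0

theorem symPinv_mul_symPinv_cancel : symPinv A hA * A * symPinv A hA = symPinv A hA := by
  rw [symPinv_mul_self, symPinv, eigen_conj_mul]
  congr 3
  ext i
  split_ifs with h0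
  · simp [h0]
  · simp

theorem mul_symPinv_mul_self : A * (symPinv A hA * A) = A := by
  rw [symPinv_mul_self]
  have h := eigen_conj_mul hA hA.eigenvalues (fun i => if hA.eigenvalues i = 0 then 0 else 1)
  rw [← eigen_decomp hA] at h
  rw [h]
  conv_rhs => rw [eigen_decomp hA]
  congr 3
  ext i
  split_ifs with h0
  · simp [h0]
  · simp

theorem eigen_conj_transpose (a : Fin d → ℝ) :
    ((hA.eigenvectorUnitary : Matrix (Fin d) (Fin d) ℝ) * diagonal a *
      star (hA.eigenvectorUnitary : Matrix (Fin d) (Fin d) ℝ))ᵀ =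
    (hA.eigenvectorUnitary : Matrix (Fin d) (Fin d) ℝ) * diagonal a *
      star (hA.eigenvectorUnitary : Matrix (Fin d) (Fin d) ℝ) := by
  simp [star_eq_conjTranspose, conjTranspose_eq_transpose_of_trivial, Matrix.mul_assoc]

theorem symPinv_transpose : (symPinv A hA)ᵀ = symPinv A hA := eigen_conj_transpose hA _

theorem symPinv_mul_self_transpose : (symPinv A hA * A)ᵀ = symPinv A hA * A := by
  rw [symPinv_mul_self]; exact eigen_conj_transpose hA _

theorem symPinv_mul_comm : symPinv A hA * A = A * symPinv A hA := by
  have hAt : Aᵀ = A := by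
    simpa [conjTranspose_eq_transpose_of_trivial] using hA.eq
  have := symPinv_mul_self_transpose hA
  rw [transpose_mul, symPinv_transpose, hAt] at this
  exact this.symm

theorem symPinv_trace : (symPinv A hA).trace = ∑ i, (hA.eigenvalues i)⁻¹ := by
  rw [symPinv, Matrix.trace_mul_comm, ← Matrix.mul_assoc, eigen_star_mul_self, Matrix.one_mul,
    trace_diagonal]

theorem dotProduct_eigen_conj (a : Fin d → ℝ) (v : Fin d → ℝ) :
    v ⬝ᵥ ((hA.eigenvectorUnitary : Matrix (Fin d) (Fin d) ℝ) * diagonal a *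
      star (hA.eigenvectorUnitary : Matrix (Fin d) (Fin d) ℝ)) *ᵥ v =
    ∑ i, a i * ((star (hA.eigenvectorUnitary : Matrix (Fin d) (Fin d) ℝ) *ᵥ v) i) ^ 2 := by
  set U := (hA.eigenvectorUnitary : Matrix (Fin d) (Fin d) ℝ)
  have h1 : v ᵥ* U = star U *ᵥ v := by
    rw [star_eq_conjTranspose, conjTranspose_eq_transpose_of_trivial, mulVec_transpose]
  rw [← mulVec_mulVec, ← mulVec_mulVec, dotProduct_mulVec, h1]
  simp only [dotProduct, mulVec_diagonal]
  exact Finset.sum_congr rfl fun i _ => by ring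

/-- Spectral gap inequality on the range. -/
theorem dotProduct_symPinv_mul_le {D : ℝ}
    (hD : ∀ i, hA.eigenvalues i ≠ 0 → 1 ≤ D * hA.eigenvalues i) (v : Fin d → ℝ) :
    v ⬝ᵥ (symPinv A hA * A) *ᵥ v ≤ D * (v ⬝ᵥ A *ᵥ v) := by
  have h2 : v ⬝ᵥ A *ᵥ v = ∑ i, hA.eigenvalues i *
      ((star (hA.eigenvectorUnitary : Matrix (Fin d) (Fin d) ℝ) *ᵥ v) i) ^ 2 := by
    rw [← dotProduct_eigen_conj, ← eigen_decomp]
  rw [symPinv_mul_self, dotProduct_eigen_conj, h2, Finset.mul_sum]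
  refine Finset.sum_le_sum fun i _ => ?_
  rw [← mul_assoc]
  refine mul_le_mul_of_nonneg_right ?_ (sq_nonneg _)
  split_ifs with h0
  · simp [h0]
  · exact hD i h0

end pinv

/-! ### Row-space projections and integrality of Gram eigenvalues. -/

section gram

open Matrix

variable {n d : ℕ} (X : Matrix (Fin n) (Fin d) ℝ)

/-- With P the product of the pseudoinverse and the Gram matrix, XᵀXP = XᵀX makes the Gram matrix of
XP - X vanish, hence XP - X itself. -/
theorem mul_gram_symPinv_mul :
    X * (symPinv (Xᵀ * X) (gram_isHermitian X) * (Xᵀ * X)) = X := by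
  set G := symPinv (Xᵀ * X) (gram_isHermitian X)
  have h1 := mul_symPinv_mul_self (gram_isHermitian X)
  have h2 := symPinv_mul_self_transpose (gram_isHermitian X)
  set P := G * (Xᵀ * X) with hP
  change Xᵀ * X * P = Xᵀ * X at h1
  have h3 : (X * P - X)ᴴ * (X * P - X) = 0 := by
    rw [conjTranspose_eq_transpose_of_trivial, transpose_sub, transpose_mul,
      show Pᵀ = P from h2, Matrix.sub_mul, Matrix.mul_sub, Matrix.mul_sub]
    have h4 : Xᵀ * (X * P) = Xᵀ * X := by rw [← Matrix.mul_assoc, h1]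
    have h5 : P * Xᵀ * (X * P) = P * Xᵀ * X := by
      rw [Matrix.mul_assoc P, h4, ← Matrix.mul_assoc P]
    rw [h4, h5]; simp
  exact sub_eq_zero.1 (conjTranspose_mul_self_eq_zero.1 h3)

theorem dotProduct_gram (v : Fin d → ℝ) :
    v ⬝ᵥ (Xᵀ * X) *ᵥ v = ∑ i, ((X *ᵥ v) i) ^ 2 := by
  rw [← mulVec_mulVec, dotProduct_mulVec, vecMul_transpose, dotProduct]
  exact Finset.sum_congr rfl fun i _ => by ring

/-- Every vector is close to the kernel, relative to its image. -/
theorem exists_near_kernel {D : ℝ} (hD : ∀ i, (gram_isHermitian X).eigenvalues i ≠ 0 →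
    1 ≤ D * (gram_isHermitian X).eigenvalues i) (v : Fin d → ℝ) :
    ∃ u, X *ᵥ u = 0 ∧ ∑ j, (v j - u j) ^ 2 ≤ D * ∑ i, ((X *ᵥ v) i) ^ 2 := by
  set P := symPinv (Xᵀ * X) (gram_isHermitian X) * (Xᵀ * X) with hP
  have hXP : X * P = X := mul_gram_symPinv_mul X
  -- Remove from `v` its orthogonal projection to the row space; the spectral gap bounds what is
  -- removed.
  refine ⟨v - P *ᵥ v, ?_, ?_⟩
  · rw [mulVec_sub, mulVec_mulVec, hXP, sub_self]
  · have h1 := dotProduct_symPinv_mul_le (gram_isHermitian X) hD v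
    rw [dotProduct_gram] at h1
    refine le_trans (le_of_eq ?_) h1
    have h2 : P * P = P := by
      rw [hP, ← Matrix.mul_assoc, symPinv_mul_symPinv_cancel]
    have h3 : Pᵀ = P := symPinv_mul_self_transpose _
    rw [← hP]
    calc ∑ j, (v j - (v - P *ᵥ v) j) ^ 2 = (P *ᵥ v) ⬝ᵥ (P *ᵥ v) := by
          rw [dotProduct]
          exact Finset.sum_congr rfl fun j _ => by simp; ring
      _ = v ⬝ᵥ P *ᵥ v := by
          conv_lhs => rw [dotProduct_mulVec, ← mulVec_transpose, mulVec_mulVec, h3, h2]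
          exact dotProduct_comm _ _

/-- Lower bound for the nonzero eigenvalues of the Gram matrix of an integer matrix. -/
theorem eigenvalue_gram_ge {C : ℝ} (Y : Matrix (Fin n) (Fin d) ℤ) (hC : 1 ≤ C)
    (hY : ∀ i j, ((Y i j : ℤ) : ℝ) ^ 2 ≤ 4) (hnC : (4 * n * d : ℝ) ≤ C) (i : Fin d)
    (hi : (gram_isHermitian (Y.map (Int.cast : ℤ → ℝ))).eigenvalues i ≠ 0) :
    1 ≤ C ^ d * (gram_isHermitian (Y.map (Int.cast : ℤ → ℝ))).eigenvalues i := by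
  classical
  set X : Matrix (Fin n) (Fin d) ℝ := Y.map (Int.cast : ℤ → ℝ) with hX
  set hA := gram_isHermitian X
  set ev := hA.eigenvalues with hev
  have hpsd : (Xᵀ * X).PosSemidef := by
    simpa [conjTranspose_eq_transpose_of_trivial] using posSemidef_conjTranspose_mul_self X
  have hev0 : ∀ i, 0 ≤ ev i := fun i => hpsd.eigenvalues_nonneg i
  have htr : ∑ i, ev i ≤ C := by
    have h1 : (Xᵀ * X).trace = ∑ i, ev i := by
      simpa using hA.trace_eq_sum_eigenvalues
    rw [← h1]
    refine le_trans ?_ hnC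
    have h2 : (Xᵀ * X).trace = ∑ j, ∑ i, (X i j) ^ 2 := by
      simp only [Matrix.trace, diag_apply, mul_apply, transpose_apply]
      exact Finset.sum_congr rfl fun j _ => Finset.sum_congr rfl fun i _ => by ring
    rw [h2]
    calc ∑ j : Fin d, ∑ i : Fin n, (X i j) ^ 2 ≤ ∑ j : Fin d, ∑ i : Fin n, (4 : ℝ) :=
          Finset.sum_le_sum fun j _ => Finset.sum_le_sum fun i _ => hY i j
      _ = 4 * n * d := by simp; ring
  have hevC : ∀ i, ev i ≤ C := fun i =>
    (Finset.single_le_sum (fun i _ => hev0 i) (Finset.mem_univ i)).trans htr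
  set s := Finset.univ.filter fun i => ev i ≠ 0 with hs
  -- If zero is an eigenvalue of multiplicity `r`, the coefficient of degree `r` of the
  -- characteristic polynomial is, up to sign, the product of the nonzero eigenvalues. It is a
  -- nonzero integer.
  have hprod : 1 ≤ ∏ i ∈ s, ev i := by
    have h1 := hA.charpoly_eq
    have h2 : (Xᵀ * X).charpoly = ((Yᵀ * Y).charpoly).map (Int.castRingHom ℝ) := by
      rw [← Matrix.charpoly_map]
      congr 1
      rw [Matrix.map_mul, ← Matrix.transpose_map]
      rfl
    have h3 : ∏ i, (Polynomial.X - Polynomial.C (ev i)) =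
        Polynomial.X ^ (Finset.univ.filter fun i => ¬ ev i ≠ 0).card *
          ∏ i ∈ s, (Polynomial.X - Polynomial.C (ev i)) := by
      rw [← Finset.prod_filter_mul_prod_filter_not Finset.univ (fun i => ev i ≠ 0), mul_comm]
      congr 1
      rw [← Finset.prod_const]
      refine Finset.prod_congr rfl fun i hi => ?_
      have : ev i = 0 := by simpa using hi
      simp [this]
    set r := (Finset.univ.filter fun i => ¬ ev i ≠ 0).card
    have h4 : (Xᵀ * X).charpoly.coeff r = ∏ i ∈ s, (- ev i) := by
      rw [h1]
      change (∏ i, (Polynomial.X - Polynomial.C (ev i))).coeff r = _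
      rw [h3]
      rw [Polynomial.coeff_X_pow_mul', if_pos le_rfl, Nat.sub_self, Polynomial.coeff_zero_eq_eval_zero,
        Polynomial.eval_prod]
      simp
    rw [h2, Polynomial.coeff_map] at h4
    have h5 : (((Yᵀ * Y).charpoly.coeff r : ℤ) : ℝ) = ∏ i ∈ s, (- ev i) := h4
    have h6 : ∏ i ∈ s, (- ev i) ≠ 0 := Finset.prod_ne_zero_iff.2 fun i hi => by
      simpa using (Finset.mem_filter.1 hi).2
    have h7 : (1 : ℝ) ≤ |∏ i ∈ s, (- ev i)| := by
      rw [← h5] at h6 ⊢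
      have : (Yᵀ * Y).charpoly.coeff r ≠ 0 := by exact_mod_cast h6
      exact_mod_cast Int.one_le_abs this
    rw [Finset.abs_prod] at h7
    simpa [abs_of_nonneg (hev0 _)] using h7
  have hmem : i ∈ s := Finset.mem_filter.2 ⟨Finset.mem_univ _, hi⟩
  rw [← Finset.prod_erase_mul _ _ hmem] at hprod
  refine hprod.trans (mul_le_mul_of_nonneg_right ?_ (hev0 i))
  calc ∏ i ∈ s.erase i, ev i ≤ ∏ i ∈ s.erase i, C :=
        Finset.prod_le_prod (fun i _ => hev0 i) fun i _ => hevC i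
    _ = C ^ (s.erase i).card := Finset.prod_const _
    _ ≤ C ^ d := pow_le_pow_right₀ hC ((Finset.card_le_univ _).trans_eq (Fintype.card_fin d))

end gram

/-! ### Nonzero eigenvalues of the Gram matrix of a design -/

theorem exists_antitone_enum {J : Type*} [DecidableEq J] (Q : Finset J) (f : J → ℝ) :
    ∃ e : Fin Q.card → J, Function.Injective e ∧ Finset.univ.image e = Q ∧
      Antitone fun a => f (e a) := by
  classical
  let e₀ : Fin Q.card → J := fun a => Q.equivFin.symm a
  let σ := Tuple.sort fun a => - f (e₀ a)
  have h₀ : Function.Injective e₀ := Subtype.val_injective.comp Q.equivFin.symm.injective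
  refine ⟨fun a => e₀ (σ a), h₀.comp σ.injective, ?_, ?_⟩
  · ext j
    simp only [Finset.mem_image, Finset.mem_univ, true_and]
    constructor
    · rintro ⟨a, rfl⟩; exact (Q.equivFin.symm _).2
    · intro hj
      exact ⟨σ.symm (Q.equivFin ⟨j, hj⟩), by simp [e₀]⟩
  · intro a b hab
    have := Tuple.monotone_sort (fun a => - f (e₀ a)) hab
    simpa using this

/-! ### Decay of the sorted entries of a nearly null vector. -/

section growth

variable {m J : Type*} [Fintype m] [DecidableEq m] [Fintype J] [DecidableEq J]

/-- If no pair of column sets of size more than `t` is bad and `v` is nearly orthogonal to the rows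
in `R`, then only the `t` largest entries of `v` can be large. -/
theorem sorted_entry_le {R : Finset m} {Q : Finset J} {M t : ℕ} (hM : 1 ≤ M) {Z : m → J → SignType}
    (hgood : ∀ r, t < r → Z ∉ badSize R Q M r) {v : J → ℝ} {ε : ℝ} (hε : 0 ≤ ε)
    (hv : ∀ i ∈ R, |∑ j ∈ Q, (Z i j : ℝ) * v j| ≤ ε) {e : Fin Q.card → J}
    (he : Function.Injective e) (heQ : Finset.univ.image e = Q) (hanti : Antitone fun a => |v (e a)|)
    {s : ℕ} (hs : Q.card < M ^ s) (a : Fin Q.card) (hta : t ≤ a) :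
    |v (e a)| ≤ ε * (2 + 2 * Q.card) ^ s := by
  classical
  -- Induction over scales of rank: the bound at rank `a` uses the one at rank M(a + 1), and each
  -- step costs a factor 2 + 2|Q|. After `s` steps the rank exceeds |Q| and nothing remains.
  suffices H : ∀ s a, t ≤ a → Q.card < (a + 1) * M ^ s → ∀ h : a < Q.card,
      |v (e ⟨a, h⟩)| ≤ ε * (2 + 2 * Q.card) ^ s from
    H s a hta (hs.trans_le (Nat.le_mul_of_pos_left _ (Nat.succ_pos _))) a.2
  clear hs hta a s
  intro s
  induction s with
  | zero => intro a _ h1 h; simp at h1; omega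
  | succ s ih =>
    intro a hta h1 h
    set x := |v (e ⟨a, h⟩)| with hx
    have hpow : (1 : ℝ) ≤ (2 + 2 * Q.card) ^ s := one_le_pow₀ (by
      have : (0 : ℝ) ≤ Q.card := by positivity
      linarith)
    rcases (abs_nonneg (v (e ⟨a, h⟩))).eq_or_lt with h0 | h0
    · rw [hx, ← h0]; positivity
    -- `T` holds the a + 1 largest entries, `T'` the M(a + 1) largest. As the pair is not bad, for
    -- `v` scaled by its entry `x` of rank `a` some row sees more than x/2 on `T'`. Since the full
    -- row sum is at most ε, the entries outside `T'` must balance it, and these are small by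
    -- induction.
    let T : Finset J := (Finset.univ.filter fun b : Fin Q.card => (b : ℕ) < a + 1).image e
    let T' : Finset J := (Finset.univ.filter fun b : Fin Q.card => (b : ℕ) < M * (a + 1)).image e
    have hTT' : T ⊆ T' := Finset.image_subset_image fun b hb => by
      have : (b : ℕ) < a + 1 := by simpa using hb
      simp only [Finset.mem_filter, Finset.mem_univ, true_and]
      exact this.trans_le (Nat.le_mul_of_pos_left _ hM)
    have hT'Q : T' ⊆ Q := by
      conv_rhs => rw [← heQ]
      exact Finset.image_subset_image (Finset.filter_subset _ _)
    have hcard : ∀ c, ((Finset.univ.filter fun b : Fin Q.card => (b : ℕ) < c).image e).card =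
        min Q.card c := by
      intro c
      rw [Finset.card_image_of_injective _ he, Fin.card_filter_val_lt]
    have hTcard : T.card = a + 1 := by rw [hcard]; omega
    have hT'card : T'.card ≤ M * (a + 1) := by rw [hcard]; omega
    have hrest : ∀ j ∈ Q \ T', |v j| ≤ ε * (2 + 2 * Q.card) ^ s := by
      intro j hj
      obtain ⟨hjQ, hjT'⟩ := Finset.mem_sdiff.1 hj
      rw [← heQ] at hjQ
      obtain ⟨b, -, rfl⟩ := Finset.mem_image.1 hjQ
      have hb : M * (a + 1) ≤ b := by
        by_contra hb
        exact hjT' (Finset.mem_image_of_mem _ (by simpa using hb))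
      have hMQ : M * (a + 1) < Q.card := hb.trans_lt b.2
      have h2 : a ≤ M * (a + 1) := by nlinarith
      have h3 := ih (M * (a + 1)) (by omega) (by
        rw [pow_succ] at h1
        calc Q.card < (a + 1) * (M ^ s * M) := h1
          _ = (M * (a + 1)) * M ^ s := by ring
          _ ≤ (M * (a + 1) + 1) * M ^ s := by gcongr; omega) hMQ
      refine le_trans ?_ h3
      exact hanti (show (⟨M * (a + 1), hMQ⟩ : Fin Q.card) ≤ b from hb)
    have hnb : Z ∉ badPair R T T' := fun hb =>
      hgood (a + 1) (by omega) ⟨T, T', hTT', hT'Q, hTcard, hT'card, hb⟩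
    simp only [badPair, Set.mem_ofPred_eq, not_exists, not_and, not_forall, not_le] at hnb
    obtain ⟨i, hi, hi2⟩ := hnb (fun j => v j / x) (by
      intro j hj
      obtain ⟨b, hb, rfl⟩ := Finset.mem_image.1 hj
      have hb' : (b : ℕ) < a + 1 := by simpa using hb
      rw [abs_div, hx, abs_abs, one_le_div h0]
      exact hanti (show b ≤ ⟨a, h⟩ from Nat.lt_succ_iff.1 hb'))
    have h4 : x / 2 < |∑ j ∈ T', (Z i j : ℝ) * v j| := by
      have h5 : ∑ j ∈ T', (Z i j : ℝ) * (v j / x) = (∑ j ∈ T', (Z i j : ℝ) * v j) / x := by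
        rw [Finset.sum_div]; exact Finset.sum_congr rfl fun j _ => by ring
      rw [h5, abs_div, hx, abs_abs, lt_div_iff₀ h0] at hi2
      rw [hx]; linarith
    have h6 : |∑ j ∈ Q \ T', (Z i j : ℝ) * v j| ≤ Q.card * (ε * (2 + 2 * Q.card) ^ s) := by
      refine (Finset.abs_sum_le_sum_abs _ _).trans ?_
      have h7 : ∀ j ∈ Q \ T', |(Z i j : ℝ) * v j| ≤ ε * (2 + 2 * Q.card) ^ s := by
        intro j hj
        rw [abs_mul]
        have h8 : |((Z i j : SignType) : ℝ)| ≤ 1 := by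
          rcases (Z i j).trichotomy with h | h | h <;> simp [h]
        calc |((Z i j : SignType) : ℝ)| * |v j| ≤ 1 * |v j| := by gcongr
          _ ≤ _ := by rw [one_mul]; exact hrest j hj
      refine (Finset.sum_le_card_nsmul _ _ _ h7).trans ?_
      rw [nsmul_eq_mul]
      gcongr
      exact Finset.sdiff_subset
    have h9 := hv i hi
    rw [← Finset.sum_sdiff hT'Q] at h9
    have h10 : |∑ j ∈ T', (Z i j : ℝ) * v j| ≤ ε + Q.card * (ε * (2 + 2 * Q.card) ^ s) := by
      have := abs_sub (∑ j ∈ Q \ T', (Z i j : ℝ) * v j + ∑ j ∈ T', (Z i j : ℝ) * v j)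
        (∑ j ∈ Q \ T', (Z i j : ℝ) * v j)
      rw [add_sub_cancel_left] at this
      linarith
    have h11 : ε * 1 ≤ ε * (2 + 2 * Q.card) ^ s := mul_le_mul_of_nonneg_left hpow hε
    calc x ≤ 2 * (ε + Q.card * (ε * (2 + 2 * Q.card) ^ s)) := by linarith
      _ ≤ ε * (2 + 2 * Q.card) ^ (s + 1) := by rw [pow_succ]; nlinarith

end growth

/-! ### Eigenvalue bound: elimination of the rare columns and integrality for few common ones. -/

section eigen

open Matrix

variable {n d : ℕ}

/-- Real matrix of a design. -/
def designMatrix (Z : Fin n → Fin d → SignType) : Matrix (Fin n) (Fin d) ℝ :=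
  Matrix.of fun i j => (Z i j : ℝ)

/-- The rows without nonzero entry outside the columns `Q`. -/
def pureRows (Q : Finset (Fin d)) (Z : Fin n → Fin d → SignType) : Finset (Fin n) :=
  Finset.univ.filter fun i => ∀ j, j ∉ Q → Z i j = 0

/-- Every row has at most one nonzero entry outside the columns `Q`. -/
def RareSparse (Q : Finset (Fin d)) (Z : Fin n → Fin d → SignType) : Prop :=
  ∀ i j j', j ∉ Q → j' ∉ Q → Z i j ≠ 0 → Z i j' ≠ 0 → j = j'

theorem abs_sign_le_one (x : SignType) : |(x : ℝ)| ≤ 1 := by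
  rcases x.trichotomy with h | h | h <;> simp [h]

theorem sign_sq_eq_one {x : SignType} (h : x ≠ 0) : (x : ℝ) * x = 1 := by
  rcases x.trichotomy with h' | h' | h' <;> simp_all

set_option maxHeartbeats 1000000 in
/-- Lower bound for the nonzero eigenvalues of the Gram matrix. -/
theorem one_le_mul_eigenvalue {Q : Finset (Fin d)} {M t s : ℕ} (hM : 1 ≤ M)
    {Z : Fin n → Fin d → SignType} (hZ : RareSparse Q Z)
    (hgood : ∀ r, t < r → Z ∉ badSize (pureRows Q Z) Q M r) (hs : Q.card < M ^ s)
    {v : Fin d → ℝ} {lam : ℝ} (hlam : lam ≠ 0) (hv1 : ∑ j, v j ^ 2 = 1)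
    (hv : ((designMatrix Z)ᵀ * designMatrix Z) *ᵥ v = lam • v) :
    1 ≤ (d * (1 + Q.card * (2 + 2 * Q.card) ^ s) * (1 + 2 * d * (n * (4 * n * d) ^ t))) ^ 2 * lam := by
  classical
  set X := designMatrix Z with hX
  set R := pureRows Q Z with hR
  -- size of the image and the kernel
  have hlamsum : ∑ i, ((X *ᵥ v) i) ^ 2 = lam := by
    rw [← dotProduct_gram, hv, dotProduct_smul, smul_eq_mul, dotProduct]
    have : ∑ j, v j * v j = 1 := by rw [← hv1]; exact Finset.sum_congr rfl fun j _ => by ring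
    rw [this, mul_one]
  have hlam0 : 0 < lam := lt_of_le_of_ne (by
    rw [← hlamsum]; exact Finset.sum_nonneg fun i _ => sq_nonneg _) hlam.symm
  have hn : 0 < n := by
    rcases Nat.eq_zero_or_pos n with rfl | h
    · simp at hlamsum; exact absurd hlamsum.symm hlam
    · exact h
  have hd : 0 < d := by
    rcases Nat.eq_zero_or_pos d with rfl | h
    · simp at hv1
    · exact h
  have hn1 : (1 : ℝ) ≤ n := by exact_mod_cast hn
  have hd1 : (1 : ℝ) ≤ d := by exact_mod_cast hd
  set ε := Real.sqrt lam with hε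
  have hε0 : 0 ≤ ε := Real.sqrt_nonneg _
  have hε2 : ε ^ 2 = lam := Real.sq_sqrt hlam0.le
  have hrow : ∀ i, |(X *ᵥ v) i| ≤ ε := fun i => by
    rw [hε]
    apply Real.abs_le_sqrt
    rw [← hlamsum]
    exact Finset.single_le_sum (fun i _ => sq_nonneg ((X *ᵥ v) i)) (Finset.mem_univ i)
  -- An eigenvector of a nonzero eigenvalue is orthogonal to the kernel. The proof builds a kernel
  -- vector `w` close to `v`; then 1 = ⟨v, v - w⟩ bounds the eigenvalue from below.
  have hker : ∀ u, X *ᵥ u = 0 → v ⬝ᵥ u = 0 := by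
    intro u hu
    have h1 : (lam • v) ⬝ᵥ u = 0 := by
      rw [← hv, ← mulVec_mulVec, mulVec_transpose, ← dotProduct_mulVec, hu, dotProduct_zero]
    rw [smul_dotProduct, smul_eq_mul] at h1
    exact (mul_eq_zero.1 h1).resolve_left hlam
  have hvle : ∀ j, |v j| ≤ 1 := fun j => by
    rw [← sq_le_one_iff_abs_le_one, ← hv1]
    exact Finset.single_le_sum (fun j _ => sq_nonneg (v j)) (Finset.mem_univ j)
  -- the sorted common columns
  obtain ⟨e, he, heQ, hanti⟩ := exists_antitone_enum Q fun j => |v j|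
  have heQ' : ∀ a, e a ∈ Q := fun a => heQ ▸ Finset.mem_image_of_mem _ (Finset.mem_univ a)
  -- The bad size `t` may exceed the number of common columns; only `t₀` columns are kept.
  set t₀ := min t Q.card with ht₀
  set κ : ℝ := (Q.card : ℝ) with hκ
  have hκ0 : 0 ≤ κ := Nat.cast_nonneg _
  set Γ : ℝ := (2 + 2 * κ) ^ s with hΓ
  have hΓ0 : 0 ≤ Γ := by positivity
  have hXv : ∀ i, (X *ᵥ v) i = ∑ j ∈ Q, (Z i j : ℝ) * v j + ∑ j ∈ Qᶜ, (Z i j : ℝ) * v j := fun i => by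
    rw [Finset.sum_add_sum_compl]; rfl
  have hpure : ∀ i ∈ R, ∀ j ∈ Qᶜ, Z i j = 0 := fun i hi j hj =>
    (Finset.mem_filter.1 hi).2 j (Finset.mem_compl.1 hj)
  clear_value Γ κ
  have hrest : ∀ a : Fin Q.card, t ≤ a → |v (e a)| ≤ ε * Γ := by
    rw [hΓ, hκ]
    refine fun a ha => sorted_entry_le hM hgood hε0 (fun i hi => ?_) he heQ hanti hs a ha
    have h1 := hrow i
    rw [hXv, Finset.sum_eq_zero (s := Qᶜ) (fun j hj => by simp [hpure i hi j hj]), add_zero] at h1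
    exact h1
  let c : Fin t₀ → Fin d := fun a => e (Fin.castLE (min_le_right _ _) a)
  have hc : Function.Injective c := he.comp (Fin.castLE_injective _)
  set T : Finset (Fin d) := Finset.univ.image c with hT
  have hTQ : T ⊆ Q := fun j hj => by
    obtain ⟨a, -, rfl⟩ := Finset.mem_image.1 hj; exact heQ' _
  have hrestT : ∀ j ∈ Q \ T, |v j| ≤ ε * Γ := by
    intro j hj
    obtain ⟨h1, h2⟩ := Finset.mem_sdiff.1 hj
    rw [← heQ] at h1
    obtain ⟨b, -, rfl⟩ := Finset.mem_image.1 h1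
    refine hrest b ?_
    by_contra hb
    exact h2 (Finset.mem_image.2 ⟨⟨b, by have := b.2; omega⟩, Finset.mem_univ _, rfl⟩)
  have hsumT : ∀ f : Fin d → ℝ, ∑ j ∈ T, f j = ∑ a, f (c a) := fun f => by
    rw [hT, Finset.sum_image fun a _ b _ h => hc h]
  set ε' := ε * (1 + κ * Γ) with hε'
  have hε'0 : 0 ≤ ε' := by positivity
  have hrow' : ∀ i, |∑ a, (Z i (c a) : ℝ) * v (c a) + ∑ j ∈ Qᶜ, (Z i j : ℝ) * v j| ≤ ε' := by
    intro i
    have h1 := hrow i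
    rw [hXv, ← Finset.sum_sdiff hTQ, hsumT (fun j => (Z i j : ℝ) * v j)] at h1
    have h2 : |∑ j ∈ Q \ T, (Z i j : ℝ) * v j| ≤ κ * (ε * Γ) := by
      refine (Finset.abs_sum_le_sum_abs _ _).trans ?_
      have hcardle : ((Q \ T).card : ℝ) ≤ κ :=
        hκ ▸ Nat.cast_le.2 (Finset.card_le_card Finset.sdiff_subset)
      have h7 : ∀ j ∈ Q \ T, |(Z i j : ℝ) * v j| ≤ ε * Γ := by
        intro j hj
        rw [abs_mul]
        calc |((Z i j : SignType) : ℝ)| * |v j| ≤ 1 * |v j| := by gcongr; exact abs_sign_le_one _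
          _ ≤ _ := by rw [one_mul]; exact hrestT j hj
      refine (Finset.sum_le_card_nsmul _ _ _ h7).trans ?_
      rw [nsmul_eq_mul]
      exact mul_le_mul_of_nonneg_right hcardle (mul_nonneg hε0 hΓ0)
    have h3 := abs_sub (∑ j ∈ Q \ T, (Z i j : ℝ) * v j + ∑ a, (Z i (c a) : ℝ) * v (c a) +
      ∑ j ∈ Qᶜ, (Z i j : ℝ) * v j) (∑ j ∈ Q \ T, (Z i j : ℝ) * v j)
    rw [show ∑ j ∈ Q \ T, (Z i j : ℝ) * v j + ∑ a, (Z i (c a) : ℝ) * v (c a) +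
      ∑ j ∈ Qᶜ, (Z i j : ℝ) * v j - ∑ j ∈ Q \ T, (Z i j : ℝ) * v j =
      ∑ a, (Z i (c a) : ℝ) * v (c a) + ∑ j ∈ Qᶜ, (Z i j : ℝ) * v j by ring] at h3
    rw [hε']; linarith
  -- representatives of the rare columns
  have hexr : ∀ j : Fin d, ∃ i : Fin n, (∃ i', Z i' j ≠ 0) → Z i j ≠ 0 := fun j => by
    by_cases h : ∃ i', Z i' j ≠ 0
    · exact ⟨h.choose, fun _ => h.choose_spec⟩
    · exact ⟨⟨0, hn⟩, fun h' => absurd h' h⟩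
  choose rep hrep using hexr
  have hexc : ∀ i : Fin n, ∃ j : Fin d, i ∉ R → j ∉ Q ∧ Z i j ≠ 0 := fun i => by
    by_cases h : i ∈ R
    · exact ⟨⟨0, hd⟩, fun h' => absurd h h'⟩
    · have : ∃ j, j ∉ Q ∧ Z i j ≠ 0 := by
        by_contra hcon
        push Not at hcon
        exact h (Finset.mem_filter.2 ⟨Finset.mem_univ _, hcon⟩)
      exact ⟨this.choose, fun _ => this.choose_spec⟩
  choose col hcol using hexc
  have hrare : ∀ i j, j ∉ Q → Z i j ≠ 0 → ∀ w : Fin d → ℝ,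
      ∑ j' ∈ Qᶜ, (Z i j' : ℝ) * w j' = (Z i j : ℝ) * w j := fun i j hj hij w => by
    refine Finset.sum_eq_single_of_mem j (Finset.mem_compl.2 hj) fun j' hj' hne => ?_
    have : Z i j' = 0 := by
      by_contra h
      exact hne (hZ i j' j (Finset.mem_compl.1 hj') hj h hij)
    simp [this]
  -- the integer matrix
  let Y : Matrix (Fin n) (Fin t₀) ℤ := Matrix.of fun i a =>
    if i ∈ R then (Z i (c a) : ℤ) else
      (Z i (col i) : ℤ) * (Z i (c a) : ℤ) -
        (Z (rep (col i)) (col i) : ℤ) * (Z (rep (col i)) (c a) : ℤ)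
  have hcast : ∀ x : SignType, ((x : ℤ) : ℝ) = (x : ℝ) := fun x => by
    rcases x.trichotomy with h | h | h <;> simp [h]
  set YR : Matrix (Fin n) (Fin t₀) ℝ := Y.map (Int.cast : ℤ → ℝ) with hYR
  let D : Fin n → (Fin t₀ → ℝ) → ℝ := fun i w => ∑ a, (Z i (c a) : ℝ) * w a
  have hYmul : ∀ i w, (YR *ᵥ w) i = if i ∈ R then D i w else
      (Z i (col i) : ℝ) * D i w - (Z (rep (col i)) (col i) : ℝ) * D (rep (col i)) w := by
    intro i w
    by_cases hi : i ∈ R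
    · simp [YR, Y, mulVec, dotProduct, hi, D, hcast]
    · simp only [YR, Y, mulVec, dotProduct, hi, D, Matrix.map_apply, Matrix.of_apply, if_false,
        Int.cast_sub, Int.cast_mul, hcast, Finset.mul_sum]
      rw [← Finset.sum_sub_distrib]
      exact Finset.sum_congr rfl fun a _ => by ring
  have hD : ∀ i x, D i x = ∑ a, (Z i (c a) : ℝ) * x a := fun _ _ => rfl
  -- A row with rare column `j` expresses `v j` through the common entries, up to ε'. Subtracting
  -- the representative row of the same rare column eliminates `v j`, which explains the impure rows
  -- of `Y`.
  have hDrow : ∀ i j, j ∉ Q → Z i j ≠ 0 → |(Z i j : ℝ) * D i (fun a => v (c a)) + v j| ≤ ε' := by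
    intro i j hj hij
    have h1 := hrow' i
    rw [hrare i j hj hij v] at h1
    have h2 : (Z i j : ℝ) * D i (fun a => v (c a)) + v j =
        (Z i j : ℝ) * (D i (fun a => v (c a)) + (Z i j : ℝ) * v j) := by
      rw [mul_add, ← mul_assoc, sign_sq_eq_one hij, one_mul]
    rw [h2, abs_mul]
    calc |((Z i j : SignType) : ℝ)| * |D i (fun a => v (c a)) + (Z i j : ℝ) * v j|
        ≤ 1 * |D i (fun a => v (c a)) + (Z i j : ℝ) * v j| := by
          gcongr; exact abs_sign_le_one _
      _ ≤ ε' := by rw [one_mul]; exact h1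
  have hYv : ∀ i, |(YR *ᵥ fun a => v (c a)) i| ≤ 2 * ε' := by
    intro i
    rw [hYmul]
    split_ifs with hi
    · have h1 := hrow' i
      rw [Finset.sum_eq_zero (s := Qᶜ) (fun j hj => by simp [hpure i hi j hj]), add_zero] at h1
      exact h1.trans (by linarith)
    · obtain ⟨h1, h2⟩ := hcol i hi
      have h3 := hDrow i _ h1 h2
      have h4 := hDrow (rep (col i)) _ h1 (hrep _ ⟨i, h2⟩)
      have h5 := abs_sub ((Z i (col i) : ℝ) * D i (fun a => v (c a)) + v (col i))
        ((Z (rep (col i)) (col i) : ℝ) * D (rep (col i)) (fun a => v (c a)) + v (col i))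
      rw [add_sub_add_right_eq_sub] at h5
      linarith
  -- integrality
  set C : ℝ := 4 * n * d with hC
  have hC1 : 1 ≤ C := by rw [hC]; nlinarith
  have ht₀d : (t₀ : ℝ) ≤ d := by
    have h1 : t₀ ≤ d := (min_le_right _ _).trans ((Finset.card_le_univ Q).trans_eq (Fintype.card_fin d))
    exact_mod_cast h1
  have hint := eigenvalue_gram_ge Y hC1 (by
    intro i a
    have h1 : |((Y i a : ℤ) : ℝ)| ≤ 2 := by
      simp only [Y, Matrix.of_apply]
      split_ifs
      · rw [hcast]; exact (abs_sign_le_one _).trans (by norm_num)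
      · simp only [Int.cast_sub, Int.cast_mul, hcast]
        refine (abs_sub _ _).trans ?_
        rw [abs_mul, abs_mul]
        have := mul_le_one₀ (abs_sign_le_one (Z i (col i))) (abs_nonneg _) (abs_sign_le_one (Z i (c a)))
        have := mul_le_one₀ (abs_sign_le_one (Z (rep (col i)) (col i))) (abs_nonneg _)
          (abs_sign_le_one (Z (rep (col i)) (c a)))
        linarith
    rw [← sq_abs]; nlinarith [abs_nonneg ((Y i a : ℤ) : ℝ)]) (by rw [hC]; gcongr)
  obtain ⟨u, hu0, hu⟩ := exists_near_kernel YR hint (fun a => v (c a))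
  set Λ : ℝ := n * C ^ t with hΛ
  have hCt : C ^ t₀ ≤ C ^ t := pow_le_pow_right₀ hC1 (min_le_left _ _)
  have hCt1 : 1 ≤ C ^ t := one_le_pow₀ hC1
  have hΛ1 : 1 ≤ Λ := by rw [hΛ]; nlinarith
  set δ := 2 * Λ * ε' with hδ
  have hδ0 : 0 ≤ δ := by positivity
  have hclose : ∀ a, |v (c a) - u a| ≤ δ := by
    intro a
    refine abs_le_of_sq_le_sq ?_ hδ0
    have h1 : (v (c a) - u a) ^ 2 ≤ ∑ a, (v (c a) - u a) ^ 2 :=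
      Finset.single_le_sum (f := fun a => (v (c a) - u a) ^ 2) (fun a _ => sq_nonneg _)
        (Finset.mem_univ a)
    have h2 : ∑ i, ((YR *ᵥ fun a => v (c a)) i) ^ 2 ≤ n * (2 * ε') ^ 2 := by
      have : ∀ i ∈ Finset.univ, ((YR *ᵥ fun a => v (c a)) i) ^ 2 ≤ (2 * ε') ^ 2 := fun i _ => by
        rw [← sq_abs]
        exact pow_le_pow_left₀ (abs_nonneg _) (hYv i) 2
      simpa using Finset.sum_le_card_nsmul _ _ _ this
    calc (v (c a) - u a) ^ 2 ≤ C ^ t₀ * ∑ i, ((YR *ᵥ fun a => v (c a)) i) ^ 2 := h1.trans hu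
      _ ≤ C ^ t * (n * (2 * ε') ^ 2) := by gcongr
      _ = Λ * (2 * ε') ^ 2 := by rw [hΛ]; ring
      -- The distance bound comes with a square root of Λ; since Λ ≥ 1, using Λ instead loses only a
      -- power and avoids the root.
      _ ≤ Λ ^ 2 * (2 * ε') ^ 2 := by
        gcongr; nlinarith
      _ = δ ^ 2 := by rw [hδ]; ring
  -- extension of `u` to the kernel of `X`
  let w : Fin d → ℝ := fun j =>
    if h : ∃ a, c a = j then u h.choose else if j ∈ Q then 0 else
      if ∃ i, Z i j ≠ 0 then -((Z (rep j) j : ℝ) * D (rep j) u) else v j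
  have hwc : ∀ a, w (c a) = u a := fun a => by
    have h : ∃ b, c b = c a := ⟨a, rfl⟩
    simp only [w, dif_pos h]
    rw [hc h.choose_spec]
  have hwQT : ∀ j ∈ Q \ T, w j = 0 := fun j hj => by
    obtain ⟨h1, h2⟩ := Finset.mem_sdiff.1 hj
    have h : ¬ ∃ a, c a = j := fun ⟨a, ha⟩ => h2 (ha ▸ Finset.mem_image_of_mem _ (Finset.mem_univ a))
    simp [w, h, h1]
  have hwrare : ∀ j, j ∉ Q → (∃ i, Z i j ≠ 0) → w j = -((Z (rep j) j : ℝ) * D (rep j) u) :=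
    fun j hj hs => by
      have h : ¬ ∃ a, c a = j := fun ⟨a, ha⟩ => hj (ha ▸ heQ' _)
      simp only [w, dif_neg h, if_neg hj, if_pos hs]
  have hwun : ∀ j, j ∉ Q → (¬ ∃ i, Z i j ≠ 0) → w j = v j := fun j hj hs => by
    have h : ¬ ∃ a, c a = j := fun ⟨a, ha⟩ => hj (ha ▸ heQ' _)
    simp only [w, dif_neg h, if_neg hj, if_neg hs]
  clear_value w
  -- In a pure row this is the equation of `Y`. In an impure row the equation of `Y` says that its
  -- value for the rare entry agrees with the representative's, from which `w` was defined.
  have hXw : X *ᵥ w = 0 := by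
    ext i
    have h1 : (X *ᵥ w) i = D i u + ∑ j ∈ Qᶜ, (Z i j : ℝ) * w j := by
      have h2 : (X *ᵥ w) i = ∑ j, (Z i j : ℝ) * w j := rfl
      rw [h2, ← Finset.sum_add_sum_compl Q, ← Finset.sum_sdiff hTQ,
        Finset.sum_eq_zero (s := Q \ T) fun j hj => by rw [hwQT j hj, mul_zero], zero_add,
        hsumT (fun j => (Z i j : ℝ) * w j)]
      simp only [hwc, D]
    have h3 := hYmul i u
    rw [hu0, Pi.zero_apply] at h3
    rw [h1, Pi.zero_apply]
    by_cases hi : i ∈ R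
    · rw [if_pos hi] at h3
      rw [← h3, Finset.sum_eq_zero fun j hj => by simp [hpure i hi j hj], add_zero]
    · rw [if_neg hi] at h3
      obtain ⟨h4, h5⟩ := hcol i hi
      rw [hrare i _ h4 h5 w, hwrare _ h4 ⟨i, h5⟩]
      have h6 : (Z (rep (col i)) (col i) : ℝ) * D (rep (col i)) u = (Z i (col i) : ℝ) * D i u := by
        linarith
      rw [h6, mul_neg, ← mul_assoc, sign_sq_eq_one h5]; ring
  have hdist : ∀ j, |v j - w j| ≤ ε' + d * δ := by
    intro j
    have hdδ : 0 ≤ d * δ := by positivity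
    by_cases hjT : j ∈ T
    · obtain ⟨a, -, rfl⟩ := Finset.mem_image.1 hjT
      rw [hwc]
      have := hclose a
      nlinarith
    by_cases hjQ : j ∈ Q
    · have hj : j ∈ Q \ T := Finset.mem_sdiff.2 ⟨hjQ, hjT⟩
      rw [hwQT j hj, sub_zero]
      have h1 := hrestT j hj
      have hk1 : (1 : ℝ) ≤ κ := by
        rw [hκ]
        exact_mod_cast Finset.card_pos.2 ⟨j, hjQ⟩
      have h2 : ε * Γ ≤ ε' := by
        rw [hε']; apply mul_le_mul_of_nonneg_left _ hε0; nlinarith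
      linarith
    by_cases hs : ∃ i, Z i j ≠ 0
    · rw [hwrare j hjQ hs]
      have h1 := hDrow (rep j) j hjQ (hrep j hs)
      have h2 : |D (rep j) (fun a => v (c a)) - D (rep j) u| ≤ d * δ := by
        have h0 : D (rep j) (fun a => v (c a)) - D (rep j) u =
            ∑ a, (Z (rep j) (c a) : ℝ) * (v (c a) - u a) := by
          rw [hD, hD, ← Finset.sum_sub_distrib]
          exact Finset.sum_congr rfl fun a _ => by ring
        rw [h0]
        refine (Finset.abs_sum_le_sum_abs _ _).trans ?_
        have h3 : ∀ a ∈ Finset.univ, |(Z (rep j) (c a) : ℝ) * (v (c a) - u a)| ≤ δ := fun a _ => by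
          rw [abs_mul]
          calc |((Z (rep j) (c a) : SignType) : ℝ)| * |v (c a) - u a| ≤ 1 * |v (c a) - u a| := by
                gcongr; exact abs_sign_le_one _
            _ ≤ δ := by rw [one_mul]; exact hclose a
        refine (Finset.sum_le_card_nsmul _ _ _ h3).trans ?_
        rw [nsmul_eq_mul, Finset.card_univ, Fintype.card_fin]
        gcongr
      have h4 : |(Z (rep j) j : ℝ) * (D (rep j) (fun a => v (c a)) - D (rep j) u)| ≤ d * δ := by
        rw [abs_mul]
        calc |((Z (rep j) j : SignType) : ℝ)| * |D (rep j) (fun a => v (c a)) - D (rep j) u|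
            ≤ 1 * |D (rep j) (fun a => v (c a)) - D (rep j) u| := by
              gcongr; exact abs_sign_le_one _
          _ ≤ _ := by rw [one_mul]; exact h2
      have h5 : v j - -((Z (rep j) j : ℝ) * D (rep j) u) =
          ((Z (rep j) j : ℝ) * D (rep j) (fun a => v (c a)) + v j) -
          (Z (rep j) j : ℝ) * (D (rep j) (fun a => v (c a)) - D (rep j) u) := by ring
      rw [h5]
      refine (abs_sub _ _).trans ?_
      linarith
    · rw [hwun j hjQ hs, sub_self, abs_zero]; positivity
  -- conclusion
  have hfin : 1 ≤ d * (ε' + d * δ) := by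
    have h1 : v ⬝ᵥ (v - w) = 1 := by
      rw [dotProduct_sub, hker w hXw, sub_zero, dotProduct, ← hv1]
      exact Finset.sum_congr rfl fun j _ => by ring
    rw [← h1, dotProduct]
    have h2 : ∀ j ∈ Finset.univ, v j * (v - w) j ≤ ε' + d * δ := fun j _ => by
      refine (le_abs_self _).trans ?_
      rw [abs_mul, Pi.sub_apply]
      calc |v j| * |v j - w j| ≤ 1 * |v j - w j| := by gcongr; exact hvle j
        _ ≤ _ := by rw [one_mul]; exact hdist j
    refine (Finset.sum_le_card_nsmul _ _ _ h2).trans_eq ?_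
    rw [nsmul_eq_mul, Finset.card_univ, Fintype.card_fin]
  have hfin2 : d * (ε' + d * δ) = d * (1 + κ * Γ) * (1 + 2 * d * (n * C ^ t)) * ε := by
    rw [hδ, hε', hΛ]; ring
  rw [hfin2] at hfin
  rw [← hε2, ← mul_pow]
  exact one_le_pow₀ hfin

end eigen

/-! ### Bias and variance of the minimum norm estimator -/

section estimator

open Matrix

variable {n d : ℕ}

/-- Moore-Penrose inverse of the Gram matrix of `X`. -/
def gramPinv (X : Matrix (Fin n) (Fin d) ℝ) : Matrix (Fin d) (Fin d) ℝ :=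
  symPinv (Xᵀ * X) (gram_isHermitian X)

/-- Projection to the row space of `X`, minus the identity, applied to `β`. -/
def biasVec (X : Matrix (Fin n) (Fin d) ℝ) (β : Fin d → ℝ) : Fin d → ℝ :=
  (gramPinv X * (Xᵀ * X)) *ᵥ β - β

/-- The linear response of the estimator to the noise. -/
def noiseVec (X : Matrix (Fin n) (Fin d) ℝ) (ξ : Fin n → ℝ) : Fin d → ℝ :=
  (gramPinv X * Xᵀ) *ᵥ ξ

theorem minNormEstimator_sub (X : Matrix (Fin n) (Fin d) ℝ) (β : Fin d → ℝ) (ξ : Fin n → ℝ) :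
    minNormEstimator X (X *ᵥ β + ξ) - β = biasVec X β + noiseVec X ξ := by
  simp only [minNormEstimator, biasVec, noiseVec, gramPinv, mulVec_add, mulVec_mulVec]
  abel

theorem mulVec_biasVec (X : Matrix (Fin n) (Fin d) ℝ) (β : Fin d → ℝ) : X *ᵥ biasVec X β = 0 := by
  rw [biasVec, mulVec_sub, mulVec_mulVec, gramPinv, mul_gram_symPinv_mul, sub_self]

/-- The bias is minus the part of β orthogonal to the row space. This crude bound serves on the bad
event. -/
theorem sum_sq_biasVec_le (X : Matrix (Fin n) (Fin d) ℝ) (β : Fin d → ℝ) :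
    ∑ j, (biasVec X β j) ^ 2 ≤ ∑ j, β j ^ 2 := by
  have h3 := symPinv_mul_self_transpose (gram_isHermitian X)
  have h4 := mulVec_biasVec X β
  set P := gramPinv X * (Xᵀ * X) with hP
  have h3 : Pᵀ = P := h3
  have h2 : P * P = P := by
    have := symPinv_mul_symPinv_cancel (gram_isHermitian X)
    rw [hP, ← Matrix.mul_assoc, gramPinv, this]
  have h5 : (P *ᵥ β) ⬝ᵥ (P *ᵥ β) = β ⬝ᵥ P *ᵥ β := by
    conv_lhs => rw [dotProduct_mulVec, ← mulVec_transpose, mulVec_mulVec, h3, h2]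
    exact dotProduct_comm _ _
  have h6 : ∑ j, (biasVec X β j) ^ 2 = ∑ j, β j ^ 2 - (P *ᵥ β) ⬝ᵥ (P *ᵥ β) := by
    have h7 : ∑ j, (biasVec X β j) ^ 2 = (P *ᵥ β) ⬝ᵥ (P *ᵥ β) - 2 * (β ⬝ᵥ P *ᵥ β) + ∑ j, β j ^ 2 := by
      simp only [dotProduct, Finset.mul_sum, ← Finset.sum_sub_distrib, ← Finset.sum_add_distrib]
      exact Finset.sum_congr rfl fun j _ => by simp only [biasVec, Pi.sub_apply, ← hP]; ring
    rw [h7, h5]; ring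
  have h8 : 0 ≤ (P *ᵥ β) ⬝ᵥ (P *ᵥ β) :=
    Finset.sum_nonneg fun j _ => mul_self_nonneg _
  linarith

/-- A feature that never occurs is orthogonal to the row space, so the minimum norm solution gives
it coefficient zero. -/
theorem biasVec_of_col_eq_zero (X : Matrix (Fin n) (Fin d) ℝ) (β : Fin d → ℝ) {j : Fin d}
    (hj : ∀ i, X i j = 0) : biasVec X β j = - β j := by
  have h3 := symPinv_mul_self_transpose (gram_isHermitian X)
  have h4 : ∀ l, (gramPinv X * (Xᵀ * X)) j l = 0 := fun l => by
    have h5 : (gramPinv X * (Xᵀ * X)) j l = (gramPinv X * (Xᵀ * X)) l j := by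
      conv_lhs => rw [gramPinv, ← h3]
      rfl
    rw [h5, Matrix.mul_apply]
    refine Finset.sum_eq_zero fun a _ => ?_
    rw [Matrix.mul_apply, Finset.sum_eq_zero fun i _ => by rw [hj i, mul_zero], mul_zero]
  simp [biasVec, mulVec, dotProduct, h4]

theorem gramPinv_cancel (X : Matrix (Fin n) (Fin d) ℝ) :
    gramPinv X * (Xᵀ * X) * gramPinv X = gramPinv X :=
  symPinv_mul_symPinv_cancel (gram_isHermitian X)

theorem gramPinv_transpose (X : Matrix (Fin n) (Fin d) ℝ) : (gramPinv X)ᵀ = gramPinv X :=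
  symPinv_transpose (gram_isHermitian X)

/-- From G XᵀX G = G. The left side is the variance of coordinate `j` of the response to unit noise.
-/
theorem sum_sq_gramPinv_mul (X : Matrix (Fin n) (Fin d) ℝ) (j : Fin d) :
    ∑ i, ((gramPinv X * Xᵀ) j i) ^ 2 = gramPinv X j j := by
  have h1 : (gramPinv X * Xᵀ) * (gramPinv X * Xᵀ)ᵀ = gramPinv X := by
    rw [transpose_mul, transpose_transpose, gramPinv_transpose]
    simpa only [Matrix.mul_assoc] using gramPinv_cancel X
  conv_rhs => rw [← h1]
  rw [Matrix.mul_apply]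
  exact Finset.sum_congr rfl fun i _ => by rw [transpose_apply, sq]

theorem gramPinv_diag_nonneg (X : Matrix (Fin n) (Fin d) ℝ) (j : Fin d) : 0 ≤ gramPinv X j j := by
  rw [← sum_sq_gramPinv_mul]; exact Finset.sum_nonneg fun i _ => sq_nonneg _

/-- The vector y = XGe_j satisfies ⟨z, y⟩ = ‖y‖² = G_jj for every admissible `z`, and ‖z - y‖² ≥ 0
gives the claim. Upper bounds for variances thus reduce to exhibiting one `z`. -/
theorem gramPinv_diag_le (X : Matrix (Fin n) (Fin d) ℝ) {j : Fin d} {z : Fin n → ℝ}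
    (hz : Xᵀ *ᵥ z = Pi.single j 1) : gramPinv X j j ≤ ∑ i, z i ^ 2 := by
  set y : Fin n → ℝ := (X * gramPinv X) *ᵥ Pi.single j 1 with hy
  have h1 : z ⬝ᵥ y = gramPinv X j j := by
    rw [hy, ← mulVec_mulVec, dotProduct_mulVec, ← mulVec_transpose, hz]
    simp
  have h2 : y ⬝ᵥ y = gramPinv X j j := by
    have h3 : y ⬝ᵥ y = (Pi.single j 1 : Fin d → ℝ) ⬝ᵥ
        (gramPinv X * (Xᵀ * X) * gramPinv X) *ᵥ Pi.single j 1 := by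
      conv_lhs => rw [hy, dotProduct_comm, dotProduct_mulVec, ← mulVec_transpose, mulVec_mulVec,
        transpose_mul, gramPinv_transpose, dotProduct_comm]
      simp only [Matrix.mul_assoc]
    rw [h3, gramPinv_cancel]
    simp
  have h4 : 0 ≤ ∑ i, (z i - y i) ^ 2 := Finset.sum_nonneg fun i _ => sq_nonneg _
  have h5 : ∑ i, (z i - y i) ^ 2 = ∑ i, z i ^ 2 - 2 * (z ⬝ᵥ y) + y ⬝ᵥ y := by
    simp only [dotProduct, Finset.mul_sum, ← Finset.sum_sub_distrib, ← Finset.sum_add_distrib]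
    exact Finset.sum_congr rfl fun j _ => by ring
  rw [h1, h2] at h5
  linarith

theorem gramPinv_diag_of_col_eq_zero (X : Matrix (Fin n) (Fin d) ℝ) {j : Fin d}
    (hj : ∀ i, X i j = 0) : gramPinv X j j = 0 := by
  have h1 : gramPinv X = gramPinv X * (gramPinv X * (Xᵀ * X)) := by
    conv_lhs => rw [← gramPinv_cancel X]
    rw [Matrix.mul_assoc]
    congr 1
    exact (symPinv_mul_comm (gram_isHermitian X)).symm
  rw [h1, ← Matrix.mul_assoc, Matrix.mul_apply]
  refine Finset.sum_eq_zero fun a _ => ?_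
  have h2 : (Xᵀ * X) a j = 0 := by
    rw [Matrix.mul_apply]
    exact Finset.sum_eq_zero fun i _ => by rw [hj i, mul_zero]
  rw [h2, mul_zero]

theorem sum_gramPinv_diag_le (X : Matrix (Fin n) (Fin d) ℝ) {D : ℝ} (hD : 0 ≤ D)
    (h : ∀ (v : Fin d → ℝ) (lam : ℝ), lam ≠ 0 → ∑ j, v j ^ 2 = 1 →
      (Xᵀ * X) *ᵥ v = lam • v → 1 ≤ D * lam) :
    ∑ j, gramPinv X j j ≤ d * D := by
  have h1 : ∑ j, gramPinv X j j = ∑ i, ((gram_isHermitian X).eigenvalues i)⁻¹ :=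
    symPinv_trace (gram_isHermitian X)
  rw [h1]
  have h2 : ∀ i ∈ Finset.univ, ((gram_isHermitian X).eigenvalues i)⁻¹ ≤ D := by
    intro i _
    by_cases h0 : (gram_isHermitian X).eigenvalues i = 0
    · simpa [h0] using hD
    · have hnorm : ∑ j, ((gram_isHermitian X).eigenvectorBasis i).ofLp j ^ 2 = 1 := by
        have := (gram_isHermitian X).eigenvectorBasis.orthonormal.1 i
        rw [← EuclideanSpace.real_norm_sq_eq, this, one_pow]
      have h3 := h _ _ h0 hnorm ((gram_isHermitian X).mulVec_eigenvectorBasis i)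
      rcases lt_or_gt_of_ne h0 with hneg | hpos
      · nlinarith
      · rwa [inv_le_iff_one_le_mul₀ hpos]
  simpa using Finset.sum_le_card_nsmul _ _ _ h2

/-- Gram matrix of the common columns in the rows `R`. -/
def gramOn (R : Finset (Fin n)) (Q : Finset (Fin d)) (Z : Fin n → Fin d → SignType) :
    Matrix Q Q ℝ :=
  Matrix.of fun l l' => ∑ i ∈ R, (Z i l : ℝ) * (Z i l' : ℝ)

theorem dotProduct_gramOn (R : Finset (Fin n)) (Q : Finset (Fin d)) (Z : Fin n → Fin d → SignType)
    (w : Q → ℝ) : w ⬝ᵥ gramOn R Q Z *ᵥ w = ∑ i ∈ R, (∑ l : Q, (Z i l : ℝ) * w l) ^ 2 := by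
  simp only [dotProduct, mulVec, gramOn, Matrix.of_apply, Finset.sum_mul, Finset.mul_sum]
  simp_rw [sq, Finset.sum_mul_sum]
  rw [show (∑ l : Q, ∑ l' : Q, ∑ i ∈ R, w l * ((Z i l : ℝ) * (Z i l' : ℝ) * w l')) =
    ∑ l : Q, ∑ i ∈ R, ∑ l' : Q, w l * ((Z i l : ℝ) * (Z i l' : ℝ) * w l') from
    Finset.sum_congr rfl fun l _ => Finset.sum_comm, Finset.sum_comm]
  exact Finset.sum_congr rfl fun i _ => Finset.sum_congr rfl fun l _ =>
    Finset.sum_congr rfl fun l' _ => by ring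

variable {p : Fin d → ℝ} {R : Finset (Fin n)} {Q : Finset (Fin d)} {Z : Fin n → Fin d → SignType}

/-- Away from near dependence wᵀGw ≥ (n p_j / 16) w_j² for all `w`. A kernel vector contradicts
this, and w = G⁻¹e_j turns it into g ≥ (n p_j / 16) g² for g = (G⁻¹)_jj. -/
theorem gramOn_inv (hp : ∀ j, 0 < p j) (hn : 0 < n) (h : Z ∉ nearDependent p R Q) :
    IsUnit (gramOn R Q Z).det ∧ ∀ j, (gramOn R Q Z)⁻¹ j j ≤ 16 / (n * p j) := by
  classical
  have hfar : ∀ (w : Q → ℝ) (j : Q), w j ≠ 0 →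
      n * p j / 16 * w j ^ 2 ≤ ∑ i ∈ R, (∑ l : Q, (Z i l : ℝ) * w l) ^ 2 := by
    intro w j hj
    by_contra hcon
    rw [not_le] at hcon
    refine h ⟨j, j.2, fun l => if hl : l ∈ Q then w ⟨l, hl⟩ / w j else 0, ?_, ?_⟩
    · simp [hj]
    · have h1 : ∀ i, ∑ l ∈ Q, (Z i l : ℝ) * (if hl : l ∈ Q then w ⟨l, hl⟩ / w j else 0) =
          (∑ l : Q, (Z i l : ℝ) * w l) / w j := fun i => by
        rw [← Finset.sum_coe_sort Q, Finset.sum_div]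
        exact Finset.sum_congr rfl fun l _ => by simp; ring
      simp only [h1, div_pow, ← Finset.sum_div]
      rw [div_lt_iff₀ (by positivity), Fintype.card_fin]
      exact hcon
  have hn' : (0 : ℝ) < n := by exact_mod_cast hn
  have hunit : IsUnit (gramOn R Q Z).det := by
    rw [isUnit_iff_ne_zero]
    intro h0
    obtain ⟨w, hw0, hw⟩ := Matrix.exists_mulVec_eq_zero_iff.2 h0
    obtain ⟨j, hj⟩ := Function.ne_iff.1 hw0
    have h1 := hfar w j hj
    rw [← dotProduct_gramOn, hw, dotProduct_zero] at h1
    have : 0 < n * p j / 16 * w j ^ 2 := by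
      have := hp j
      have hj' : 0 < w j ^ 2 := sq_pos_of_ne_zero (by exact hj)
      positivity
    linarith
  refine ⟨hunit, fun j => ?_⟩
  set A := gramOn R Q Z
  set g := A⁻¹ j j with hg
  have hpj := hp j
  rcases le_or_gt g 0 with h0 | h0
  · exact h0.trans (by positivity)
  · have h1 := hfar (A⁻¹ *ᵥ Pi.single j 1) j (by simpa using h0.ne')
    rw [← dotProduct_gramOn, mulVec_mulVec, Matrix.mul_nonsing_inv _ hunit, one_mulVec] at h1
    simp only [mulVec_single_one, col_apply, dotProduct_single_one, ← hg] at h1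
    rw [le_div_iff₀ (by positivity)]
    have h2 : n * p j / 16 * g ≤ 1 := by
      by_contra hcon
      nlinarith
    linarith

/-- Coefficient vectors in the rows `R` that produce the common part `c`. -/
def dualVec (R : Finset (Fin n)) (Q : Finset (Fin d)) (Z : Fin n → Fin d → SignType) (c : Q → ℝ) :
    Fin n → ℝ :=
  fun i => if i ∈ R then ∑ l : Q, (Z i l : ℝ) * ((gramOn R Q Z)⁻¹ *ᵥ c) l else 0

/-- Rows in `R` have no rare entries, so a combination of them produces any prescribed common part
without side effects on the rare columns. -/
theorem transpose_mulVec_dualVec (hunit : IsUnit (gramOn R Q Z).det)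
    (hR : ∀ i ∈ R, ∀ j, j ∉ Q → Z i j = 0) (c : Q → ℝ) (j : Fin d) :
    ((designMatrix Z)ᵀ *ᵥ dualVec R Q Z c) j = if h : j ∈ Q then c ⟨j, h⟩ else 0 := by
  have h1 : ((designMatrix Z)ᵀ *ᵥ dualVec R Q Z c) j =
      ∑ i ∈ R, (Z i j : ℝ) * ∑ l : Q, (Z i l : ℝ) * ((gramOn R Q Z)⁻¹ *ᵥ c) l := by
    simp only [mulVec, dotProduct, designMatrix, transpose_apply, Matrix.of_apply, dualVec, mul_ite,
      mul_zero, Finset.sum_ite_mem, Finset.univ_inter]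
  rw [h1]
  split_ifs with hj
  · have h2 : (gramOn R Q Z *ᵥ ((gramOn R Q Z)⁻¹ *ᵥ c)) ⟨j, hj⟩ = c ⟨j, hj⟩ := by
      rw [mulVec_mulVec, Matrix.mul_nonsing_inv _ hunit, one_mulVec]
    rw [← h2]
    generalize (gramOn R Q Z)⁻¹ *ᵥ c = w
    simp only [mulVec, dotProduct, gramOn, Matrix.of_apply, Finset.sum_mul, Finset.mul_sum]
    rw [Finset.sum_comm]
    exact Finset.sum_congr rfl fun l _ => Finset.sum_congr rfl fun i _ => by ring
  · exact Finset.sum_eq_zero fun i hi => by simp [hR i hi j hj]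

theorem sum_sq_dualVec (hunit : IsUnit (gramOn R Q Z).det) (c : Q → ℝ) :
    ∑ i, dualVec R Q Z c i ^ 2 = c ⬝ᵥ (gramOn R Q Z)⁻¹ *ᵥ c := by
  have h1 : ∑ i, dualVec R Q Z c i ^ 2 =
      ∑ i ∈ R, (∑ l : Q, (Z i l : ℝ) * ((gramOn R Q Z)⁻¹ *ᵥ c) l) ^ 2 := by
    simp only [dualVec, ite_pow, ne_eq, OfNat.ofNat_ne_zero, not_false_eq_true, zero_pow,
      Finset.sum_ite_mem, Finset.univ_inter]
  rw [h1, ← dotProduct_gramOn, mulVec_mulVec, Matrix.mul_nonsing_inv _ hunit, one_mulVec,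
    dotProduct_comm]

theorem gramPinv_diag_common_le (hunit : IsUnit (gramOn R Q Z).det)
    (hR : ∀ i ∈ R, ∀ j, j ∉ Q → Z i j = 0) (j : Q) :
    gramPinv (designMatrix Z) j j ≤ (gramOn R Q Z)⁻¹ j j := by
  refine (gramPinv_diag_le (designMatrix Z) (z := dualVec R Q Z (Pi.single j 1)) ?_).trans_eq ?_
  · ext l
    rw [transpose_mulVec_dualVec hunit hR]
    split_ifs with hl
    · simp only [Pi.single_apply, Subtype.ext_iff]
    · rw [Pi.single_eq_of_ne]
      rintro rfl
      exact hl j.2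
  · rw [sum_sq_dualVec hunit]
    simp

/-- Take the impure row `i`, cancel its common part by pure rows, and correct the sign; no other
rare column occurs in row `i`. The two pieces have disjoint supports, so their squared norms add: 1
for row `i`, and its leverage for the correction. -/
theorem gramPinv_diag_rare_le (hZ : RareSparse Q Z) (hunit : IsUnit (gramOn R Q Z).det)
    (hR : ∀ i ∈ R, ∀ j, j ∉ Q → Z i j = 0) {j : Fin d} (hj : j ∉ Q) {i : Fin n} (hi : i ∉ R)
    (hij : Z i j ≠ 0) :
    gramPinv (designMatrix Z) j j ≤ 1 + (fun l : Q => (Z i l : ℝ)) ⬝ᵥ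
      (gramOn R Q Z)⁻¹ *ᵥ (fun l : Q => (Z i l : ℝ)) := by
  classical
  set c : Q → ℝ := fun l => (Z i l : ℝ) with hc
  refine (gramPinv_diag_le (designMatrix Z)
    (z := (Z i j : ℝ) • (Pi.single i 1 - dualVec R Q Z c)) ?_).trans_eq ?_
  · ext l
    rw [mulVec_smul, mulVec_sub, Pi.smul_apply, Pi.sub_apply, transpose_mulVec_dualVec hunit hR]
    have h1 : ((designMatrix Z)ᵀ *ᵥ Pi.single i 1) l = (Z i l : ℝ) := by
      simp [designMatrix]
    rw [h1]
    split_ifs with hl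
    · rw [Pi.single_eq_of_ne (ne_of_mem_of_not_mem hl hj)]
      simp [hc]
    · by_cases hlj : l = j
      · subst hlj
        simp [sign_sq_eq_one hij]
      · rw [Pi.single_eq_of_ne hlj]
        have : Z i l = 0 := by
          by_contra h
          exact hlj (hZ i l j hl hj h hij)
        simp [this]
  · have h2 : ∀ a, ((Z i j : ℝ) • ((Pi.single i 1 : Fin n → ℝ) - dualVec R Q Z c)) a ^ 2 =
        (Pi.single i 1 : Fin n → ℝ) a + dualVec R Q Z c a ^ 2 := by
      intro a
      rw [Pi.smul_apply, smul_eq_mul, mul_pow, sq, sign_sq_eq_one hij, one_mul, Pi.sub_apply]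
      by_cases ha : a = i
      · subst ha
        have : dualVec R Q Z c a = 0 := by simp [dualVec, hi]
        simp [this]
      · rw [Pi.single_eq_of_ne ha]; ring
    rw [Finset.sum_congr rfl fun a _ => h2 a, Finset.sum_add_distrib, sum_sq_dualVec hunit]
    simp

/-- The bias on the good event. -/
theorem bias_le_of_good {β : Fin d → ℝ} {B : ℝ} (hp : ∀ j, 0 < p j) (hn : 0 < n)
    (hβ : ∀ j, |β j| ≤ B) (hZ : RareSparse Q Z) (h : Z ∉ nearDependent p (pureRows Q Z) Q) :
    ∑ j, p j * biasVec (designMatrix Z) β j ^ 2 ≤ B ^ 2 * ∑ j ∈ Qᶜ, p j := by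
  classical
  set r := biasVec (designMatrix Z) β with hr
  have hXr : ∀ i, ∑ j, (Z i j : ℝ) * r j = 0 := fun i => congrFun (mulVec_biasVec (designMatrix Z) β) i
  -- The bias lies in the kernel of X, so a nonzero common coordinate, scaled to 1, would be an
  -- exact linear dependence on the pure rows.
  have hcommon : ∀ j ∈ Q, r j = 0 := by
    intro j hj
    by_contra h0
    refine h ⟨j, hj, fun l => r l / r j, div_self h0, ?_⟩
    have h1 : ∀ i ∈ pureRows Q Z, (∑ l ∈ Q, (Z i l : ℝ) * (r l / r j)) ^ 2 = 0 := by
      intro i hi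
      have h2 := hXr i
      rw [← Finset.sum_add_sum_compl Q, Finset.sum_eq_zero (s := Qᶜ) fun l hl => by
        rw [(Finset.mem_filter.1 hi).2 l (Finset.mem_compl.1 hl)]; simp, add_zero] at h2
      have h3 : ∑ l ∈ Q, (Z i l : ℝ) * (r l / r j) = (∑ l ∈ Q, (Z i l : ℝ) * r l) / r j := by
        rw [Finset.sum_div]; exact Finset.sum_congr rfl fun l _ => by ring
      rw [h3, h2]; simp
    rw [Finset.sum_eq_zero h1, Fintype.card_fin]
    have := hp j
    positivity
  -- If the feature occurs, its row contains no other rare entry and the common coordinates vanish,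
  -- so this coordinate vanishes too. Only unseen features keep their full coefficient.
  have hrare : ∀ j, j ∉ Q → r j ^ 2 ≤ B ^ 2 := by
    intro j hj
    by_cases hs : ∃ i, Z i j ≠ 0
    · obtain ⟨i, hi⟩ := hs
      have h2 := hXr i
      rw [Finset.sum_eq_single_of_mem j (Finset.mem_univ _)] at h2
      · have h3 : (Z i j : ℝ) ≠ 0 := fun h0 => by
          have := sign_sq_eq_one hi; rw [h0] at this; simp at this
        rw [(mul_eq_zero.1 h2).resolve_left h3, zero_pow two_ne_zero]
        exact sq_nonneg B
      · intro l _ hl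
        by_cases hlQ : l ∈ Q
        · rw [hcommon l hlQ, mul_zero]
        · have : Z i l = 0 := by
            by_contra h0
            exact hl (hZ i l j hlQ hj h0 hi)
          simp [this]
    · push Not at hs
      rw [hr, biasVec_of_col_eq_zero _ _ fun i => by simp [designMatrix, hs i], neg_sq, ← sq_abs]
      exact pow_le_pow_left₀ (abs_nonneg _) (hβ j) 2
  rw [← Finset.sum_add_sum_compl Q, Finset.sum_eq_zero fun j hj => by rw [hcommon j hj]; ring,
    zero_add, Finset.mul_sum]
  refine Finset.sum_le_sum fun j hj => ?_
  rw [mul_comm]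
  exact mul_le_mul_of_nonneg_right (hrare j (Finset.mem_compl.1 hj)) (hp j).le

end estimator

/-! ### The laws of the statement in terms of finite sums -/

/-- Finite support turns the law of the design into a weighted sum, so that all estimates on designs
can be made with `avg` and `prob`. -/
theorem pi_sum_dirac {I α E : Type*} [Fintype I] [DecidableEq I] [Fintype α] [MeasurableSpace E]
    {w : I → α → ℝ} (hw : ∀ i a, 0 ≤ w i a) (f : α → E) (μ : I → Measure E)
    [∀ i, SigmaFinite (μ i)] (hμ : ∀ i, μ i = ∑ a, ENNReal.ofReal (w i a) • Measure.dirac (f a)) :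
    Measure.pi μ = ∑ Z : I → α, ENNReal.ofReal (∏ i, w i (Z i)) • Measure.dirac (fun i => f (Z i)) := by
  classical
  refine Measure.pi_eq fun s hs => ?_
  have h1 : ∀ i, μ i (s i) = ∑ a, ENNReal.ofReal (w i a) * (s i).indicator 1 (f a) := fun i => by
    rw [hμ, Measure.finsetSum_apply]
    exact Finset.sum_congr rfl fun a _ => by
      rw [Measure.smul_apply, Measure.dirac_apply' _ (hs i), smul_eq_mul]
  rw [Measure.finsetSum_apply, Finset.prod_congr rfl fun i _ => h1 i, Finset.prod_univ_sum,
    Fintype.piFinset_univ]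
  refine Finset.sum_congr rfl fun Z _ => ?_
  rw [Measure.smul_apply, Measure.dirac_apply' _ (MeasurableSet.univ_pi hs), smul_eq_mul,
    Finset.prod_mul_distrib, ENNReal.ofReal_prod_of_nonneg fun i _ => hw i _]
  congr 1
  by_cases h : ∀ i, f (Z i) ∈ s i
  · rw [Set.indicator_of_mem (by simpa using h)]
    exact (Finset.prod_eq_one fun i _ => by simp [h i]).symm
  · rw [Set.indicator_of_notMem (by simpa using h)]
    push Not at h
    obtain ⟨i, hi⟩ := h
    exact (Finset.prod_eq_zero (Finset.mem_univ i) (by simp [hi])).symm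

theorem featureLaw_eq_sum (q : ℝ) :
    featureLaw q = ∑ x : SignType, ENNReal.ofReal (entryWeight q x) • Measure.dirac ((x : SignType) : ℝ) := by
  rw [show (Finset.univ : Finset SignType) = {0, 1, -1} by decide,
    Finset.sum_insert (by decide), Finset.sum_insert (by decide), Finset.sum_singleton]
  simp [featureLaw, entryWeight, add_assoc]

section laws

variable {n d : ℕ} {p : Fin d → ℝ}

theorem sampleLaw_eq_sum (hp : ∀ j, 0 ≤ p j ∧ p j ≤ 1) :
    sampleLaw p = ∑ x : Fin d → SignType, ENNReal.ofReal (rowWeight p x) •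
      Measure.dirac (fun j => ((x j : SignType) : ℝ)) :=
  pi_sum_dirac (isWeight_entry hp).nonneg (fun x : SignType => (x : ℝ)) (fun j => featureLaw (p j))
    fun j => featureLaw_eq_sum (p j)

theorem designLaw_eq_sum (hp : ∀ j, 0 ≤ p j ∧ p j ≤ 1) :
    designLaw n p = ∑ Z : Fin n → Fin d → SignType,
      ENNReal.ofReal (∏ i, designWeight (Fin n) p i (Z i)) •
        Measure.dirac (fun i j => ((Z i j : SignType) : ℝ)) :=
  pi_sum_dirac (w := designWeight (Fin n) p) (isWeight_design (Fin n) hp).nonneg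
    (fun (x : Fin d → SignType) j => ((x j : SignType) : ℝ)) (fun _ => sampleLaw p)
    fun _ => sampleLaw_eq_sum hp

theorem integral_finsetSum_dirac {Ω K : Type*} [MeasurableSpace Ω] [MeasurableSingletonClass Ω] [Fintype K]
    {w : K → ℝ} (hw : ∀ a, 0 ≤ w a) (x : K → Ω) (f : Ω → ℝ) :
    ∫ y, f y ∂(∑ a, ENNReal.ofReal (w a) • Measure.dirac (x a)) = ∑ a, w a * f (x a) := by
  rw [integral_finsetSum_measure fun a _ =>
    (integrable_dirac (by simp)).smul_measure ENNReal.ofReal_ne_top]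
  exact Finset.sum_congr rfl fun a _ => by
    rw [integral_smul_measure, integral_dirac, ENNReal.toReal_ofReal (hw a), smul_eq_mul]

theorem integral_designLaw (hp : ∀ j, 0 ≤ p j ∧ p j ≤ 1) (f : (Fin n → Fin d → ℝ) → ℝ) :
    ∫ X, f X ∂(designLaw n p) =
      avg (designWeight (Fin n) p) fun Z => f fun i j => ((Z i j : SignType) : ℝ) := by
  rw [designLaw_eq_sum hp, integral_finsetSum_dirac (isWeight_design (Fin n) hp).prod_nonneg]
  rfl

/-- Second moments of one row. -/
theorem avg_row_quadratic {J : Type*} [Fintype J] [DecidableEq J] {p : J → ℝ}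
    (hp : ∀ j, 0 ≤ p j ∧ p j ≤ 1) (l l' : J) :
    avg (fun j => entryWeight (p j)) (fun x => ((x l : SignType) : ℝ) * ((x l' : SignType) : ℝ)) =
      if l = l' then p l else 0 := by
  have hw := isWeight_entry hp
  split_ifs with h
  · subst h
    have h1 := avg_prod_subset hw {l} (fun _ x => (x : ℝ) * (x : ℝ))
    simp only [Finset.prod_singleton, sum_entryWeight_mul] at h1
    rw [h1]; simp; ring
  · have h1 := avg_prod_subset hw {l, l'} (fun _ x => (x : ℝ))
    simp only [Finset.prod_pair h, sum_entryWeight_mul] at h1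
    rw [h1]; simp

/-- The coordinates of a sample are uncorrelated with second moments p_j, so the cross terms vanish.
-/
theorem testLoss_eq (hp : ∀ j, 0 ≤ p j ∧ p j ≤ 1) (β β' : Fin d → ℝ) :
    testLoss p β β' = ∑ j, p j * (β j - β' j) ^ 2 := by
  have h1 : testLoss p β β' = avg (fun j => entryWeight (p j)) fun x =>
      ∑ l, ∑ l', ((β l - β' l) * (β l' - β' l')) * (((x l : SignType) : ℝ) * ((x l' : SignType) : ℝ)) := by
    have h2 := integral_finsetSum_dirac (isWeight_entry hp).prod_nonneg
      (fun (x : Fin d → SignType) j => ((x j : SignType) : ℝ)) fun x => (β ⬝ᵥ x - β' ⬝ᵥ x) ^ 2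
    rw [testLoss, sampleLaw_eq_sum hp]
    refine h2.trans ?_
    refine Finset.sum_congr rfl fun x _ => ?_
    congr 1
    rw [← sub_dotProduct, sq, dotProduct, Finset.sum_mul_sum]
    exact Finset.sum_congr rfl fun l _ => Finset.sum_congr rfl fun l' _ => by
      simp only [Pi.sub_apply]; ring
  rw [h1, avg_sum]
  refine Finset.sum_congr rfl fun l _ => ?_
  rw [avg_sum, Finset.sum_congr rfl fun l' _ => avg_const_mul _ _ _]
  simp only [avg_row_quadratic hp, mul_ite, mul_zero, Finset.sum_ite_eq, Finset.mem_univ, if_true]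
  ring

theorem trainedLoss_le (hp : ∀ j, 0 ≤ p j ∧ p j ≤ 1) (β : Fin d → ℝ) (X : Fin n → Fin d → ℝ)
    (ξ : Fin n → ℝ) :
    trainedLoss p β X ξ ≤ 2 * ∑ j, p j * biasVec (Matrix.of X) β j ^ 2 +
      2 * ∑ j, p j * noiseVec (Matrix.of X) ξ j ^ 2 := by
  rw [trainedLoss, testLoss_eq hp, Finset.mul_sum, Finset.mul_sum, ← Finset.sum_add_distrib]
  refine Finset.sum_le_sum fun j _ => ?_
  have h1 := congrFun (minNormEstimator_sub (Matrix.of X) β ξ) j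
  rw [Pi.sub_apply, Pi.add_apply] at h1
  rw [h1]
  nlinarith [mul_nonneg (hp j).1 (sq_nonneg (biasVec (Matrix.of X) β j - noiseVec (Matrix.of X) ξ j))]

theorem commonAveragedLoss_le (hp : ∀ j, 0 ≤ p j ∧ p j ≤ 1) (k : ℕ) (β : Fin d → ℝ)
    (Z : Fin n → Fin d → SignType) (ξ : Fin n → ℝ) :
    commonAveragedLoss k p β (fun i j => ((Z i j : SignType) : ℝ), ξ) ≤
      2 * avg (designWeight (Fin n) p) (fun Z' => ∑ j, p j *
        biasVec (designMatrix (splice (fun _ (j : Fin d) => (j : ℕ) < k) Z' Z)) β j ^ 2) +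
      2 * avg (designWeight (Fin n) p) (fun Z' => ∑ j, p j *
        noiseVec (designMatrix (splice (fun _ (j : Fin d) => (j : ℕ) < k) Z' Z)) ξ j ^ 2) := by
  rw [commonAveragedLoss, integral_designLaw hp, ← avg_const_mul, ← avg_const_mul, ← avg_add]
  refine avg_mono (isWeight_design (Fin n) hp) fun Z' => ?_
  refine (trainedLoss_le hp _ _ _).trans_eq ?_
  have h : (Matrix.of (replaceCommon k (fun i j => ((Z' i j : SignType) : ℝ))
      (fun i j => ((Z i j : SignType) : ℝ))) : Matrix (Fin n) (Fin d) ℝ) =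
      designMatrix (splice (fun _ (j : Fin d) => (j : ℕ) < k) Z' Z) := by
    ext i j
    simp only [replaceCommon, designMatrix, splice, Matrix.of_apply]
    split_ifs <;> rfl
  rw [h]

/-! ### Gaussian noise -/

instance noiseLaw.instIsProbabilityMeasure (n : ℕ) (σ : ℝ) : IsProbabilityMeasure (noiseLaw n σ) := by
  unfold noiseLaw; infer_instance

theorem noiseLaw_linear_sq (n : ℕ) (σ : ℝ) (c : Fin n → ℝ) :
    Integrable (fun ξ => (∑ i, c i * ξ i) ^ 2) (noiseLaw n σ) ∧
      ∫ ξ, (∑ i, c i * ξ i) ^ 2 ∂(noiseLaw n σ) = σ ^ 2 * ∑ i, c i ^ 2 := by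
  set v : NNReal := Real.toNNReal (σ ^ 2) with hv
  have hmem : ∀ i, MemLp (fun x : ℝ => c i * x) 2 (gaussianReal 0 v) := fun i =>
    (memLp_id_gaussianReal 2).const_mul (c i)
  have hmem' : ∀ i, MemLp (fun ξ : Fin n → ℝ => c i * ξ i) 2 (noiseLaw n σ) := fun i =>
    (hmem i).comp_measurePreserving (measurePreserving_eval (fun _ : Fin n => gaussianReal 0 v) i)
  have hsum : MemLp (fun ξ : Fin n → ℝ => ∑ i, c i * ξ i) 2 (noiseLaw n σ) :=
    memLp_finsetSum _ fun i _ => hmem' i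
  refine ⟨hsum.integrable_sq, ?_⟩
  have hmean : ∫ ξ, (∑ i, c i * ξ i) ∂(noiseLaw n σ) = 0 := by
    rw [integral_finsetSum _ fun i _ => (hmem' i).integrable one_le_two]
    refine Finset.sum_eq_zero fun i _ => ?_
    rw [integral_const_mul]
    have h1 : ∫ ξ : Fin n → ℝ, ξ i ∂(noiseLaw n σ) = ∫ x, x ∂(gaussianReal 0 v) := by
      rw [← (measurePreserving_eval (fun _ : Fin n => gaussianReal 0 v) i).map_eq,
        integral_map (measurable_pi_apply i).aemeasurable (by fun_prop)]
      rfl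
    rw [h1, integral_id_gaussianReal, mul_zero]
  have hvar := variance_sum_pi (μ := fun _ : Fin n => gaussianReal 0 v)
    (X := fun i x => c i * x) hmem
  have hvar' : Var[fun ξ : Fin n → ℝ => ∑ i, c i * ξ i; noiseLaw n σ] = ∑ i, c i ^ 2 * v := by
    have h2 : (fun ξ : Fin n → ℝ => ∑ i, c i * ξ i) = ∑ i, fun ξ : Fin n → ℝ => c i * ξ i := by
      ext ξ; simp
    rw [h2]
    refine hvar.trans (Finset.sum_congr rfl fun i _ => ?_)
    rw [variance_const_mul, variance_fun_id_gaussianReal]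
  rw [variance_of_integral_eq_zero hsum.aestronglyMeasurable.aemeasurable hmean] at hvar'
  rw [hvar', ← Finset.sum_mul, hv, Real.coe_toNNReal _ (sq_nonneg σ), mul_comm]

theorem integral_noiseVec_sq (σ : ℝ) (X : Matrix (Fin n) (Fin d) ℝ) (j : Fin d) :
    Integrable (fun ξ => noiseVec X ξ j ^ 2) (noiseLaw n σ) ∧
      ∫ ξ, noiseVec X ξ j ^ 2 ∂(noiseLaw n σ) = σ ^ 2 * gramPinv X j j := by
  rw [← sum_sq_gramPinv_mul]
  exact noiseLaw_linear_sq n σ fun i => (gramPinv X * X.transpose) j i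

/-- Markov bound for the averaged noise part. -/
theorem noiseLaw_markov (hp : ∀ j, 0 ≤ p j ∧ p j ≤ 1) (σ : ℝ)
    (X : (Fin n → Fin d → SignType) → Matrix (Fin n) (Fin d) ℝ) {W τ : ℝ} (hτ : 0 < τ)
    (hW : avg (designWeight (Fin n) p) (fun Z' => ∑ j, p j * gramPinv (X Z') j j) ≤ W)
    (hWτ : 200 * (σ ^ 2 * W) ≤ τ) :
    ENNReal.ofReal (199 / 200) ≤ noiseLaw n σ
      {ξ | avg (designWeight (Fin n) p) (fun Z' => ∑ j, p j * noiseVec (X Z') ξ j ^ 2) ≤ τ} := by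
  set g : (Fin n → ℝ) → ℝ := fun ξ =>
    avg (designWeight (Fin n) p) (fun Z' => ∑ j, p j * noiseVec (X Z') ξ j ^ 2) with hg
  have hw := isWeight_design (Fin n) hp
  have hg0 : ∀ ξ, 0 ≤ g ξ := fun ξ => avg_nonneg hw fun Z' =>
    Finset.sum_nonneg fun j _ => mul_nonneg (hp j).1 (sq_nonneg _)
  have hint : ∀ Z', Integrable (fun ξ => ∑ j, p j * noiseVec (X Z') ξ j ^ 2) (noiseLaw n σ) :=
    fun Z' => integrable_finsetSum _ fun j _ => (integral_noiseVec_sq σ (X Z') j).1.const_mul _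
  have hgint : Integrable g (noiseLaw n σ) := by
    have h := integrable_finsetSum (μ := noiseLaw n σ)
      (Finset.univ : Finset (Fin n → Fin d → SignType)) fun Z' _ =>
        (hint Z').const_mul (∏ i, designWeight (Fin n) p i (Z' i))
    exact h
  have hgval : ∫ ξ, g ξ ∂(noiseLaw n σ) =
      σ ^ 2 * avg (designWeight (Fin n) p) (fun Z' => ∑ j, p j * gramPinv (X Z') j j) := by
    rw [← avg_const_mul]
    simp only [hg, avg]
    rw [integral_finsetSum _ fun Z' _ => (hint Z').const_mul _]
    refine Finset.sum_congr rfl fun Z' _ => ?_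
    rw [integral_const_mul, integral_finsetSum _ fun j _ =>
      (integral_noiseVec_sq σ (X Z') j).1.const_mul _]
    congr 1
    rw [Finset.mul_sum]
    refine Finset.sum_congr rfl fun j _ => ?_
    rw [integral_const_mul, (integral_noiseVec_sq σ (X Z') j).2]; ring
  have hmarkov := mul_meas_ge_le_integral_of_nonneg (ae_of_all _ hg0) hgint τ
  rw [hgval] at hmarkov
  have h1 : (noiseLaw n σ).real {ξ | τ ≤ g ξ} ≤ 1 / 200 := by
    have h2 : σ ^ 2 * avg (designWeight (Fin n) p) (fun Z' => ∑ j, p j * gramPinv (X Z') j j) ≤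
        σ ^ 2 * W := mul_le_mul_of_nonneg_left hW (sq_nonneg σ)
    by_contra hcon
    have h3 : τ * (1 / 200) < τ * (noiseLaw n σ).real {ξ | τ ≤ g ξ} := by
      apply mul_lt_mul_of_pos_left _ hτ
      linarith
    linarith
  have h2 : (1 : ENNReal) ≤ noiseLaw n σ {ξ | g ξ ≤ τ} + noiseLaw n σ {ξ | τ ≤ g ξ} := by
    rw [← measure_univ (μ := noiseLaw n σ)]
    refine (measure_mono ?_).trans (measure_union_le _ _)
    intro ξ _
    exact le_total (g ξ) τ
  have h3 : noiseLaw n σ {ξ | τ ≤ g ξ} ≤ ENNReal.ofReal (1 / 200) := by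
    rw [← ENNReal.ofReal_toReal (measure_ne_top (noiseLaw n σ) {ξ | τ ≤ g ξ})]
    exact ENNReal.ofReal_le_ofReal h1
  have h4 : ENNReal.ofReal (199 / 200) + ENNReal.ofReal (1 / 200) = 1 := by
    rw [← ENNReal.ofReal_add (by norm_num) (by norm_num)]; norm_num
  have h5 : ENNReal.ofReal (199 / 200) + ENNReal.ofReal (1 / 200) ≤
      noiseLaw n σ {ξ | g ξ ≤ τ} + ENNReal.ofReal (1 / 200) := by
    rw [h4]; exact h2.trans (by gcongr)
  exact (ENNReal.add_le_add_iff_right ENNReal.ofReal_ne_top).1 h5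

/-- Holds for arbitrary sets: the design takes finitely many values, and each slice inclusion is a
measurable embedding. -/
theorem dataLaw_apply (hp : ∀ j, 0 ≤ p j ∧ p j ≤ 1) (σ : ℝ)
    (S : Set ((Fin n → Fin d → ℝ) × (Fin n → ℝ))) :
    dataLaw n p σ S = ∑ Z : Fin n → Fin d → SignType,
      ENNReal.ofReal (∏ i, designWeight (Fin n) p i (Z i)) *
        noiseLaw n σ {ξ | ((fun i j => ((Z i j : SignType) : ℝ)), ξ) ∈ S} := by
  have h : dataLaw n p σ = ∑ Z : Fin n → Fin d → SignType,
      ENNReal.ofReal (∏ i, designWeight (Fin n) p i (Z i)) •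
        (noiseLaw n σ).map (Prod.mk fun i j => ((Z i j : SignType) : ℝ)) := by
    have : IsFiniteMeasure (designLaw n p) := by
      unfold designLaw sampleLaw
      have : ∀ j, IsFiniteMeasure (featureLaw (p j)) := fun j => ⟨by simp [featureLaw]⟩
      infer_instance
    refine Measure.prod_eq fun s t hs ht => ?_
    rw [designLaw_eq_sum hp, Measure.finsetSum_apply, Measure.finsetSum_apply, Finset.sum_mul]
    refine Finset.sum_congr rfl fun Z _ => ?_
    rw [Measure.smul_apply, Measure.smul_apply, Measure.dirac_apply' _ hs,
      Measure.map_apply measurable_prodMk_left (hs.prod ht), smul_eq_mul, smul_eq_mul, mul_assoc]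
    congr 1
    by_cases hZ : (fun i j => ((Z i j : SignType) : ℝ)) ∈ s
    · rw [Set.mk_preimage_prod_right hZ, Set.indicator_of_mem hZ]; simp
    · rw [Set.mk_preimage_prod_right_eq_empty hZ, Set.indicator_of_notMem hZ]; simp
  rw [h, Measure.finsetSum_apply]
  refine Finset.sum_congr rfl fun Z _ => ?_
  rw [Measure.smul_apply, (measurableEmbedding_prodMk_left _).map_apply, smul_eq_mul]
  rfl

/-- Lower bound for probabilities under the data law. -/
theorem dataLaw_ge (hp : ∀ j, 0 ≤ p j ∧ p j ≤ 1) (σ : ℝ)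
    (S : Set ((Fin n → Fin d → ℝ) × (Fin n → ℝ))) (G : Set (Fin n → Fin d → SignType))
    (hG : 199 / 200 ≤ prob (designWeight (Fin n) p) G)
    (h : ∀ Z ∈ G, ENNReal.ofReal (199 / 200) ≤
      noiseLaw n σ {ξ | ((fun i j => ((Z i j : SignType) : ℝ)), ξ) ∈ S}) :
    ENNReal.ofReal 0.99 ≤ dataLaw n p σ S := by
  have hw := isWeight_design (Fin n) hp
  rw [dataLaw_apply hp]
  -- (199/200)² exceeds 0.99.
  calc ENNReal.ofReal 0.99
      ≤ ENNReal.ofReal (prob (designWeight (Fin n) p) G * (199 / 200)) :=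
        ENNReal.ofReal_le_ofReal (by norm_num; linarith)
    _ = ∑ Z : Fin n → Fin d → SignType, ENNReal.ofReal
        ((∏ i, designWeight (Fin n) p i (Z i)) * (G.indicator 1 Z * (199 / 200))) := by
        rw [← ENNReal.ofReal_sum_of_nonneg]
        · simp only [prob, avg, Finset.sum_mul, mul_assoc]
        · intro Z _
          refine mul_nonneg (hw.prod_nonneg Z) (mul_nonneg ?_ (by norm_num))
          exact Set.indicator_nonneg (fun _ _ => zero_le_one) Z
    _ ≤ _ := by
        refine Finset.sum_le_sum fun Z _ => ?_
        rw [ENNReal.ofReal_mul (hw.prod_nonneg Z)]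
        gcongr
        by_cases hZ : Z ∈ G
        · rw [Set.indicator_of_mem hZ]; simpa using h Z hZ
        · rw [Set.indicator_of_notMem hZ]; simp

end laws

/-! ### Averages over the common columns -/

section rows

variable {m J : Type*} [Fintype m] [DecidableEq m] [Fintype J] [DecidableEq J] {p : J → ℝ}

theorem avg_designWeight_row (hp : ∀ j, 0 ≤ p j ∧ p j ≤ 1) (i : m) (g : (J → SignType) → ℝ) :
    avg (designWeight m p) (fun Z => g (Z i)) = avg (fun j => entryWeight (p j)) g := by
  have h := avg_prod_subset (isWeight_design m hp) {i} fun _ x => g x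
  simp only [Finset.prod_singleton] at h
  exact h

theorem prob_entry_ne_zero (hp : ∀ j, 0 ≤ p j ∧ p j ≤ 1) (i : m) (j : J) :
    prob (designWeight m p) {Z | Z i j ≠ 0} ≤ p j := by
  have h := avg_designWeight_row hp i fun x => (x j : ℝ) * (x j : ℝ)
  rw [avg_row_quadratic hp, if_pos rfl] at h
  rw [← h]
  refine prob_le_avg (isWeight_design m hp) (fun Z => mul_self_nonneg _) fun Z hZ => ?_
  rw [sign_sq_eq_one hZ]

theorem prob_two_entries_ne_zero (hp : ∀ j, 0 ≤ p j ∧ p j ≤ 1) (i : m) {j j' : J} (hj : j ≠ j') :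
    prob (designWeight m p) {Z | Z i j ≠ 0 ∧ Z i j' ≠ 0} ≤ p j * p j' := by
  have h := avg_designWeight_row hp i fun x => ∏ l ∈ {j, j'}, ((x l : ℝ) * (x l : ℝ))
  rw [avg_prod_subset (isWeight_entry hp) {j, j'} fun _ x => (x : ℝ) * (x : ℝ),
    Finset.prod_pair hj, sum_entryWeight_mul, sum_entryWeight_mul] at h
  have h2 : p j * p j' = p j / 2 * (1 + 1) * (p j' / 2 * (1 + 1)) := by ring
  simp at h
  rw [h2, ← h]
  refine prob_le_avg (isWeight_design m hp) (fun Z => ?_) fun Z hZ => ?_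
  · exact Finset.prod_nonneg fun l _ => mul_self_nonneg _
  · rw [Finset.prod_pair hj, sign_sq_eq_one hZ.1, sign_sq_eq_one hZ.2, one_mul]

end rows

section common

open Matrix

variable {n d : ℕ} {p : Fin d → ℝ} {Q : Finset (Fin d)}

/-- Columns in `Q` from `Z'`, the others from `Z`. -/
def mixCols (Q : Finset (Fin d)) (Z' Z : Fin n → Fin d → SignType) : Fin n → Fin d → SignType :=
  splice (fun _ j => j ∈ Q) Z' Z

theorem mixCols_of_mem (Z' Z : Fin n → Fin d → SignType) (i : Fin n) {j : Fin d} (hj : j ∈ Q) :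
    mixCols Q Z' Z i j = Z' i j := if_pos hj

theorem mixCols_of_notMem (Z' Z : Fin n → Fin d → SignType) (i : Fin n) {j : Fin d} (hj : j ∉ Q) :
    mixCols Q Z' Z i j = Z i j := if_neg hj

/-- Purity is read off the rare columns, so the set of pure rows is constant while the common
columns are averaged. -/
theorem pureRows_mixCols (Z' Z : Fin n → Fin d → SignType) :
    pureRows Q (mixCols Q Z' Z) = pureRows Q Z := by
  refine Finset.filter_congr fun i _ => forall_congr' fun j => forall_congr' fun hj => ?_
  rw [mixCols_of_notMem _ _ _ hj]

theorem RareSparse.mixCols {Z : Fin n → Fin d → SignType} (h : RareSparse Q Z)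
    (Z' : Fin n → Fin d → SignType) : RareSparse Q (mixCols Q Z' Z) := by
  intro i j j' hj hj' h1 h2
  rw [mixCols_of_notMem _ _ _ hj] at h1
  rw [mixCols_of_notMem _ _ _ hj'] at h2
  exact h i j j' hj hj' h1 h2

theorem nearDependent_congr {R : Finset (Fin n)} {Z Z' : Fin n → Fin d → SignType}
    (h : ∀ i ∈ R, ∀ j ∈ Q, Z i j = Z' i j) :
    Z ∈ nearDependent p R Q ↔ Z' ∈ nearDependent p R Q := by
  have h1 : ∀ u : Fin d → ℝ, ∑ i ∈ R, (∑ l ∈ Q, (Z i l : ℝ) * u l) ^ 2 =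
      ∑ i ∈ R, (∑ l ∈ Q, (Z' i l : ℝ) * u l) ^ 2 := fun u =>
    Finset.sum_congr rfl fun i hi => by
      rw [Finset.sum_congr rfl fun l hl => by rw [h i hi l hl]]
  simp only [nearDependent, Set.mem_ofPred_eq, h1]

theorem gramOn_congr {R : Finset (Fin n)} {Z Z' : Fin n → Fin d → SignType}
    (h : ∀ i ∈ R, ∀ j ∈ Q, Z i j = Z' i j) : gramOn R Q Z = gramOn R Q Z' := by
  ext l l'
  exact Finset.sum_congr rfl fun i hi => by rw [h i hi l l.2, h i hi l' l'.2]

theorem badSize_congr {R : Finset (Fin n)} {M t : ℕ} {Z Z' : Fin n → Fin d → SignType}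
    (h : ∀ i ∈ R, ∀ j ∈ Q, Z i j = Z' i j) (hZ : Z ∈ badSize R Q M t) : Z' ∈ badSize R Q M t := by
  obtain ⟨T, T', h1, h2, h3, h4, v, hv, h5⟩ := hZ
  refine ⟨T, T', h1, h2, h3, h4, v, hv, fun i hi => ?_⟩
  have h6 : ∑ j ∈ T', (Z i j : ℝ) * v j = ∑ j ∈ T', (Z' i j : ℝ) * v j :=
    Finset.sum_congr rfl fun j hj => by rw [h i hi j (h2 hj)]
  rw [← h6]
  exact h5 i hi

theorem sum_mul_biasVec_sq_le (hp : ∀ j, 0 ≤ p j ∧ p j ≤ 1) (X : Matrix (Fin n) (Fin d) ℝ)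
    {β : Fin d → ℝ} {B : ℝ} (hβ : ∀ j, |β j| ≤ B) :
    ∑ j, p j * biasVec X β j ^ 2 ≤ d * B ^ 2 := by
  calc ∑ j, p j * biasVec X β j ^ 2 ≤ ∑ j, biasVec X β j ^ 2 :=
        Finset.sum_le_sum fun j _ => mul_le_of_le_one_left (sq_nonneg _) (hp j).2
    _ ≤ ∑ j, β j ^ 2 := sum_sq_biasVec_le X β
    _ ≤ ∑ _j : Fin d, B ^ 2 := Finset.sum_le_sum fun j _ => sq_le_sq' (abs_le.1 (hβ j)).1
        (abs_le.1 (hβ j)).2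
    _ = d * B ^ 2 := by simp

/-- Outside near dependence only unseen features contribute; on it the trivial bound dB² is used. -/
theorem avg_bias_le (hp : ∀ j, 0 < p j ∧ p j ≤ 1) (hn : 0 < n) {β : Fin d → ℝ} {B : ℝ}
    (hβ : ∀ j, |β j| ≤ B) {Z : Fin n → Fin d → SignType} (hZ : RareSparse Q Z) :
    avg (designWeight (Fin n) p) (fun Z' => ∑ j, p j *
        biasVec (designMatrix (mixCols Q Z' Z)) β j ^ 2) ≤
      B ^ 2 * ∑ j ∈ Qᶜ, p j +
        d * B ^ 2 * prob (designWeight (Fin n) p) (nearDependent p (pureRows Q Z) Q) := by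
  have hp' : ∀ j, 0 ≤ p j ∧ p j ≤ 1 := fun j => ⟨(hp j).1.le, (hp j).2⟩
  have hw := isWeight_design (Fin n) hp'
  rw [prob, ← avg_const_mul, ← avg_const hw (B ^ 2 * ∑ j ∈ Qᶜ, p j), ← avg_add]
  refine avg_mono hw fun Z' => ?_
  have h0 : 0 ≤ B ^ 2 * ∑ j ∈ Qᶜ, p j :=
    mul_nonneg (sq_nonneg B) (Finset.sum_nonneg fun j _ => (hp j).1.le)
  by_cases h : Z' ∈ nearDependent p (pureRows Q Z) Q
  · rw [Set.indicator_of_mem h]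
    have := sum_mul_biasVec_sq_le hp' (designMatrix (mixCols Q Z' Z)) hβ
    simp only [Pi.one_apply]
    linarith
  · rw [Set.indicator_of_notMem h, mul_zero, add_zero]
    refine bias_le_of_good (fun j => (hp j).1) hn hβ (hZ.mixCols Z') ?_
    rw [pureRows_mixCols, nearDependent_congr fun i _ j hj => mixCols_of_mem Z' Z i hj]
    exact h

/-- A row outside `R` is independent of the Gram matrix of the rows in `R`. -/
theorem avg_leverage_le (hp : ∀ j, 0 < p j ∧ p j ≤ 1) (hn : 0 < n) (R : Finset (Fin n)) {i : Fin n}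
    (hi : i ∉ R) :
    avg (designWeight (Fin n) p) (fun Z => (nearDependent p R Q)ᶜ.indicator 1 Z *
      ((fun l : Q => (Z i l : ℝ)) ⬝ᵥ (gramOn R Q Z)⁻¹ *ᵥ (fun l => (Z i l : ℝ)))) ≤
      16 * Q.card / n := by
  have hp' : ∀ j, 0 ≤ p j ∧ p j ≤ 1 := fun j => ⟨(hp j).1.le, (hp j).2⟩
  have hw := isWeight_design (Fin n) hp'
  have hn' : (0 : ℝ) < n := Nat.cast_pos.2 hn
  rw [← avg_resample hp' (fun i' _ => i' ≠ i)]
  -- All rows but `i` are frozen, in particular the Gram matrix of `R`. Averaging the quadratic form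
  -- over row `i` leaves the sum of p_l (G⁻¹)_ll, each term at most 16/n.
  refine avg_le_of_le hw fun Z => ?_
  set s : Fin n → Fin d → Prop := fun i' _ => i' ≠ i
  have hcongr : ∀ Z', ∀ i' ∈ R, ∀ j ∈ Q, splice s Z Z' i' j = Z i' j := fun Z' i' hi' j _ =>
    if_pos fun h : i' = i => hi (h ▸ hi')
  have hrow : ∀ Z' (l : Fin d), splice s Z Z' i l = Z' i l := fun Z' l => if_neg fun h => h rfl
  have hmem : ∀ Z', splice s Z Z' ∈ (nearDependent p R Q)ᶜ ↔ Z ∈ (nearDependent p R Q)ᶜ := fun Z' =>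
    not_congr (nearDependent_congr (hcongr Z'))
  by_cases hZ : Z ∈ (nearDependent p R Q)ᶜ
  · have h1 : ∀ Z' : Fin n → Fin d → SignType,
        (nearDependent p R Q)ᶜ.indicator 1 (splice s Z Z') *
        ((fun l : Q => ((splice s Z Z' i l : SignType) : ℝ)) ⬝ᵥ (gramOn R Q (splice s Z Z'))⁻¹ *ᵥ
          (fun l : Q => ((splice s Z Z' i l : SignType) : ℝ))) =
        ∑ l : Q, ∑ l' : Q, (gramOn R Q Z)⁻¹ l l' * ((Z' i l : ℝ) * (Z' i l' : ℝ)) := by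
      intro Z'
      rw [Set.indicator_of_mem ((hmem Z').2 hZ), Pi.one_apply, one_mul, gramOn_congr (hcongr Z')]
      simp only [hrow, dotProduct, Matrix.mulVec, Finset.mul_sum]
      exact Finset.sum_congr rfl fun l _ => Finset.sum_congr rfl fun l' _ => by ring
    refine (congrArg (avg (designWeight (Fin n) p)) (funext h1)).trans_le ?_
    rw [avg_sum]
    simp only [avg_sum, avg_const_mul]
    have h2 : ∀ l l' : Q, avg (designWeight (Fin n) p) (fun Z' => (Z' i l : ℝ) * (Z' i l' : ℝ)) =
        if l = l' then p l else 0 := fun l l' => by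
      rw [avg_designWeight_row hp' i fun x => (x l : ℝ) * (x l' : ℝ), avg_row_quadratic hp']
      simp only [Subtype.ext_iff]
    simp only [h2, mul_ite, mul_zero, Finset.sum_ite_eq, Finset.mem_univ, if_true]
    have h3 := (gramOn_inv (fun j => (hp j).1) hn hZ).2
    calc ∑ l : Q, (gramOn R Q Z)⁻¹ l l * p l ≤ ∑ _l : Q, (16 / n : ℝ) := by
          refine Finset.sum_le_sum fun l _ => ?_
          have := mul_le_mul_of_nonneg_right (h3 l) (hp l).1.le
          refine this.trans_eq ?_
          have := (hp l).1.ne'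
          field_simp
      _ = 16 * Q.card / n := by simp; ring
  · have h1 : ∀ Z' : Fin n → Fin d → SignType,
        (nearDependent p R Q)ᶜ.indicator (1 : (Fin n → Fin d → SignType) → ℝ) (splice s Z Z') = 0 := fun Z' =>
      Set.indicator_of_notMem (fun h => hZ ((hmem Z').1 h)) _
    refine (congrArg (avg (designWeight (Fin n) p)) (funext fun Z' =>
      mul_eq_zero_of_left (h1 Z') _)).trans_le ?_
    rw [avg_const hw]
    positivity

/-- Bound for the inverse of the nonzero eigenvalues of the Gram matrix if no bad pair has more
than `t` columns. -/
def eigBound (d n k s t : ℕ) : ℝ :=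
  (d * (1 + k * (2 + 2 * k) ^ s) * (1 + 2 * d * (n * (4 * n * d) ^ t))) ^ 2

theorem eigBound_nonneg (d n k s t : ℕ) : 0 ≤ eigBound d n k s t := sq_nonneg _

/-- Apply the eigenvalue bound with `t` the largest bad size of the design, or 0 if there is none;
the sum over all sizes dominates the term of this largest one. -/
theorem sum_gramPinv_diag_le_eigBound {M s : ℕ} (hM : 1 ≤ M) (hs : Q.card < M ^ s)
    {Z : Fin n → Fin d → SignType} (hZ : RareSparse Q Z) :
    ∑ j, gramPinv (designMatrix Z) j j ≤ d * (eigBound d n Q.card s 0 +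
      ∑ t ∈ Finset.Icc 1 Q.card, (badSize (pureRows Q Z) Q M t).indicator 1 Z *
        eigBound d n Q.card s t) := by
  classical
  set S := (Finset.Icc 1 Q.card).filter fun t => Z ∈ badSize (pureRows Q Z) Q M t with hS
  have hterm : ∀ t ∈ Finset.Icc 1 Q.card,
      0 ≤ (badSize (pureRows Q Z) Q M t).indicator (1 : (Fin n → Fin d → SignType) → ℝ) Z * eigBound d n Q.card s t :=
    fun t _ => mul_nonneg (Set.indicator_nonneg (fun _ _ => zero_le_one) Z) (eigBound_nonneg _ _ _ _ _)
  have hbig : ∀ r, 0 < r → Z ∈ badSize (pureRows Q Z) Q M r → r ∈ S := by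
    intro r hr h
    obtain ⟨T, T', h1, h2, h3, -⟩ := id h
    exact Finset.mem_filter.2
      ⟨Finset.mem_Icc.2 ⟨hr, h3 ▸ Finset.card_le_card (h1.trans h2)⟩, h⟩
  have key : ∀ t, (∀ r, t < r → Z ∉ badSize (pureRows Q Z) Q M r) →
      ∑ j, gramPinv (designMatrix Z) j j ≤ d * eigBound d n Q.card s t := fun t ht =>
    sum_gramPinv_diag_le _ (eigBound_nonneg _ _ _ _ _) fun v lam hlam hv1 hv =>
      one_le_mul_eigenvalue hM hZ ht hs hlam hv1 hv
  by_cases hne : S.Nonempty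
  · have hmax := S.max'_mem hne
    refine (key (S.max' hne) fun r hr h => ?_).trans ?_
    · exact absurd (S.le_max' r (hbig r (by omega) h)) (not_le.2 hr)
    · gcongr
      have h1 := Finset.single_le_sum hterm (Finset.mem_filter.1 hmax).1
      rw [Set.indicator_of_mem (Finset.mem_filter.1 hmax).2, Pi.one_apply, one_mul] at h1
      linarith [eigBound_nonneg d n Q.card s 0]
  · refine (key 0 fun r hr h => hne ⟨r, hbig r hr h⟩).trans ?_
    gcongr
    linarith [Finset.sum_nonneg hterm]

/-- The terms are the common columns, the rare columns with their average leverage, and the bad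
event, where the trace of the pseudoinverse is bounded through the bad sizes. -/
theorem avg_variance_le (hp : ∀ j, 0 < p j ∧ p j ≤ 1) (hn : 0 < n) {M s : ℕ} (hM : 1 ≤ M)
    (hs : Q.card < M ^ s) {Z : Fin n → Fin d → SignType} (hZ : RareSparse Q Z) :
    avg (designWeight (Fin n) p) (fun Z' => ∑ j, p j *
        gramPinv (designMatrix (mixCols Q Z' Z)) j j) ≤
      16 * Q.card / n + (∑ j ∈ Qᶜ, p j) * (1 + 16 * Q.card / n) +
      d * (prob (designWeight (Fin n) p) (nearDependent p (pureRows Q Z) Q) *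
        eigBound d n Q.card s 0 + ∑ t ∈ Finset.Icc 1 Q.card,
          prob (designWeight (Fin n) p) (badSize (pureRows Q Z) Q M t) *
            eigBound d n Q.card s t) := by
  classical
  have hp' : ∀ j, 0 ≤ p j ∧ p j ≤ 1 := fun j => ⟨(hp j).1.le, (hp j).2⟩
  have hw := isWeight_design (Fin n) hp'
  have hn' : (0 : ℝ) < n := Nat.cast_pos.2 hn
  set R := pureRows Q Z with hR
  set N := nearDependent p R Q with hN
  have hRz : ∀ i, ∀ j ∉ Q, Z i j ≠ 0 → i ∉ R := fun i j hj hij hi =>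
    hij ((Finset.mem_filter.1 hi).2 j hj)
  have hmix : ∀ Z', ∀ i ∈ R, ∀ j ∈ Q, mixCols Q Z' Z i j = Z' i j := fun Z' i _ j hj =>
    mixCols_of_mem Z' Z i hj
  have hpure : ∀ Z', ∀ i ∈ R, ∀ j, j ∉ Q → mixCols Q Z' Z i j = 0 := fun Z' i hi j hj => by
    rw [mixCols_of_notMem _ _ _ hj]; exact (Finset.mem_filter.1 hi).2 j hj
  have hgood : ∀ Z', Z' ∉ N → mixCols Q Z' Z ∉ nearDependent p R Q := fun Z' h => by
    rwa [nearDependent_congr (hmix Z')]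
  -- The dominating functions `g` are defined for all designs and nonnegative, so that they can be
  -- averaged over the whole space.
  have hrare : ∀ j : Fin d, ∃ g : (Fin n → Fin d → SignType) → ℝ,
      avg (designWeight (Fin n) p) g ≤ 1 + 16 * Q.card / n ∧ (∀ Z', 0 ≤ g Z') ∧
        ∀ Z', Z' ∉ N → j ∉ Q → gramPinv (designMatrix (mixCols Q Z' Z)) j j ≤ g Z' := by
    intro j
    by_cases h : j ∉ Q ∧ ∃ i, Z i j ≠ 0
    · obtain ⟨hj, i, hij⟩ := h
      have hi : i ∉ R := hRz i j hj hij
      have hle : ∀ Z', Z' ∉ N → gramPinv (designMatrix (mixCols Q Z' Z)) j j ≤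
          1 + Nᶜ.indicator 1 Z' * ((fun l : Q => (Z' i l : ℝ)) ⬝ᵥ (gramOn R Q Z')⁻¹ *ᵥ
            (fun l => (Z' i l : ℝ))) := by
        intro Z' hZ'
        have h1 := gramPinv_diag_rare_le (hZ.mixCols Z')
          (gramOn_inv (fun j => (hp j).1) hn (hgood Z' hZ')).1 (hpure Z') hj hi
          (by rwa [mixCols_of_notMem _ _ _ hj])
        rw [gramOn_congr (hmix Z')] at h1
        have h2 : (fun l : Q => (mixCols Q Z' Z i l : ℝ)) = fun l : Q => (Z' i l : ℝ) := by
          ext l; rw [mixCols_of_mem _ _ _ l.2]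
        rw [h2] at h1
        rwa [Set.indicator_of_mem (show Z' ∈ Nᶜ from hZ'), Pi.one_apply, one_mul]
      refine ⟨fun Z' => 1 + Nᶜ.indicator 1 Z' * ((fun l : Q => (Z' i l : ℝ)) ⬝ᵥ (gramOn R Q Z')⁻¹ *ᵥ
            (fun l => (Z' i l : ℝ))), ?_, fun Z' => ?_, fun Z' hZ' _ => hle Z' hZ'⟩
      · rw [avg_add, avg_const hw]
        linarith [avg_leverage_le hp hn R hi (Q := Q)]
      · by_cases hZ' : Z' ∈ N
        · beta_reduce
          rw [Set.indicator_of_notMem (show Z' ∉ Nᶜ from not_not_intro hZ')]; norm_num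
        · exact (gramPinv_diag_nonneg _ _).trans (hle Z' hZ')
    · refine ⟨fun _ => 0, ?_, fun _ => le_rfl, fun Z' _ hj => ?_⟩
      · rw [avg_const hw]; positivity
      · push Not at h
        refine (gramPinv_diag_of_col_eq_zero _ fun i => ?_).le
        rw [designMatrix, Matrix.of_apply, mixCols_of_notMem _ _ _ hj, h hj i]
        simp
  choose g hgavg hg0 hg using hrare
  have hpoint : ∀ Z', ∑ j, p j * gramPinv (designMatrix (mixCols Q Z' Z)) j j ≤
      16 * Q.card / n + ∑ j ∈ Qᶜ, p j * g j Z' + d * (eigBound d n Q.card s 0 * N.indicator 1 Z' +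
        ∑ t ∈ Finset.Icc 1 Q.card, eigBound d n Q.card s t *
          (badSize R Q M t).indicator 1 Z') := by
    intro Z'
    have hc0 : (0 : ℝ) ≤ 16 * Q.card / n := by positivity
    have hr0 : 0 ≤ ∑ j ∈ Qᶜ, p j * g j Z' :=
      Finset.sum_nonneg fun j _ => mul_nonneg (hp j).1.le (hg0 j Z')
    have hb0 : 0 ≤ ∑ t ∈ Finset.Icc 1 Q.card, eigBound d n Q.card s t *
        (badSize R Q M t).indicator (1 : (Fin n → Fin d → SignType) → ℝ) Z' :=
      Finset.sum_nonneg fun t _ => mul_nonneg (eigBound_nonneg _ _ _ _ _)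
        (Set.indicator_nonneg (fun _ _ => zero_le_one) Z')
    by_cases hZ' : Z' ∈ N
    · rw [Set.indicator_of_mem hZ', Pi.one_apply, mul_one]
      have h1 := sum_gramPinv_diag_le_eigBound hM hs (hZ.mixCols Z')
      rw [pureRows_mixCols] at h1
      have h2 : ∀ t, (badSize R Q M t).indicator (1 : (Fin n → Fin d → SignType) → ℝ)
          (mixCols Q Z' Z) = (badSize R Q M t).indicator 1 Z' := by
        intro t
        by_cases h : Z' ∈ badSize R Q M t
        · rw [Set.indicator_of_mem h, Set.indicator_of_mem
            (badSize_congr (fun i hi j hj => (hmix Z' i hi j hj).symm) h)]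
          rfl
        · rw [Set.indicator_of_notMem h, Set.indicator_of_notMem
            fun h' => h (badSize_congr (hmix Z') h')]
      have h3 : ∑ j, p j * gramPinv (designMatrix (mixCols Q Z' Z)) j j ≤
          ∑ j, gramPinv (designMatrix (mixCols Q Z' Z)) j j := Finset.sum_le_sum fun j _ =>
        mul_le_of_le_one_left (gramPinv_diag_nonneg _ _) (hp j).2
      simp only [← hR, h2, mul_comm (Set.indicator _ _ _)] at h1
      linarith
    · rw [Set.indicator_of_notMem hZ', mul_zero, zero_add,
        ← Finset.sum_add_sum_compl Q fun j => p j * gramPinv (designMatrix (mixCols Q Z' Z)) j j]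
      have hb1 : 0 ≤ (d : ℝ) * ∑ t ∈ Finset.Icc 1 Q.card, eigBound d n Q.card s t *
        (badSize R Q M t).indicator (1 : (Fin n → Fin d → SignType) → ℝ) Z' :=
        mul_nonneg (Nat.cast_nonneg d) hb0
      have h1 : ∑ j ∈ Q, p j * gramPinv (designMatrix (mixCols Q Z' Z)) j j ≤ 16 * Q.card / n := by
        have h2 := gramOn_inv (fun j => (hp j).1) hn (hgood Z' hZ')
        calc ∑ j ∈ Q, p j * gramPinv (designMatrix (mixCols Q Z' Z)) j j
            ≤ ∑ _j ∈ Q, (16 / n : ℝ) := by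
              refine Finset.sum_le_sum fun j hj => ?_
              have h3 := (gramPinv_diag_common_le h2.1 (hpure Z') ⟨j, hj⟩).trans (h2.2 ⟨j, hj⟩)
              refine (mul_le_mul_of_nonneg_left h3 (hp j).1.le).trans_eq ?_
              have := (hp j).1.ne'
              simp only
              field_simp
          _ = 16 * Q.card / n := by simp; ring
      have h2 : ∑ j ∈ Qᶜ, p j * gramPinv (designMatrix (mixCols Q Z' Z)) j j ≤
          ∑ j ∈ Qᶜ, p j * g j Z' := Finset.sum_le_sum fun j hj =>
        mul_le_mul_of_nonneg_left (hg j Z' hZ' (Finset.mem_compl.1 hj)) (hp j).1.le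
      linarith
  refine (avg_mono hw hpoint).trans ?_
  rw [avg_add, avg_add, avg_const hw, avg_const_mul, avg_add, avg_const_mul, avg_sum, avg_sum]
  simp only [avg_const_mul]
  change _ + _ + d * (_ * prob _ N + ∑ t ∈ _, _ * prob _ (badSize R Q M t)) ≤ _
  have h1 : ∑ j ∈ Qᶜ, p j * avg (designWeight (Fin n) p) (g j) ≤
      (∑ j ∈ Qᶜ, p j) * (1 + 16 * Q.card / n) := by
    rw [Finset.sum_mul]
    exact Finset.sum_le_sum fun j _ => mul_le_mul_of_nonneg_left (hgavg j) (hp j).1.le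
  simp only [mul_comm (prob _ _)]
  linarith

/-! ### The rare columns -/

/-- Union bound over rows and ordered pairs of rare columns, whose entries are independent. -/
theorem prob_not_rareSparse_le (hp : ∀ j, 0 ≤ p j ∧ p j ≤ 1) :
    prob (designWeight (Fin n) p) {Z | ¬ RareSparse Q Z} ≤ n * (∑ j ∈ Qᶜ, p j) ^ 2 := by
  classical
  have hw := isWeight_design (Fin n) hp
  have h1 : {Z : Fin n → Fin d → SignType | ¬ RareSparse Q Z} ⊆
      {Z | ∃ i : Fin n, Z ∈ {Z : Fin n → Fin d → SignType | ∃ j ∈ Qᶜ,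
        Z ∈ {Z : Fin n → Fin d → SignType | ∃ j' ∈ Qᶜ, Z ∈
          {Z : Fin n → Fin d → SignType | j ≠ j' ∧ Z i j ≠ 0 ∧ Z i j' ≠ 0}}}} := by
    intro Z hZ
    simp only [Set.mem_ofPred_eq, RareSparse] at hZ
    push Not at hZ
    obtain ⟨i, j, j', hj, hj', h, h', hne⟩ := hZ
    exact ⟨i, j, Finset.mem_compl.2 hj, j', Finset.mem_compl.2 hj', hne, h, h'⟩
  refine (prob_mono hw h1).trans ((prob_iUnion_le hw _).trans ?_)
  have h2 : ∀ i : Fin n, prob (designWeight (Fin n) p) {Z : Fin n → Fin d → SignType | ∃ j ∈ Qᶜ,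
        Z ∈ {Z : Fin n → Fin d → SignType | ∃ j' ∈ Qᶜ, Z ∈
          {Z : Fin n → Fin d → SignType | j ≠ j' ∧ Z i j ≠ 0 ∧ Z i j' ≠ 0}}} ≤
      (∑ j ∈ Qᶜ, p j) ^ 2 := by
    intro i
    refine (prob_biUnion_le hw _ _).trans ?_
    rw [sq, Finset.sum_mul_sum]
    refine Finset.sum_le_sum fun j _ => (prob_biUnion_le hw _ _).trans
      (Finset.sum_le_sum fun j' _ => ?_)
    by_cases hj : j = j'
    · have : {Z : Fin n → Fin d → SignType | j ≠ j' ∧ Z i j ≠ 0 ∧ Z i j' ≠ 0} ⊆ ∅ :=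
        fun Z hZ => hZ.1 hj
      refine (prob_mono hw this).trans ?_
      have h3 : prob (designWeight (Fin n) p) ∅ = 0 := by
        simp only [prob, Set.indicator_empty]; exact avg_const hw 0
      rw [h3]
      exact mul_nonneg (hp j).1 (hp j').1
    · exact (prob_mono hw fun Z hZ => hZ.2).trans (prob_two_entries_ne_zero hp i hj)
  exact (Finset.sum_le_sum fun i _ => h2 i).trans_eq (by simp)

/-- Markov's inequality: the expected number of rare entries, hence of impure rows, is at most n
p_{>k}. -/
theorem prob_pureRows_card_lt_le (hp : ∀ j, 0 ≤ p j ∧ p j ≤ 1) (hn : 0 < n) :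
    prob (designWeight (Fin n) p) {Z | ((pureRows Q Z).card : ℝ) < (n : ℝ) / 2} ≤
      2 * ∑ j ∈ Qᶜ, p j := by
  classical
  have hw := isWeight_design (Fin n) hp
  have hn' : (0 : ℝ) < n := Nat.cast_pos.2 hn
  have h1 : prob (designWeight (Fin n) p) {Z | ((pureRows Q Z).card : ℝ) < (n : ℝ) / 2} ≤
      avg (designWeight (Fin n) p) fun Z => 2 / n * ∑ i : Fin n, ∑ j ∈ Qᶜ,
        {Z : Fin n → Fin d → SignType | Z i j ≠ 0}.indicator 1 Z := by
    have hsum : ∀ Z : Fin n → Fin d → SignType, ∀ i, 0 ≤ ∑ j ∈ Qᶜ,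
        {Z : Fin n → Fin d → SignType | Z i j ≠ 0}.indicator (1 : (Fin n → Fin d → SignType) → ℝ) Z := fun Z i =>
      Finset.sum_nonneg fun j _ => Set.indicator_nonneg (fun _ _ => zero_le_one) Z
    refine prob_le_avg hw (fun Z => ?_) fun Z hZ => ?_
    · exact mul_nonneg (by positivity) (Finset.sum_nonneg fun i _ => hsum Z i)
    · have h2 : ((pureRows Q Z)ᶜ.card : ℝ) ≤ ∑ i : Fin n, ∑ j ∈ Qᶜ,
          {Z : Fin n → Fin d → SignType | Z i j ≠ 0}.indicator (1 : (Fin n → Fin d → SignType) → ℝ) Z := by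
        rw [Finset.cast_card]
        refine (Finset.sum_le_sum fun i hi => ?_).trans
          (Finset.sum_le_sum_of_subset_of_nonneg (Finset.subset_univ (pureRows Q Z)ᶜ)
            fun i _ _ => hsum Z i)
        have h3 : ∃ j, j ∉ Q ∧ Z i j ≠ 0 := by
          by_contra hcon
          push Not at hcon
          exact Finset.mem_compl.1 hi (Finset.mem_filter.2 ⟨Finset.mem_univ i, hcon⟩)
        obtain ⟨j, hj, hij⟩ := h3
        refine le_trans (le_of_eq ?_) (Finset.single_le_sum
          (fun j _ => Set.indicator_nonneg (fun _ _ => zero_le_one) Z) (Finset.mem_compl.2 hj))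
        rw [Set.indicator_of_mem (show Z ∈ {Z : Fin n → Fin d → SignType | Z i j ≠ 0} from hij)]
      have h4 : ((pureRows Q Z)ᶜ.card : ℝ) = n - (pureRows Q Z).card := by
        rw [Finset.card_compl, Fintype.card_fin, Nat.cast_sub]
        exact (Finset.card_le_univ _).trans_eq (Fintype.card_fin n)
      have h5 : ((pureRows Q Z).card : ℝ) < (n : ℝ) / 2 := hZ
      have h6 : (n : ℝ) / 2 ≤ ∑ i : Fin n, ∑ j ∈ Qᶜ,
          {Z : Fin n → Fin d → SignType | Z i j ≠ 0}.indicator (1 : (Fin n → Fin d → SignType) → ℝ) Z := by linarith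
      calc (1 : ℝ) = 2 / n * (n / 2) := by field_simp
        _ ≤ _ := by gcongr
  refine h1.trans ?_
  rw [avg_const_mul, avg_sum]
  simp only [avg_sum]
  have h2 : ∑ i : Fin n, ∑ j ∈ Qᶜ, avg (designWeight (Fin n) p)
      ({Z : Fin n → Fin d → SignType | Z i j ≠ 0}.indicator 1) ≤ ∑ _i : Fin n, ∑ j ∈ Qᶜ, p j :=
    Finset.sum_le_sum fun i _ => Finset.sum_le_sum fun j _ => prob_entry_ne_zero hp i j
  calc _ ≤ 2 / (n : ℝ) * ∑ _i : Fin n, ∑ j ∈ Qᶜ, p j := by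
        gcongr
    _ = 2 * ∑ j ∈ Qᶜ, p j := by simp; field_simp

theorem prob_rare_good (hp : ∀ j, 0 ≤ p j ∧ p j ≤ 1) (hn : 10 ^ 6 ≤ n)
    (hq : n * (∑ j ∈ Qᶜ, p j) ^ 2 ≤ 1 / 1000) :
    199 / 200 ≤ prob (designWeight (Fin n) p)
      {Z | RareSparse Q Z ∧ (n : ℝ) / 2 ≤ (pureRows Q Z).card} := by
  have hw := isWeight_design (Fin n) hp
  have hn1 : (10 : ℝ) ^ 6 ≤ n := by exact_mod_cast hn
  set q := ∑ j ∈ Qᶜ, p j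
  have hq0 : 0 ≤ q := Finset.sum_nonneg fun j _ => (hp j).1
  -- Follows from n q² ≤ 1/1000 and n ≥ 10⁶. The two failure probabilities are then at most 1/1000
  -- and 2/1000, below 1/200 together.
  have hq1 : q ≤ 1 / 1000 := by
    by_contra h
    push Not at h
    nlinarith [mul_lt_mul'' h h (by norm_num) (by norm_num)]
  have h1 := prob_not_rareSparse_le (n := n) (Q := Q) hp
  have h2 := prob_pureRows_card_lt_le (n := n) (Q := Q) hp (by omega)
  have h3 : 1 ≤ prob (designWeight (Fin n) p)
      {Z | RareSparse Q Z ∧ (n : ℝ) / 2 ≤ (pureRows Q Z).card} +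
      (prob (designWeight (Fin n) p) {Z | ¬ RareSparse Q Z} +
        prob (designWeight (Fin n) p) {Z | ((pureRows Q Z).card : ℝ) < (n : ℝ) / 2}) := by
    refine le_trans ?_ ((prob_union_le hw _ _).trans (add_le_add_right (prob_union_le hw _ _) _))
    refine le_trans (le_of_eq (avg_const hw 1).symm) (avg_mono hw fun Z => ?_)
    rw [Set.indicator_of_mem]
    · rfl
    · by_cases h : RareSparse Q Z
      · by_cases h' : (n : ℝ) / 2 ≤ (pureRows Q Z).card
        · exact Or.inl ⟨h, h'⟩
        · exact Or.inr (Or.inr (not_le.1 h'))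
      · exact Or.inr (Or.inl h)
  linarith

end common

/-! ### Quantitative estimates -/

theorem natCast_pow_eq_exp {d : ℕ} (hd : 0 < d) (m : ℕ) :
    (d : ℝ) ^ m = Real.exp (m * Real.log d) := by
  rw [Real.exp_nat_mul, Real.exp_log (Nat.cast_pos.2 hd)]

theorem eigBound_le {d n k : ℕ} (hd : 8 ≤ d) (hn : n ≤ d) (hk : k ≤ d) (s t : ℕ) :
    eigBound d n k s t ≤ (d : ℝ) ^ (4 * s + 6 * t + 12) := by
  have hd' : (8 : ℝ) ≤ d := by exact_mod_cast hd
  have hn' : (n : ℝ) ≤ d := by exact_mod_cast hn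
  have hk' : (k : ℝ) ≤ d := by exact_mod_cast hk
  have hk0 : (0 : ℝ) ≤ k := Nat.cast_nonneg k
  have hn0 : (0 : ℝ) ≤ n := Nat.cast_nonneg n
  set D : ℝ := (d : ℝ) with hD
  have h1 : (2 + 2 * k : ℝ) ^ s ≤ (D ^ 2) ^ s := by gcongr; nlinarith
  have h2 : (4 * n * D : ℝ) ^ t ≤ (D ^ 3) ^ t := by
    gcongr
    calc 4 * n * D ≤ D * D * D := by gcongr; nlinarith
      _ = D ^ 3 := by ring
  have h3 : (1 : ℝ) ≤ (D ^ 2) ^ s := one_le_pow₀ (one_le_pow₀ (by linarith))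
  have h4 : (1 : ℝ) ≤ (D ^ 3) ^ t := one_le_pow₀ (one_le_pow₀ (by linarith))
  have h5 : 1 + k * (2 + 2 * k : ℝ) ^ s ≤ D ^ 2 * (D ^ 2) ^ s := by
    calc 1 + k * (2 + 2 * k : ℝ) ^ s ≤ (D ^ 2) ^ s + D * (D ^ 2) ^ s := by gcongr
      _ = (1 + D) * (D ^ 2) ^ s := by ring
      _ ≤ D ^ 2 * (D ^ 2) ^ s := by gcongr; nlinarith
  have h6 : 1 + 2 * D * (n * (4 * n * D : ℝ) ^ t) ≤ D ^ 3 * (D ^ 3) ^ t := by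
    calc 1 + 2 * D * (n * (4 * n * D : ℝ) ^ t) ≤ (D ^ 3) ^ t + 2 * D * (D * (D ^ 3) ^ t) := by gcongr
      _ = (1 + 2 * D ^ 2) * (D ^ 3) ^ t := by ring
      _ ≤ D ^ 3 * (D ^ 3) ^ t := by gcongr; nlinarith [mul_le_mul_of_nonneg_right hd' (sq_nonneg D)]
  calc eigBound d n k s t ≤ (D * (D ^ 2 * (D ^ 2) ^ s) * (D ^ 3 * (D ^ 3) ^ t)) ^ 2 := by
        unfold eigBound; gcongr
    _ = D ^ (4 * s + 6 * t + 12) := by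
        rw [← pow_mul, ← pow_mul, ← pow_add, ← pow_add, ← pow_succ', ← pow_add, ← pow_mul]
        congr 1; ring

/-- With x = qt in [0, 1], e^{-x} ≤ 1 - x/2, so the left side is at most 1 - x/4. -/
theorem half_add_half_pow_le {q : ℝ} (hq : 0 ≤ q) (hq1 : q ≤ 1) {t : ℕ} (ht : q * t ≤ 1) :
    1 / 2 + 1 / 2 * (1 - q) ^ t ≤ Real.exp (-(q * t / 4)) := by
  have hx0 : 0 ≤ q * t := by positivity
  have h1 : (1 - q) ^ t ≤ Real.exp (-(q * t)) := by
    calc (1 - q) ^ t ≤ Real.exp (-q) ^ t :=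
          pow_le_pow_left₀ (by linarith) (by linarith [Real.add_one_le_exp (-q)]) t
      _ = Real.exp (-(q * t)) := by rw [← Real.exp_nat_mul]; congr 1; ring
  have h2 : Real.exp (-(q * t)) ≤ 1 - q * t / 2 := by
    have h3 := Real.add_one_le_exp (q * t)
    rw [Real.exp_neg]
    refine inv_le_of_inv_le₀ (by linarith) (le_trans ?_ h3)
    rw [inv_le_iff_one_le_mul₀ (by linarith)]
    nlinarith
  have h4 := Real.add_one_le_exp (-(q * t / 4))
  linarith

/-! ### Probabilities of degeneracy against sizes of inverse eigenvalues. -/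

section regime

variable {d n k M : ℕ} {c : ℝ} {p : Fin d → ℝ}

/-- The counting factors are at most d^{7Mt}. At least n/4 rows remain free, each contributing
exp(-qt/4) with q = cL²/n, which together give exp(-tcL²/16). -/
theorem prob_badSize_le_exp (hp : ∀ j, 0 ≤ p j ∧ p j ≤ 1) (hd : 8 ≤ d) (hnd : n ≤ d)
    (hM : 1 ≤ M) (hc : 0 < c) (hc1 : c ≤ 1) (hL : 1 ≤ Real.log d) (hkn : k * Real.log d ^ 5 ≤ n)
    (hLM : 4 * M ≤ Real.log d) {Q : Finset (Fin d)}
    (hpQ : ∀ j ∈ Q, c * Real.log d ^ 2 / n ≤ p j) {R : Finset (Fin n)} (hR : (n : ℝ) / 2 ≤ R.card)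
    {t : ℕ} (ht : 1 ≤ t) (htk : t ≤ k) :
    prob (designWeight (Fin n) p) (badSize R Q M t) ≤
      Real.exp (t * (7 * M * Real.log d - c * Real.log d ^ 2 / 16)) := by
  set L := Real.log d
  have hd' : (8 : ℝ) ≤ d := by exact_mod_cast hd
  have hM' : (1 : ℝ) ≤ M := by exact_mod_cast hM
  have htk' : (t : ℝ) ≤ k := by exact_mod_cast htk
  have ht' : (1 : ℝ) ≤ t := by exact_mod_cast ht
  have hL5 : L ≤ L ^ 5 := le_self_pow₀ hL (by norm_num)
  have hL25 : L ^ 2 ≤ L ^ 5 := pow_le_pow_right₀ hL (by norm_num)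
  have hk0 : (0 : ℝ) < k := by linarith
  have hn0 : (0 : ℝ) < n := lt_of_lt_of_le (by positivity) hkn
  set q := c * L ^ 2 / n with hq
  have hq0 : 0 ≤ q := by positivity
  have hqt : q * t ≤ 1 := by
    rw [hq, div_mul_eq_mul_div, div_le_one hn0]
    calc c * L ^ 2 * (t : ℝ) ≤ 1 * L ^ 5 * (k : ℝ) := by gcongr
      _ ≤ (n : ℝ) := by linarith
  have hq1 : q ≤ 1 := le_trans (le_mul_of_one_le_right hq0 ht') hqt
  refine (prob_badSize_le hp R Q hq0 hq1 hpQ).trans ?_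
  rw [Fintype.card_fin]
  have hRn : (R.card : ℝ) ≤ n := by
    exact_mod_cast (Finset.card_le_univ R).trans_eq (Fintype.card_fin n)
  have hnd' : (n : ℝ) ≤ d := by exact_mod_cast hnd
  have hkn' : (k : ℝ) ≤ n := by nlinarith
  have hMt : (M * t : ℝ) ≤ n / 4 := by nlinarith
  have hcard : (n : ℝ) / 4 ≤ (R.card - M * t : ℕ) := by
    have h1 : M * t ≤ R.card := by
      have : ((M * t : ℕ) : ℝ) ≤ R.card := by push_cast; linarith
      exact_mod_cast this
    rw [Nat.cast_sub h1]; push_cast; linarith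
  have hfac : (1 / 2 + 1 / 2 * (1 - q) ^ t) ^ (R.card - M * t) ≤
      Real.exp (-(t * (c * L ^ 2 / 16))) := by
    calc (1 / 2 + 1 / 2 * (1 - q) ^ t) ^ (R.card - M * t)
        ≤ Real.exp (-(q * t / 4)) ^ (R.card - M * t) := by
          refine pow_le_pow_left₀ ?_ (half_add_half_pow_le hq0 hq1 hqt) _
          have : 0 ≤ (1 - q) ^ t := pow_nonneg (by linarith) t
          linarith
      _ = Real.exp ((R.card - M * t : ℕ) * -(q * t / 4)) := by rw [Real.exp_nat_mul]
      _ ≤ Real.exp (-(t * (c * L ^ 2 / 16))) := by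
          gcongr
          have h2 : (n : ℝ) / 4 * (q * t / 4) = t * (c * L ^ 2 / 16) := by
            rw [hq]; field_simp; ring
          have h3 := mul_le_mul_of_nonneg_right hcard (by positivity : 0 ≤ q * t / 4)
          linarith
  have hpre : ((d : ℝ) + 1) ^ t * ((d : ℝ) + 1) ^ (M * t) *
      (2 ^ t * (2 * R.card + t + 1) ^ (M * t)) ≤ Real.exp (t * (7 * M * L)) := by
    calc ((d : ℝ) + 1) ^ t * ((d : ℝ) + 1) ^ (M * t) * (2 ^ t * (2 * R.card + t + 1) ^ (M * t))
        ≤ ((d : ℝ) ^ 2) ^ t * ((d : ℝ) ^ 2) ^ (M * t) * ((d : ℝ) ^ t * ((d : ℝ) ^ 2) ^ (M * t)) := by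
          gcongr <;> nlinarith
      _ = (d : ℝ) ^ (3 * t + 4 * (M * t)) := by
          rw [← pow_mul, ← pow_mul, ← pow_add, ← pow_add, ← pow_add]; congr 1; ring
      _ ≤ (d : ℝ) ^ (7 * (M * t)) := by
          refine pow_le_pow_right₀ (by linarith) ?_
          have := Nat.le_mul_of_pos_left t hM
          omega
      _ = Real.exp (t * (7 * M * L)) := by
          rw [natCast_pow_eq_exp (by omega)]; push_cast; congr 1; ring
  have h1 : t * (7 * M * L - c * L ^ 2 / 16) = t * (7 * M * L) + -(t * (c * L ^ 2 / 16)) := by ring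
  rw [h1, Real.exp_add, ← mul_assoc]
  refine mul_le_mul hpre hfac (pow_nonneg ?_ _) (Real.exp_pos _).le
  have : 0 ≤ (1 - q) ^ t := pow_nonneg (by linarith) t
  linarith

theorem prob_nearDependent_le_exp (hp : ∀ j, 0 ≤ p j ∧ p j ≤ 1) (hd : 8 ≤ d) (hkd : k ≤ d)
    (hc1 : c ≤ 1) (hL : 256 ≤ Real.log d) (hkn : k * Real.log d ^ 5 ≤ n) (hn : 0 < n)
    {Q : Finset (Fin d)} (hQ : Q.card = k) (hpQ : ∀ j ∈ Q, c * Real.log d ^ 2 / n ≤ p j)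
    {R : Finset (Fin n)} (hR : (n : ℝ) / 2 ≤ R.card) :
    prob (designWeight (Fin n) p) (nearDependent p R Q) ≤
      Real.exp (2 * Real.log d - c * Real.log d ^ 2 / 128) := by
  set L := Real.log d with hLd
  have hd' : (8 : ℝ) ≤ d := by exact_mod_cast hd
  have hkd' : (k : ℝ) ≤ d := by exact_mod_cast hkd
  have hn0 : (0 : ℝ) < n := Nat.cast_pos.2 hn
  have hL0 : 0 < L := by linarith
  -- The leverage threshold L⁻³ makes the second error exp(-L³/1024), negligible for L ≥ 256; kL⁵ ≤
  -- n leaves room for the dimension condition.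
  have h := prob_nearDependent_le (m := Fin n) hp R Q (η := (L ^ 3)⁻¹) (by positivity)
    (by rwa [Fintype.card_fin]) (by
      rw [hQ, Fintype.card_fin, inv_mul_eq_div, le_div_iff₀ (by positivity), le_div_iff₀ (by norm_num)]
      refine le_trans ?_ hkn
      have : (k : ℝ) * L ^ 5 = k * L ^ 3 * L ^ 2 := by ring
      rw [this]
      gcongr
      nlinarith) hpQ
  refine h.trans ?_
  rw [hQ, Fintype.card_fin]
  have h1 : (n : ℝ) * (c * L ^ 2 / n) / 128 = c * L ^ 2 / 128 := by field_simp
  have h2 : Real.exp (-(1 / (1024 * (L ^ 3)⁻¹))) ≤ Real.exp (-(c * L ^ 2 / 128)) := by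
    refine Real.exp_le_exp.2 (neg_le_neg ?_)
    have : 1 / (1024 * (L ^ 3)⁻¹) = L ^ 2 * L / 1024 := by field_simp
    rw [this]
    nlinarith [sq_nonneg L, mul_le_mul_of_nonneg_left hL (sq_nonneg L),
      mul_le_mul_of_nonneg_right hc1 (sq_nonneg L)]
  rw [h1]
  calc (k : ℝ) * (3 * Real.exp (-(c * L ^ 2 / 128)) + 2 * Real.exp (-(1 / (1024 * (L ^ 3)⁻¹))))
      ≤ d * (3 * Real.exp (-(c * L ^ 2 / 128)) + 2 * Real.exp (-(c * L ^ 2 / 128))) := by gcongr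
    _ = (5 * d) * Real.exp (-(c * L ^ 2 / 128)) := by ring
    _ ≤ (d : ℝ) ^ 2 * Real.exp (-(c * L ^ 2 / 128)) := by gcongr; nlinarith
    _ = Real.exp (2 * L - c * L ^ 2 / 128) := by
        rw [natCast_pow_eq_exp (by omega), ← Real.exp_add]; push_cast; congr 1

/-- Both probability exponents are quadratic in L, and linear in `t` for bad sizes. The eigenvalue
bound costs (6t + 16)L plus the scale term cL²/512, the latter because log M ≥ 2048/c keeps the
number of scales below cL/2048 + 1. Every product is thus at most d⁻⁴. -/
theorem bad_terms_le (hp : ∀ j, 0 ≤ p j ∧ p j ≤ 1) (hnd : n ≤ d) (hk : 1 ≤ k) (hkd : k ≤ d)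
    (hM : 2 ≤ M) (hc : 0 < c) (hc1 : c ≤ 1) (hMc : 2048 ≤ c * Real.log M)
    (hL : 4096 * (7 * M + 32) ≤ c * Real.log d) (hkn : k * Real.log d ^ 5 ≤ n)
    {Q : Finset (Fin d)} (hQ : Q.card = k) (hpQ : ∀ j ∈ Q, c * Real.log d ^ 2 / n ≤ p j)
    {R : Finset (Fin n)} (hR : (n : ℝ) / 2 ≤ R.card) :
    d * (prob (designWeight (Fin n) p) (nearDependent p R Q) *
        eigBound d n k (Nat.log M k + 1) 0 + ∑ t ∈ Finset.Icc 1 k,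
          prob (designWeight (Fin n) p) (badSize R Q M t) *
            eigBound d n k (Nat.log M k + 1) t) ≤ 1 / d := by
  set L := Real.log d with hLd
  set s := Nat.log M k + 1 with hs
  have hM' : (2 : ℝ) ≤ M := by exact_mod_cast hM
  have hlogM : 0 < Real.log M := Real.log_pos (by linarith)
  have hL0 : 0 ≤ L := Real.log_natCast_nonneg d
  have hLbig : 4096 * (7 * M + 32) ≤ L := hL.trans (mul_le_of_le_one_left hL0 hc1)
  have hd8 : 8 ≤ d := by
    by_contra h
    push Not at h
    have h1 : L ≤ d := Real.log_le_self (Nat.cast_nonneg d)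
    have h2 : (d : ℝ) ≤ 8 := by exact_mod_cast h.le
    linarith
  have hd' : (8 : ℝ) ≤ d := by exact_mod_cast hd8
  have hkd' : (k : ℝ) ≤ d := by exact_mod_cast hkd
  have hk' : (1 : ℝ) ≤ k := by exact_mod_cast hk
  have hn0 : (0 : ℝ) < n := lt_of_lt_of_le (mul_pos (by linarith)
    (pow_pos (by linarith) 5)) hkn
  have hsL : 4 * s * L ≤ c * L ^ 2 / 512 + 4 * L := by
    have h1 : (Nat.log M k : ℝ) * Real.log M ≤ L := by
      rw [← Real.log_pow]
      refine Real.log_le_log (by positivity) (le_trans ?_ hkd')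
      exact_mod_cast Nat.pow_log_le_self M (by omega)
    have h2 : 2048 * (Nat.log M k : ℝ) ≤ c * L := by
      calc 2048 * (Nat.log M k : ℝ) ≤ c * Real.log M * Nat.log M k := by gcongr
        _ = c * (Nat.log M k * Real.log M) := by ring
        _ ≤ c * L := by gcongr
    rw [hs]; push_cast
    nlinarith
  have heig : ∀ t, eigBound d n k s t ≤ Real.exp (c * L ^ 2 / 512 + (6 * t + 16) * L) := by
    intro t
    refine (eigBound_le hd8 hnd hkd s t).trans ?_
    rw [natCast_pow_eq_exp (by omega)]
    push_cast
    gcongr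
    linarith
  have hcL : 4096 * (7 * M + 32) * L ≤ c * L ^ 2 := by nlinarith
  have hML : 0 ≤ M * L := by positivity
  have hN : prob (designWeight (Fin n) p) (nearDependent p R Q) * eigBound d n k s 0 ≤
      Real.exp (-(4 * L)) := by
    have h1 := prob_nearDependent_le_exp hp hd8 hkd hc1 (by linarith) hkn (Nat.cast_pos.1 hn0) hQ hpQ hR
    refine (mul_le_mul h1 (heig 0) (eigBound_nonneg _ _ _ _ _) (Real.exp_pos _).le).trans ?_
    rw [← Real.exp_add]
    gcongr
    push_cast
    linarith
  have hT : ∀ t ∈ Finset.Icc 1 k, prob (designWeight (Fin n) p) (badSize R Q M t) *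
      eigBound d n k s t ≤ Real.exp (-(4 * L)) := by
    intro t ht
    obtain ⟨ht1, htk⟩ := Finset.mem_Icc.1 ht
    have ht' : (1 : ℝ) ≤ t := by exact_mod_cast ht1
    have h1 := prob_badSize_le_exp (M := M) hp hd8 hnd (by omega) hc hc1 (by linarith) hkn (by linarith)
      hpQ hR ht1 htk
    refine (mul_le_mul h1 (heig t) (eigBound_nonneg _ _ _ _ _) (Real.exp_pos _).le).trans ?_
    rw [← Real.exp_add]
    gcongr
    have h2 : c * L ^ 2 / 512 + (6 * t + 16) * L ≤ t * (c * L ^ 2 / 512 + 22 * L) := by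
      have : 0 ≤ (t - 1 : ℝ) * (c * L ^ 2 / 512 + 16 * L) :=
        mul_nonneg (by linarith) (by positivity)
      linarith
    have h3 : t * (7 * M * L - c * L ^ 2 / 16) + t * (c * L ^ 2 / 512 + 22 * L) =
        -(t * (c * L ^ 2 * (31 / 512) - (7 * M + 22) * L)) := by ring
    have h4 : 4 * L ≤ c * L ^ 2 * (31 / 512) - (7 * M + 22) * L := by linarith
    have h5 := mul_le_mul_of_nonneg_left h4 (by linarith : (0 : ℝ) ≤ t)
    have h6 : 4 * L ≤ t * (4 * L) := le_mul_of_one_le_left (by linarith) ht'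
    linarith
  have hexp : Real.exp (-(4 * L)) = 1 / (d : ℝ) ^ 4 := by
    rw [natCast_pow_eq_exp (by omega), one_div, ← Real.exp_neg]; norm_num; exact hLd
  calc _ ≤ (d : ℝ) * (Real.exp (-(4 * L)) + ∑ t ∈ Finset.Icc 1 k, Real.exp (-(4 * L))) := by
        gcongr with t ht
        exact hT t ht
    _ = (d : ℝ) * ((1 + k) * (1 / (d : ℝ) ^ 4)) := by
        rw [Finset.sum_const, Nat.card_Icc, hexp, Nat.add_sub_cancel, nsmul_eq_mul]; ring
    _ ≤ (d : ℝ) * ((d * d) * (1 / (d : ℝ) ^ 4)) := by gcongr; nlinarith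
    _ = 1 / d := by field_simp

end regime

/-! ### The loss bound for general frequencies -/

section loss

variable {d n k : ℕ} {p : Fin d → ℝ}

/-- The first `k` columns. -/
def commonCols (d k : ℕ) : Finset (Fin d) :=
  Finset.univ.filter fun j => (j : ℕ) < k

theorem card_commonCols (hkd : k ≤ d) : (commonCols d k).card = k := by
  have h : commonCols d k = Finset.univ.map (Fin.castLEEmb hkd) := by
    ext j
    simp only [commonCols, Finset.mem_filter, Finset.mem_univ, true_and, Finset.mem_map]
    exact ⟨fun h => ⟨⟨j, h⟩, rfl⟩, fun ⟨a, ha⟩ => ha ▸ a.2⟩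
  rw [h, Finset.card_map, Finset.card_univ, Fintype.card_fin]

theorem sum_compl_commonCols (p : Fin d → ℝ) (k : ℕ) :
    ∑ j ∈ (commonCols d k)ᶜ, p j = tailProb p k := by
  rw [tailProb, ← Finset.sum_filter]
  refine Finset.sum_congr ?_ fun _ _ => rfl
  ext j
  simp [commonCols]

theorem splice_lt_eq_mixCols (Z' Z : Fin n → Fin d → SignType) :
    splice (fun _ (j : Fin d) => (j : ℕ) < k) Z' Z = mixCols (commonCols d k) Z' Z := by
  ext i j
  simp [splice, mixCols, commonCols]

theorem tailProb_pos (hp : ∀ j, 0 < p j) (hk : k < d) : 0 < tailProb p k := by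
  rw [← sum_compl_commonCols]
  exact Finset.sum_pos (fun j _ => hp j) ⟨⟨k, hk⟩, by simp [commonCols]⟩

/-- The right hand side of the loss bound, up to a constant factor. -/
def lossRate (d n k : ℕ) (q σ : ℝ) : ℝ :=
  q + σ ^ 2 * (k * Real.log d / n +
    ((k : ℝ) ^ 2 * Real.log d ^ 2 / n + Real.log d) * q * Real.log d)

theorem le_lossRate {q σ : ℝ} (hL : 1 ≤ Real.log d) (hq : 0 ≤ q) :
    q + σ ^ 2 * (k * Real.log d / n + q) ≤ lossRate d n k q σ := by
  set L := Real.log d with hLd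
  have h1 : q ≤ (k ^ 2 * L ^ 2 / n + L) * q * L := by
    have h2 : 0 ≤ k ^ 2 * L ^ 2 / n := by positivity
    have h3 : 1 ≤ (k ^ 2 * L ^ 2 / n + L) * L := by nlinarith
    calc q ≤ q * ((k ^ 2 * L ^ 2 / n + L) * L) := le_mul_of_one_le_right hq h3
      _ = _ := by ring
  unfold lossRate
  gcongr

set_option maxHeartbeats 800000 in
theorem dataLaw_loss_ge {c A B σ : ℝ} {M : ℕ} (hp : ∀ j, 0 < p j ∧ p j ≤ 1) (hnd : n ≤ d)
    (hk : 1 ≤ k) (hkd : k < d) (hM : 2 ≤ M) (hc : 0 < c) (hc1 : c ≤ 1)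
    (hMc : 2048 ≤ c * Real.log M) (hL : 4096 * (7 * M + 32) ≤ c * Real.log d)
    (hA : 128 * (A + 4) ≤ c * Real.log d) (hkn : k * Real.log d ^ 5 ≤ n)
    (hpk : ∀ j : Fin d, (j : ℕ) < k → c * Real.log d ^ 2 / n ≤ p j)
    (hq : n * tailProb p k ^ 2 ≤ 1 / 1000) {βstar : Fin d → ℝ} (hβ : ∀ i, |βstar i| ≤ B)
    (hAσ : (d : ℝ) ^ (-A) ≤ tailProb p k + σ ^ 2) :
    ENNReal.ofReal 0.99 ≤ dataLaw n p σ
      {ω | commonAveragedLoss k p βstar ω ≤ (4 * B ^ 2 + 6800) * lossRate d n k (tailProb p k) σ} := by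
  set q := tailProb p k with hqd
  set L := Real.log d with hLd
  set Q := commonCols d k with hQd
  have hp' : ∀ j, 0 ≤ p j ∧ p j ≤ 1 := fun j => ⟨(hp j).1.le, (hp j).2⟩
  have hw := isWeight_design (Fin n) hp'
  have hQ : Q.card = k := card_commonCols hkd.le
  have hqQ : ∑ j ∈ Qᶜ, p j = q := sum_compl_commonCols p k
  have hq0 : 0 < q := tailProb_pos (fun j => (hp j).1) hkd
  have hpQ : ∀ j ∈ Q, c * L ^ 2 / n ≤ p j := fun j hj => hpk j (Finset.mem_filter.1 hj).2
  have hM' : (2 : ℝ) ≤ M := by exact_mod_cast hM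
  have hk' : (1 : ℝ) ≤ k := by exact_mod_cast hk
  have hL0 : 0 ≤ L := Real.log_natCast_nonneg d
  have hLbig : 4096 * (7 * M + 32) ≤ L := hL.trans (mul_le_of_le_one_left hL0 hc1)
  have hL1 : 4096 ≤ L := by linarith
  have hd0 : (0 : ℝ) < d := Nat.cast_pos.2 (by omega)
  have hd8 : 8 ≤ d := by
    have h1 : L ≤ d := Real.log_le_self (Nat.cast_nonneg d)
    have : (8 : ℝ) ≤ d := by linarith
    exact_mod_cast this
  have hn6 : 10 ^ 6 ≤ n := by
    have h1 : L ^ 2 ≤ L ^ 5 := pow_le_pow_right₀ (by linarith) (by norm_num)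
    have h2 : (10 : ℝ) ^ 6 ≤ n := by
      calc (10 : ℝ) ^ 6 ≤ 1 * L ^ 2 := by nlinarith
        _ ≤ k * L ^ 5 := by gcongr
        _ ≤ n := hkn
    exact_mod_cast h2
  have hn0 : (0 : ℝ) < n := Nat.cast_pos.2 (by omega)
  have hnd' : (n : ℝ) ≤ d := by exact_mod_cast hnd
  have hkn1 : 16 * (k : ℝ) / n ≤ 1 := by
    rw [div_le_one hn0]
    have h1 : L ≤ L ^ 5 := le_self_pow₀ (by linarith) (by norm_num)
    nlinarith
  set T := lossRate d n k q σ with hT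
  have hTq := le_lossRate (d := d) (n := n) (k := k) (σ := σ) (by linarith : 1 ≤ Real.log d) hq0.le
  rw [← hLd, ← hT] at hTq
  have hkL0 : 0 ≤ k * L / n := by positivity
  have hkn0 : 0 ≤ (k : ℝ) / n := by positivity
  have hknL : (k : ℝ) / n ≤ k * L / n := by gcongr; nlinarith
  have hσ0 := sq_nonneg σ
  have hT0 : 0 < T := lt_of_lt_of_le (by positivity) hTq
  have hqT : q ≤ T := le_trans (le_add_of_nonneg_right (by positivity)) hTq
  refine dataLaw_ge hp' σ _ _ (prob_rare_good (Q := Q) hp' hn6 (by rwa [hqQ])) ?_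
  rintro Z ⟨hZ, hR⟩
  have hbias := avg_bias_le hp (by omega) hβ hZ
  have hvar := avg_variance_le hp (by omega) (M := M) (s := Nat.log M k + 1) (by omega)
    (by rw [hQ]; exact Nat.lt_pow_succ_log_self (by omega) k) hZ
  have hbad := bad_terms_le hp' hnd hk hkd.le hM hc hc1 hMc hL hkn hQ hpQ hR
  rw [hQ, hqQ] at hvar
  rw [hqQ] at hbias
  have hW : avg (designWeight (Fin n) p) (fun Z' => ∑ j, p j *
      gramPinv (designMatrix (mixCols Q Z' Z)) j j) ≤ 17 * (k / n) + 2 * q := by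
    have h1 : 1 / (d : ℝ) ≤ k / n := by gcongr
    have h2 : q * (1 + 16 * k / n) ≤ q * 2 := by gcongr; linarith
    have h3 : 16 * (k : ℝ) / n = 16 * (k / n) := by ring
    linarith
  -- The lower bound d^{-A} on p_{>k} + σ² enters here: the rate is at least d^{-A-1}, and 128(A +
  -- 4) ≤ cL makes the bad-event bias smaller.
  have hnear : d * B ^ 2 * prob (designWeight (Fin n) p) (nearDependent p (pureRows Q Z) Q) ≤
      B ^ 2 * T := by
    have h1 := prob_nearDependent_le_exp hp' hd8 hkd.le hc1 (by linarith) hkn (by omega) hQ hpQ hR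
    have h2 : d * Real.exp (2 * Real.log d - c * Real.log d ^ 2 / 128) ≤ T := by
      have h3 : (d : ℝ) ^ (-A - 1) ≤ T := by
        rw [Real.rpow_sub_one hd0.ne']
        have h4 : 1 / (d : ℝ) ≤ k * L / n := by
          gcongr; nlinarith
        have h5 : 1 / (d : ℝ) ≤ 1 := by rw [div_le_one hd0]; exact_mod_cast (by omega : 1 ≤ d)
        have h6 : 0 ≤ 1 / (d : ℝ) := by positivity
        calc (d : ℝ) ^ (-A) / d = (d : ℝ) ^ (-A) * (1 / d) := by ring
          _ ≤ (q + σ ^ 2) * (1 / d) := by gcongr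
          _ = q * (1 / d) + σ ^ 2 * (1 / d) := by ring
          _ ≤ q * 1 + σ ^ 2 * (k * L / n + q) := by gcongr; linarith
          _ ≤ T := by linarith
      refine le_trans ?_ h3
      rw [Real.rpow_def_of_pos hd0]
      nth_rw 1 [← Real.exp_log hd0]
      rw [← Real.exp_add]
      gcongr
      rw [← hLd]
      have h7 := mul_le_mul_of_nonneg_right hA hL0
      linarith
    calc d * B ^ 2 * prob (designWeight (Fin n) p) (nearDependent p (pureRows Q Z) Q)
        ≤ d * B ^ 2 * Real.exp (2 * Real.log d - c * Real.log d ^ 2 / 128) := by gcongr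
      _ = B ^ 2 * (d * Real.exp (2 * Real.log d - c * Real.log d ^ 2 / 128)) := by ring
      _ ≤ B ^ 2 * T := by gcongr
  -- 3400 = 200 · 17, from Markov at level 1/200 and the variance bound 17k/n + 2q. Doubling in the
  -- bias-noise split gives the final 6800, and twice the two bias terms give 4B².
  refine (noiseLaw_markov hp' σ (fun Z' => designMatrix (mixCols Q Z' Z)) (τ := 3400 * T)
    (by positivity) hW ?_).trans (measure_mono fun ξ hξ => ?_)
  · have h1 : σ ^ 2 * (k / n + q) ≤ σ ^ 2 * (k * L / n + q) := by gcongr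
    have h2 := mul_nonneg hσ0 hq0.le
    linarith
  · have h1 := commonAveragedLoss_le hp' k βstar Z ξ
    simp only [splice_lt_eq_mixCols] at h1
    have h2 : B ^ 2 * q ≤ B ^ 2 * T := by gcongr
    have h3 : avg (designWeight (Fin n) p) (fun Z' => ∑ j, p j *
      noiseVec (designMatrix (mixCols Q Z' Z)) ξ j ^ 2) ≤ 3400 * T := hξ
    change commonAveragedLoss k p βstar _ ≤ _
    linarith

/-- The loss bound for general frequencies in the size regime. -/
theorem exists_lossRate_bound {c₁ A B : ℝ} (hc₁ : 0 < c₁) :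
    ∃ d₀ : ℕ, ∀ (d n k : ℕ) (_ : 1 ≤ k) (hkd : k - 1 < d) (p βstar : Fin d → ℝ)
      (σ : ℝ), d₀ ≤ d → SizeRegime 5 d n k → IsFeatureFrequency p → (∀ i, |βstar i| ≤ B) →
      c₁ * Real.log d ^ 2 ≤ n * p ⟨k - 1, hkd⟩ →
      n * tailProb p k ^ 2 ≤ 1 / 1000 → (d : ℝ) ^ (-A) ≤ tailProb p k + σ ^ 2 →
      ENNReal.ofReal 0.99 ≤ dataLaw n p σ
        {ω | commonAveragedLoss k p βstar ω ≤
          (4 * B ^ 2 + 6800) * lossRate d n k (tailProb p k) σ} := by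
  set c := min c₁ 1 with hc
  have hc0 : 0 < c := lt_min hc₁ one_pos
  -- `M` depends on c₁ only; it is fixed before `d₀`, which must beat it.
  obtain ⟨M, hM⟩ := exists_nat_ge (max 2 (Real.exp (2048 / c)))
  have hM2 : 2 ≤ M := by exact_mod_cast (le_max_left _ _).trans hM
  have hMc : 2048 ≤ c * Real.log M := by
    have h1 : 2048 / c ≤ Real.log M := by
      rw [Real.le_log_iff_exp_le (Nat.cast_pos.2 (by omega))]
      exact (le_max_right _ _).trans hM
    rwa [div_le_iff₀' hc0] at h1
  obtain ⟨d₀, hd₀⟩ := exists_nat_ge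
    (Real.exp (max (4096 * (7 * M + 32) / c) (128 * (A + 4) / c)))
  refine ⟨d₀, fun d n k hk hkd p βstar σ hd hreg hp hβ hpk hq hA => ?_⟩
  have hL : max (4096 * (7 * M + 32) / c) (128 * (A + 4) / c) ≤ Real.log d := by
    rw [Real.le_log_iff_exp_le (Nat.cast_pos.2 (by omega))]
    exact hd₀.trans (by exact_mod_cast hd)
  have hL1 := (le_max_left _ _).trans hL
  have hL2 := (le_max_right _ _).trans hL
  rw [div_le_iff₀' hc0] at hL1 hL2
  have hM0 : (0 : ℝ) ≤ M := Nat.cast_nonneg M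
  have hlog : 4096 * (7 * M + 32) ≤ Real.log d :=
    hL1.trans (mul_le_of_le_one_left (Real.log_natCast_nonneg d) (min_le_right _ _))
  set L := Real.log d with hLd
  have hLpos : 0 < L := by linarith
  have hL5 : 1 ≤ L ^ 5 := one_le_pow₀ (by linarith)
  obtain ⟨hr1, hr2, hr3⟩ := hreg
  rw [← hLd] at hr1 hr2 hr3
  rw [lt_div_iff₀ (by positivity)] at hr2
  have hr4 : (n : ℝ) < d / L ^ 5 := by
    rw [div_lt_div_iff₀ (by positivity) (by positivity)] at hr3
    rw [lt_div_iff₀ (by positivity)]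
    nlinarith
  have hnd : (n : ℝ) < d := hr4.trans_le (div_le_self (Nat.cast_nonneg d) hL5)
  have hkn : (k : ℝ) < n := lt_of_le_of_lt (le_mul_of_one_le_right (Nat.cast_nonneg k) hL5) hr2
  have hn0 : (0 : ℝ) < n := lt_of_le_of_lt (Nat.cast_nonneg k) hkn
  refine dataLaw_loss_ge hp.2 (by exact_mod_cast hnd.le) hk (by exact_mod_cast hkn.trans hnd) hM2
    hc0 (min_le_right _ _) hMc hL1 hL2 hr2.le (fun j hj => ?_) hq hβ hA
  have h1 : p ⟨k - 1, hkd⟩ ≤ p j := hp.1 (Fin.le_def.2 (by simp; omega))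
  rw [div_le_iff₀' hn0]
  calc c * Real.log d ^ 2 ≤ c₁ * Real.log d ^ 2 := by gcongr; exact min_le_left _ _
    _ ≤ n * p ⟨k - 1, hkd⟩ := hpk
    _ ≤ n * p j := by gcongr

end loss

/-! ### Power-law frequencies -/

section powerLaw

variable {d n k : ℕ} {α s : ℝ}

theorem sum_range_inv_sq_tail_le (hk : 1 ≤ k) (d : ℕ) :
    ∑ i ∈ Finset.range d, (if k ≤ i then ((i : ℝ) + 1) ^ (-2 : ℝ) else 0) ≤ 1 / k := by
  have hk' : (0 : ℝ) < k := Nat.cast_pos.2 (by omega)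
  rcases lt_or_ge d k with h | h
  · rw [Finset.sum_eq_zero fun i hi => if_neg (by have := Finset.mem_range.1 hi; omega)]
    positivity
  · have key : ∑ i ∈ Finset.range d, (if k ≤ i then ((i : ℝ) + 1) ^ (-2 : ℝ) else 0) ≤
        1 / k - 1 / d := by
      induction d, h using Nat.le_induction with
      | base =>
        rw [Finset.sum_eq_zero fun i hi => if_neg (by have := Finset.mem_range.1 hi; omega)]
        simp
      | succ m hm ih =>
        rw [Finset.sum_range_succ, if_pos hm]
        have hm' : (0 : ℝ) < m := Nat.cast_pos.2 (by omega)
        -- Telescoping comparison with 1/(m(m + 1)).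
        have h1 : ((m : ℝ) + 1) ^ (-2 : ℝ) ≤ 1 / m - 1 / (m + 1) := by
          rw [Real.rpow_neg (by positivity), div_sub_div _ _ hm'.ne' (by positivity), ← one_div,
            div_le_div_iff₀ (by positivity) (by positivity)]
          norm_num
          nlinarith
        push_cast
        linarith
    have : (0 : ℝ) ≤ 1 / d := by positivity
    linarith

theorem sum_rpow_tail_le (hα : 2 ≤ α) (hk : 1 ≤ k) (d : ℕ) :
    ∑ i : Fin d, (if k ≤ (i : ℕ) then ((i : ℝ) + 1) ^ (-α) else 0) ≤ (k : ℝ) ^ (1 - α) := by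
  have hk' : (0 : ℝ) < k := Nat.cast_pos.2 (by omega)
  rw [Fin.sum_univ_eq_sum_range (fun i => if k ≤ i then ((i : ℝ) + 1) ^ (-α) else 0) d]
  calc ∑ i ∈ Finset.range d, (if k ≤ i then ((i : ℝ) + 1) ^ (-α) else 0)
      ≤ ∑ i ∈ Finset.range d,
          (k : ℝ) ^ (2 - α) * (if k ≤ i then ((i : ℝ) + 1) ^ (-2 : ℝ) else 0) := by
        refine Finset.sum_le_sum fun i _ => ?_
        split_ifs with h
        · have hi : (k : ℝ) ≤ (i : ℝ) + 1 := by
            have : (k : ℝ) ≤ i := by exact_mod_cast h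
            linarith
          have h1 : ((i : ℝ) + 1) ^ (-α) = ((i : ℝ) + 1) ^ (2 - α) * ((i : ℝ) + 1) ^ (-2 : ℝ) := by
            rw [← Real.rpow_add (by positivity)]; congr 1; ring
          rw [h1]
          gcongr ?_ * _
          exact Real.rpow_le_rpow_of_nonpos hk' hi (by linarith)
        · simp
    _ ≤ (k : ℝ) ^ (2 - α) * (1 / k) := by
        rw [← Finset.mul_sum]
        gcongr
        exact sum_range_inv_sq_tail_le hk d
    _ = (k : ℝ) ^ (1 - α) := by
        rw [mul_one_div, ← Real.rpow_sub_one hk'.ne']; congr 1; ring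

theorem one_le_sum_rpow (α : ℝ) (hd : 1 ≤ d) : 1 ≤ ∑ j : Fin d, ((j : ℝ) + 1) ^ (-α) := by
  have h := Finset.single_le_sum (f := fun j : Fin d => ((j : ℝ) + 1) ^ (-α))
    (fun j _ => by positivity) (Finset.mem_univ ⟨0, hd⟩)
  simpa using h

theorem sum_rpow_le_two (hα : 2 ≤ α) (d : ℕ) : ∑ j : Fin d, ((j : ℝ) + 1) ^ (-α) ≤ 2 := by
  cases d with
  | zero => simp
  | succ m =>
    have h := sum_rpow_tail_le hα le_rfl (m + 1)
    rw [Fin.sum_univ_succ] at h ⊢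
    simp at h ⊢
    linarith

theorem powerLawFreq_isFeatureFrequency (hα : 0 ≤ α) (hs : 0 < s) :
    IsFeatureFrequency (powerLawFreq d α s) := by
  have hZ : ∀ _ : Fin d, 0 < ∑ j : Fin d, ((j : ℝ) + 1) ^ (-α) := fun i =>
    lt_of_lt_of_le one_pos (one_le_sum_rpow α (by have := i.2; omega))
  refine ⟨fun i j hij => ?_, fun i => ⟨?_, min_le_left _ _⟩⟩
  · refine min_le_min le_rfl ?_
    have := hZ i
    have hij' : (i : ℝ) ≤ j := by exact_mod_cast hij
    gcongr ?_ / _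
    exact mul_le_mul_of_nonneg_left
      (Real.rpow_le_rpow_of_nonpos (by positivity) (by linarith) (by linarith)) hs.le
  · exact lt_min one_pos (div_pos (mul_pos hs (by positivity)) (hZ i))

theorem tailProb_powerLawFreq_le (hα : 2 ≤ α) (hs : 0 < s) (hk : 1 ≤ k) :
    tailProb (powerLawFreq d α s) k ≤ s * (k : ℝ) ^ (1 - α) := by
  refine le_trans ?_ (mul_le_mul_of_nonneg_left (sum_rpow_tail_le hα hk d) hs.le)
  rw [tailProb, Finset.mul_sum]
  refine Finset.sum_le_sum fun i _ => ?_
  rw [mul_ite, mul_zero]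
  split_ifs
  · exact (min_le_right _ _).trans (div_le_self (by positivity)
      (one_le_sum_rpow α (by have := i.2; omega)))
  · exact le_rfl

/-- Keep only the first tail term, of index k + 1 ≤ 2k when counting from 1. It supplies the
polynomial lower bound that the general theorem asks for. -/
theorem le_tailProb_powerLawFreq (hα : 2 ≤ α) (hs : 0 < s) (hk : 1 ≤ k) (hkd : k < d) (hkd' : k - 1 < d) :
    2 ^ (-α) * powerLawFreq d α s ⟨k - 1, hkd'⟩ ≤ tailProb (powerLawFreq d α s) k := by
  have hfreq := powerLawFreq_isFeatureFrequency (d := d) (by linarith : 0 ≤ α) hs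
  have h1 : powerLawFreq d α s ⟨k, hkd⟩ ≤ tailProb (powerLawFreq d α s) k := by
    have h := Finset.single_le_sum
      (f := fun i : Fin d => if k ≤ (i : ℕ) then powerLawFreq d α s i else 0)
      (fun i _ => by split_ifs; exacts [(hfreq.2 i).1.le, le_rfl])
      (Finset.mem_univ ⟨k, hkd⟩)
    simpa [tailProb] using h
  refine le_trans ?_ h1
  have hZ : 0 < ∑ j : Fin d, ((j : ℝ) + 1) ^ (-α) :=
    lt_of_lt_of_le one_pos (one_le_sum_rpow α (by omega))
  have hk' : (1 : ℝ) ≤ k := by exact_mod_cast hk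
  have h2 : (2 : ℝ) ^ (-α) ≤ 1 := Real.rpow_le_one_of_one_le_of_nonpos (by norm_num) (by linarith)
  have hcast : ((k - 1 : ℕ) : ℝ) + 1 = k := by
    rw [Nat.cast_sub hk]; simp
  unfold powerLawFreq
  refine le_min (mul_le_one₀ h2 (le_min zero_le_one (by positivity)) (min_le_left _ _)) ?_
  refine (mul_le_mul_of_nonneg_left (min_le_right _ _) (by positivity)).trans ?_
  rw [mul_div_assoc']
  gcongr ?_ / _
  simp only [hcast]
  have h3 : (2 : ℝ) ^ (-α) * (k : ℝ) ^ (-α) ≤ ((k : ℝ) + 1) ^ (-α) := by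
    rw [← Real.mul_rpow (by norm_num) (by positivity)]
    exact Real.rpow_le_rpow_of_nonpos (by positivity) (by linarith) (by linarith)
  calc (2 : ℝ) ^ (-α) * (s * (k : ℝ) ^ (-α)) = s * ((2 : ℝ) ^ (-α) * (k : ℝ) ^ (-α)) := by ring
    _ ≤ s * ((k : ℝ) + 1) ^ (-α) := by gcongr

/-- Size of `k` when the `k`-th frequency is of order `ln² d / n`. -/
theorem powerLaw_size {L c₁ c₂ : ℝ} (hα : 2 ≤ α) (hs : 0 < s) (hk : 1 ≤ k) (hkd : k - 1 < d)
    (hc2 : c₂ * L ^ 2 < n)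
    (h1 : c₁ * L ^ 2 ≤ n * powerLawFreq d α s ⟨k - 1, hkd⟩)
    (h2 : n * powerLawFreq d α s ⟨k - 1, hkd⟩ ≤ c₂ * L ^ 2) :
    c₁ * L ^ 2 * (k : ℝ) ^ α ≤ n * s ∧ n * s ≤ 2 * c₂ * L ^ 2 * (k : ℝ) ^ α := by
  have hZ1 := one_le_sum_rpow (d := d) α (by omega)
  have hZ2 := sum_rpow_le_two hα d
  have hk' : (0 : ℝ) < k := by exact_mod_cast hk
  have hcast : ((k - 1 : ℕ) : ℝ) + 1 = k := by
    rw [Nat.cast_sub hk]; simp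
  have hval : powerLawFreq d α s ⟨k - 1, hkd⟩ =
      s * (k : ℝ) ^ (-α) / ∑ j : Fin d, ((j : ℝ) + 1) ^ (-α) := by
    unfold powerLawFreq at h2 ⊢
    simp only [hcast] at h2 ⊢
    -- The cap at 1 is inactive: otherwise n ≤ c₂L², against `hc2`.
    refine min_eq_right (le_of_not_gt fun h => ?_)
    rw [min_eq_left h.le] at h2
    linarith
  rw [hval] at h1 h2
  set Z := ∑ j : Fin d, ((j : ℝ) + 1) ^ (-α)
  have hZ0 : 0 < Z := by linarith
  have hkα : 0 < (k : ℝ) ^ α := by positivity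
  have hinv : (k : ℝ) ^ (-α) = ((k : ℝ) ^ α)⁻¹ := Real.rpow_neg hk'.le α
  have heq : n * (s * (k : ℝ) ^ (-α) / Z) = n * s / ((k : ℝ) ^ α * Z) := by
    rw [hinv]; field_simp
  rw [heq] at h1 h2
  rw [le_div_iff₀ (by positivity)] at h1
  rw [div_le_iff₀ (by positivity)] at h2
  have hns : 0 ≤ n * s := by positivity
  constructor
  · by_contra hcon
    push Not at hcon
    have h3 : n * s < c₁ * L ^ 2 * (k : ℝ) ^ α * 1 := by linarith
    have h4 : c₁ * L ^ 2 * (k : ℝ) ^ α * 1 ≤ c₁ * L ^ 2 * (k : ℝ) ^ α * Z :=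
      mul_le_mul_of_nonneg_left hZ1 (by linarith)
    linarith
  · have h5 : 0 ≤ c₂ * L ^ 2 * (k : ℝ) ^ α := by
      by_contra hcon
      push Not at hcon
      have := mul_neg_of_neg_of_pos hcon hZ0
      linarith
    nlinarith

end powerLaw

/-- Upper bound for the number of common features. -/
theorem sq_le_of_powerLaw_size {α s c₁ L η N κ : ℝ} (hα : 2 ≤ α) (hκ : 0 < κ) (hc₁ : 0 < c₁)
    (hL : 1 ≤ L) (hN : 1 ≤ N) (hη : 0 ≤ η) (hs : s ≤ N ^ η) (h : c₁ * L ^ 2 * κ ^ α ≤ N * s) :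
    κ ^ 2 ≤ c₁ ^ (-(2 / α)) * N ^ (2 / α + η) := by
  have hN0 : 0 < N := by linarith
  have h1 : κ ^ α ≤ c₁⁻¹ * N ^ (1 + η) := by
    have h2 : c₁ * κ ^ α ≤ c₁ * L ^ 2 * κ ^ α := by
      have : 1 ≤ L ^ 2 := one_le_pow₀ hL
      have h3 : 0 ≤ κ ^ α := by positivity
      have := mul_le_mul_of_nonneg_left this (mul_nonneg hc₁.le h3)
      linarith
    have h4 : N * s ≤ N ^ (1 + η) := by
      rw [Real.rpow_add hN0, Real.rpow_one]; gcongr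
    rw [inv_mul_eq_div, le_div_iff₀' hc₁]
    linarith
  have h5 : κ ^ 2 = (κ ^ α) ^ (2 / α) := by
    rw [← Real.rpow_mul hκ.le, mul_div_cancel₀ _ (by linarith : α ≠ 0)]; norm_num
  rw [h5]
  have h6 : 2 / α ≤ 1 := by rw [div_le_one (by linarith)]; exact hα
  have h7 : 0 ≤ 2 / α := by positivity
  calc (κ ^ α) ^ (2 / α) ≤ (c₁⁻¹ * N ^ (1 + η)) ^ (2 / α) := by gcongr
    _ = c₁ ^ (-(2 / α)) * N ^ ((1 + η) * (2 / α)) := by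
        rw [Real.mul_rpow (by positivity) (by positivity), ← Real.rpow_mul hN0.le,
          Real.inv_rpow hc₁.le, Real.rpow_neg hc₁.le]
    _ ≤ c₁ ^ (-(2 / α)) * N ^ (2 / α + η) := by
        gcongr
        nlinarith

/-- The tail bound in terms of the effective rate. -/
theorem rpow_tail_le_rate {α s c₂ L N κ : ℝ} (hα : 2 ≤ α) (hκ : 0 < κ) (hc₂ : 0 < c₂) (hL : 0 < L)
    (hN : 0 < N) (hs : 0 < s) (h : N * s ≤ 2 * c₂ * L ^ 2 * κ ^ α) :
    κ ^ (1 - α) ≤ (2 * c₂) ^ (1 - 1 / α) * (L ^ 2 / (N * s)) ^ (1 - 1 / α) := by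
  have hα0 : 0 < α := by linarith
  have h1 : (κ ^ α)⁻¹ ≤ 2 * c₂ * (L ^ 2 / (N * s)) := by
    rw [mul_div_assoc', le_div_iff₀ (by positivity), inv_mul_le_iff₀ (by positivity)]
    linarith
  have h2 : κ ^ (1 - α) = ((κ ^ α)⁻¹) ^ (1 - 1 / α) := by
    rw [← Real.rpow_neg hκ.le, ← Real.rpow_mul hκ.le]
    congr 1; field_simp; ring
  have h3 : 0 ≤ 1 - 1 / α := by
    rw [sub_nonneg, div_le_one hα0]; linarith
  rw [h2, ← Real.mul_rpow (by positivity) (by positivity)]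
  gcongr

set_option maxHeartbeats 2000000 in
/-- The bound for power-law frequencies. -/
theorem exists_powerLaw_bound {α c₁ c₂ B : ℝ} (hα : 2 < α) (hc₁ : 0 < c₁) (hc₁₂ : c₁ ≤ c₂) :
    ∃ η : ℝ, 0 < η ∧ ∃ C : ℝ, 0 < C ∧ ∃ d₀ : ℕ,
      ∀ (d n k : ℕ) (_ : 1 ≤ k) (hkd : k - 1 < d) (s : ℝ) (βstar : Fin d → ℝ) (σ : ℝ),
        d₀ ≤ d → SizeRegime 5 d n k →
        0 < s → s + Real.log d < (n : ℝ) ^ η →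
        (∀ i, |βstar i| ≤ B) →
        c₁ * Real.log d ^ 2 ≤ n * powerLawFreq d α s ⟨k - 1, hkd⟩ →
        n * powerLawFreq d α s ⟨k - 1, hkd⟩ ≤ c₂ * Real.log d ^ 2 →
        ENNReal.ofReal 0.99 ≤ dataLaw n (powerLawFreq d α s) σ
          {ω | commonAveragedLoss k (powerLawFreq d α s) βstar ω ≤
            C * (s * (Real.log d ^ 2 / (n * s)) ^ (1 - 1 / α) +
              σ ^ 2 * (Real.log d ^ 2 / (n * s)) ^ (1 - 1 / α) * s * Real.log d ^ 5)} := by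
  have hc₂ : 0 < c₂ := hc₁.trans_le hc₁₂
  obtain ⟨d₁, hd₁⟩ := exists_lossRate_bound (A := 2) (B := B) hc₁
  set θ := 1 - 2 / α with hθ
  have hα0 : 0 < α := by linarith
  have h2α0 : 0 < 2 / α := by positivity
  have hθ0 : 0 < θ := by
    rw [hθ, sub_pos, div_lt_one hα0]; exact hα
  set E := c₁ ^ (-(2 / α)) with hE
  have hE0 : 0 < E := Real.rpow_pos_of_pos hc₁ _
  set C₃ := (2 * c₂) ^ (1 - 1 / α) with hC₃
  have hC₃0 : 0 < C₃ := Real.rpow_pos_of_pos (by positivity) _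
  -- The three terms give, in this order, the lower bound d⁻² for the tail, c₂L² < n, and n^{θ/2} ≥
  -- 4000 c₂²E, where θ = 1 - 2/α.
  obtain ⟨d₂, hd₂⟩ := exists_nat_ge (max (2 ^ α / c₁) (Real.exp (max (1 + c₂)
    ((4000 * c₂ ^ 2 * E) ^ (2 / θ)))))
  -- In n p_{>k}² ≤ 4c₂²L⁴k²/n, the factor L⁴ uses exponent 4θ/10 and k² uses 2/α + θ/10. This
  -- leaves n^{θ/2} to absorb the constants.
  refine ⟨θ / 10, by positivity, (4 * B ^ 2 + 6800) * ((1 / c₁ + E + 2) * C₃), by positivity,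
    max d₁ d₂, fun d n k hk hkd s βstar σ hd hreg hs hsn hβ h1 h2 => ?_⟩
  have hdd₂ : (d₂ : ℝ) ≤ d := by exact_mod_cast (le_max_right _ _).trans hd
  set p := powerLawFreq d α s with hp
  have hd0 : (0 : ℝ) < d := by
    have : 1 ≤ d := by omega
    exact_mod_cast this
  have hlog := (Real.le_log_iff_exp_le hd0).2 (((le_max_right _ _).trans hd₂).trans hdd₂)
  obtain ⟨hr1, hr2, hr3⟩ := id hreg
  set L := Real.log d with hL
  have hLc : 1 + c₂ ≤ L := (le_max_left _ _).trans hlog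
  have hLE := (le_max_right _ _).trans hlog
  have hL1 : 1 ≤ L := by linarith
  have hL0 : 0 < L := by linarith
  have hL5 : 1 ≤ L ^ 5 := one_le_pow₀ hL1
  rw [lt_div_iff₀ (by positivity)] at hr2
  have hk1 : (1 : ℝ) ≤ k := by exact_mod_cast hk
  have hk0 : (0 : ℝ) < k := by linarith
  have hkn : (k : ℝ) < n := lt_of_le_of_lt (le_mul_of_one_le_right hk0.le hL5) hr2
  have hn1 : (1 : ℝ) ≤ n := hk1.trans hkn.le
  have hn0 : (0 : ℝ) < n := by linarith
  have hL5n : L ^ 5 < n := lt_of_le_of_lt (le_mul_of_one_le_left (by linarith) hk1) hr2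
  have hnd : (n : ℝ) < d := by
    rw [div_lt_div_iff₀ (by positivity) (by positivity)] at hr3
    have h3 : (n : ℝ) * L ^ 5 < d := by
      have h4 : (n : ℝ) * L ^ 5 * L ^ 5 < d * L ^ 5 := by linarith
      exact lt_of_mul_lt_mul_right h4 (by positivity)
    exact lt_of_le_of_lt (le_mul_of_one_le_right hn0.le hL5) h3
  have hkd' : k < d := by exact_mod_cast hkn.trans hnd
  have hc2n : c₂ * L ^ 2 < n := by
    have h3 : L ^ 3 ≤ L ^ 5 := pow_le_pow_right₀ hL1 (by norm_num)
    have h4 : c₂ * L ^ 2 ≤ L * L ^ 2 := by gcongr; linarith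
    linarith [pow_succ' L 2]
  obtain ⟨hsize1, hsize2⟩ := powerLaw_size hα.le hs hk hkd hc2n h1 h2
  have hnη : 1 ≤ (n : ℝ) ^ (θ / 10) := Real.one_le_rpow hn1 (by positivity)
  have hsq := sq_le_of_powerLaw_size hα.le hk0 hc₁ hL1 hn1 (by positivity : 0 ≤ θ / 10)
    (by linarith : s ≤ (n : ℝ) ^ (θ / 10)) hsize1
  have htail : tailProb p k ≤ s * (k : ℝ) ^ (1 - α) := tailProb_powerLawFreq_le hα.le hs hk
  set V := s * (k : ℝ) ^ (1 - α) with hV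
  have hkα : 0 < (k : ℝ) ^ α := by positivity
  have hVeq : V = s * k / (k : ℝ) ^ α := by
    rw [hV, Real.rpow_sub hk0, Real.rpow_one]; ring
  have hV0 : 0 < V := by positivity
  have hVn : V ≤ 2 * c₂ * L ^ 2 * k / n := by
    rw [hVeq, div_le_div_iff₀ hkα hn0]
    calc s * k * n = n * s * k := by ring
      _ ≤ 2 * c₂ * L ^ 2 * (k : ℝ) ^ α * k := by gcongr
      _ = _ := by ring
  have hnV : c₁ * L ^ 2 * (k / n) ≤ V := by
    rw [hVeq, mul_div_assoc', div_le_div_iff₀ hn0 hkα]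
    calc c₁ * L ^ 2 * k * (k : ℝ) ^ α = c₁ * L ^ 2 * (k : ℝ) ^ α * k := by ring
      _ ≤ n * s * k := by gcongr
      _ = _ := by ring
  have hq0 : 0 < tailProb p k :=
    tailProb_pos (fun j => ((powerLawFreq_isFeatureFrequency hα0.le hs).2 j).1) hkd'
  have hkk : (k : ℝ) ^ 2 / n ≤ E := by
    rw [div_le_iff₀ hn0]
    refine hsq.trans ?_
    gcongr
    nth_rw 2 [← Real.rpow_one (n : ℝ)]
    exact Real.rpow_le_rpow_of_exponent_le hn1 (by linarith)
  have hnq : n * tailProb p k ^ 2 ≤ 1 / 1000 := by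
    have hL4 : L ^ 4 ≤ (n : ℝ) ^ (4 * (θ / 10)) := by
      have h3 : L ≤ (n : ℝ) ^ (θ / 10) := by linarith
      calc L ^ 4 ≤ ((n : ℝ) ^ (θ / 10)) ^ 4 := by gcongr
        _ = (n : ℝ) ^ (4 * (θ / 10)) := by
          rw [← Real.rpow_mul_natCast hn0.le]; congr 1; push_cast; ring
    have hnE : 4000 * c₂ ^ 2 * E ≤ (n : ℝ) ^ (θ / 2) := by
      have h3 : (4000 * c₂ ^ 2 * E) ^ (2 / θ) ≤ n := by
        have h4 : L ≤ L ^ 5 := le_self_pow₀ hL1 (by norm_num)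
        linarith
      have h4 := Real.rpow_le_rpow (by positivity) h3 (by positivity : 0 ≤ θ / 2)
      rwa [← Real.rpow_mul (by positivity), show 2 / θ * (θ / 2) = 1 by field_simp,
        Real.rpow_one] at h4
    have h5 : n * tailProb p k ^ 2 ≤ 4 * c₂ ^ 2 * L ^ 4 * (k : ℝ) ^ 2 / n := by
      calc n * tailProb p k ^ 2 ≤ n * (2 * c₂ * L ^ 2 * k / n) ^ 2 := by
            gcongr; exact htail.trans hVn
        _ = _ := by field_simp; ring
    refine h5.trans ?_
    rw [div_le_iff₀ hn0]
    have h6 : (n : ℝ) ^ (4 * (θ / 10)) * (n : ℝ) ^ (2 / α + θ / 10) * (n : ℝ) ^ (θ / 2) = n := by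
      rw [← Real.rpow_add hn0, ← Real.rpow_add hn0]
      nth_rw 2 [← Real.rpow_one (n : ℝ)]
      congr 1; rw [hθ]; ring
    have h7 : 4 * c₂ ^ 2 * L ^ 4 * (k : ℝ) ^ 2 ≤
        4 * c₂ ^ 2 * (n : ℝ) ^ (4 * (θ / 10)) * (E * (n : ℝ) ^ (2 / α + θ / 10)) := by gcongr
    have h8 := mul_le_mul_of_nonneg_left hnE
      (by positivity : 0 ≤ (n : ℝ) ^ (4 * (θ / 10)) * (n : ℝ) ^ (2 / α + θ / 10))
    rw [h6] at h8
    linarith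
  have hA : (d : ℝ) ^ (-2 : ℝ) ≤ tailProb p k + σ ^ 2 := by
    have h3 := le_tailProb_powerLawFreq hα.le hs hk hkd' hkd
    have h4 : c₁ / d ≤ p ⟨k - 1, hkd⟩ := by
      rw [div_le_iff₀ hd0]
      have h5 : c₁ ≤ c₁ * L ^ 2 := le_mul_of_one_le_right hc₁.le (one_le_pow₀ hL1)
      have h6 : 0 ≤ p ⟨k - 1, hkd⟩ :=
        ((powerLawFreq_isFeatureFrequency hα0.le hs).2 _).1.le
      have h7 := mul_le_mul_of_nonneg_right hnd.le h6
      linarith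
    have h5 : 2 ^ α / c₁ ≤ d := ((le_max_left _ _).trans hd₂).trans hdd₂
    have h6 : (d : ℝ) ^ (-2 : ℝ) ≤ 2 ^ (-α) * (c₁ / d) := by
      rw [Real.rpow_neg hd0.le, Real.rpow_neg (by norm_num), inv_mul_eq_div, div_div,
        le_div_iff₀ (by positivity), inv_mul_le_iff₀ (by positivity)]
      rw [div_le_iff₀ hc₁] at h5
      have h7 := mul_le_mul_of_nonneg_left h5 hd0.le
      norm_num
      linarith
    have h7 : 2 ^ (-α) * (c₁ / d) ≤ 2 ^ (-α) * p ⟨k - 1, hkd⟩ := by gcongr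
    have := sq_nonneg σ
    linarith
  refine (hd₁ d n k hk hkd p βstar σ ((le_max_left _ _).trans hd) hreg
    (powerLawFreq_isFeatureFrequency hα0.le hs) hβ h1 hnq hA).trans (measure_mono fun ω hω => ?_)
  refine le_trans (b := (4 * B ^ 2 + 6800) * lossRate d n k (tailProb p k) σ) hω ?_
  rw [mul_assoc (4 * B ^ 2 + 6800)]
  gcongr
  set U := (L ^ 2 / (n * s)) ^ (1 - 1 / α) with hU
  have hVU : V ≤ C₃ * (s * U) := by
    have h3 := rpow_tail_le_rate hα.le hk0 hc₂ hL0 hn0 hs hsize2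
    calc V ≤ s * (C₃ * U) := by rw [hV]; gcongr
      _ = _ := by ring
  -- c₁L²k/n ≤ V converts the variance k/n of the common part into the tail bound V; since k²/n ≤ E,
  -- the last variance term is of the same form.
  have hkL : k * L / n ≤ V * L ^ 5 / c₁ := by
    rw [le_div_iff₀ hc₁]
    have h3 : L ≤ L ^ 2 * L ^ 5 := by
      rw [← pow_add]; exact le_self_pow₀ hL1 (by norm_num)
    calc k * L / n * c₁ = c₁ * (k / n) * L := by ring
      _ ≤ c₁ * (k / n) * (L ^ 2 * L ^ 5) := by gcongr
      _ = c₁ * L ^ 2 * (k / n) * L ^ 5 := by ring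
      _ ≤ V * L ^ 5 := by gcongr
  have hlast : ((k : ℝ) ^ 2 * L ^ 2 / n + L) * tailProb p k * L ≤ (E + 1) * (V * L ^ 5) := by
    have h3 : L ≤ L ^ 2 := le_self_pow₀ hL1 (by norm_num)
    have h4 : L ^ 3 ≤ L ^ 5 := pow_le_pow_right₀ hL1 (by norm_num)
    calc ((k : ℝ) ^ 2 * L ^ 2 / n + L) * tailProb p k * L
        = ((k : ℝ) ^ 2 / n * L ^ 2 + L) * tailProb p k * L := by ring
      _ ≤ (E * L ^ 2 + L ^ 2) * V * L := by gcongr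
      _ = (E + 1) * (V * L ^ 3) := by ring
      _ ≤ (E + 1) * (V * L ^ 5) := by gcongr
  have hc₁' : 0 < 1 / c₁ := by positivity
  calc lossRate d n k (tailProb p k) σ
      ≤ V + σ ^ 2 * (V * L ^ 5 / c₁ + (E + 1) * (V * L ^ 5)) := by
        unfold lossRate; gcongr
    _ = V + (1 / c₁ + E + 1) * (σ ^ 2 * V * L ^ 5) := by ring
    _ ≤ (1 / c₁ + E + 2) * (V + σ ^ 2 * V * L ^ 5) := by
        have h3 : 0 ≤ σ ^ 2 * V * L ^ 5 := by positivity
        nlinarith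
    _ ≤ (1 / c₁ + E + 2) * (C₃ * (s * U) + σ ^ 2 * (C₃ * (s * U)) * L ^ 5) := by gcongr
    _ = _ := by ring

end

/-! ### The theorem. -/

theorem theorem3 :
    ∃ c₀ : ℝ, 0 < c₀ ∧ ∃ K : ℕ,
      -- general frequencies
      (∀ c₁ c₂ cp B A : ℝ, 0 < c₁ → c₁ ≤ c₂ → 0 < cp →
        ∃ C : ℝ, 0 < C ∧ ∃ d₀ : ℕ,
          ∀ (d n k : ℕ) (hk : 1 ≤ k) (hkd : k ≤ d) (p βstar : Fin d → ℝ) (σ : ℝ),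
            d₀ ≤ d → SizeRegime K d n k →
            IsFeatureFrequency p →
            (∀ i, |βstar i| ≤ B) →
            0 ≤ σ → σ ≤ 1 →
            c₁ * Real.log d ^ 2 ≤ n * p ⟨k - 1, by omega⟩ →
            n * p ⟨k - 1, by omega⟩ ≤ c₂ * Real.log d ^ 2 →
            tailProb p k ≤ 1 - cp →
            n * tailProb p k ^ 2 < c₀ →
            (d : ℝ) ^ (-A) ≤ tailProb p k + σ ^ 2 →
            ENNReal.ofReal 0.99 ≤ dataLaw n p σ
              {ω | commonAveragedLoss k p βstar ω ≤
                C * (tailProb p k + σ ^ 2 * (k * Real.log d / n +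
                  ((k : ℝ) ^ 2 * Real.log d ^ 2 / n + Real.log d) *
                    tailProb p k * Real.log d))}) ∧
      -- power-law frequencies
      (∀ α c₁ c₂ B : ℝ, 2 < α → 0 < c₁ → c₁ ≤ c₂ →
        ∃ η : ℝ, 0 < η ∧ ∃ C : ℝ, 0 < C ∧ ∃ d₀ : ℕ,
          ∀ (d n k : ℕ) (hk : 1 ≤ k) (hkd : k ≤ d) (s : ℝ) (βstar : Fin d → ℝ) (σ : ℝ),
            d₀ ≤ d → SizeRegime K d n k →
            0 < s → s + Real.log d < (n : ℝ) ^ η →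
            (∀ i, |βstar i| ≤ B) →
            0 ≤ σ → σ ≤ 1 →
            c₁ * Real.log d ^ 2 ≤ n * powerLawFreq d α s ⟨k - 1, by omega⟩ →
            n * powerLawFreq d α s ⟨k - 1, by omega⟩ ≤ c₂ * Real.log d ^ 2 →
            ENNReal.ofReal 0.99 ≤ dataLaw n (powerLawFreq d α s) σ
              {ω | commonAveragedLoss k (powerLawFreq d α s) βstar ω ≤
                C * (s * (Real.log d ^ 2 / (n * s)) ^ (1 - 1 / α) +
                  σ ^ 2 * (Real.log d ^ 2 / (n * s)) ^ (1 - 1 / α) * s *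
                    Real.log d ^ 5)}) := by
  -- 1/1000 is what sparsity of the rare columns needs. The power 5 gives kL⁵ ≤ n, which leaves a
  -- factor L² beyond the threshold L⁻³ for near dependence.
  refine ⟨1 / 1000, by norm_num, 5, ?_, ?_⟩
  · intro c₁ c₂ cp B A hc₁ _ _
    obtain ⟨d₀, hd₀⟩ := exists_lossRate_bound (A := A) (B := B) hc₁
    refine ⟨4 * B ^ 2 + 6800, by positivity, d₀, fun d n k hk hkd p βstar σ hd hreg hp hβ _ _ h1 _ _
      hq hA => ?_⟩
    exact hd₀ d n k hk (by omega) p βstar σ hd hreg hp hβ h1 hq.le hA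
  · intro α c₁ c₂ B hα hc₁ hc₁₂
    obtain ⟨η, hη, C, hC, d₀, hd₀⟩ := exists_powerLaw_bound (B := B) hα hc₁ hc₁₂
    exact ⟨η, hη, C, hC, d₀, fun d n k hk hkd s βstar σ hd hreg hs hsn hβ _ _ h1 h2 =>
      hd₀ d n k hk (by omega) s βstar σ hd hreg hs hsn hβ h1 h2⟩
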